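/- Theorem 2.3 (Uniqueness). Let $\omega>0$, $B=(0,0,\omega)\in\mathbb R^3$, and let $f^{in}\in L^1\cap L^\infty(\mathbb R^3\times\mathbb R^3)$ be a probability density. For $f\in L^\infty_{loc}([0,\infty);L^1(\mathbb R^3\times\mathbb R^3))$ (that is, $f$ is measurable and for every $T>0$ the norms $\|f(t)\|_{L^1}$ are bounded for a.e. $t\in[0,T]$) put $$\rho_f(t,x)=\int_{\mathbb R^3}f(t,x,v)\,dv,\qquad E_f(t,x)=\frac1{4\pi}\int_{\mathbb R^3}\frac{x-y}{|x-y|^3}\,\rho_f(t,y)\,dy ,$$ so that $E_f$ is the Coulomb solution of $\operatorname{div}_xE=\rho_f$. Such an $f$ is called a weak solution of the Cauchy problem for the magnetized Vlasov–Poisson system $$\partial_tf+v\cdot\nabla_xf+(E_f+v\wedge B)\cdot\nabla_vf=0,\qquad f(0)=f^{in},$$ if $fE_f$ is locally integrable on $[0,\infty)\times\mathbb R^3\times\mathbb R^3$ and for every $\varphi\in C_c^\infty(\mathbb R\times\mathbb R^3\times\mathbb R^3)$ $$\int_0^\infty\!\!\iint f\,\bigl(\partial_t\varphi+v\cdot\nabla_x\varphi+(E_f+v\wedge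 B)\cdot\nabla_v\varphi\bigr)\,dx\,dv\,dt+\iint f^{in}(x,v)\,\varphi(0,x,v)\,dx\,dv=0 .$$ Then there is at most one weak solution $f$ such that $\rho_f\in L^\infty([0,T]\times\mathbb R^3)$ for every $T>0$: any two such solutions coincide almost everywhere on $[0,\infty)\times\mathbb R^3\times\mathbb R^3$. -/

import Mathlib

open MeasureTheory Set
open scoped Matrix

namespace VlasovPoisson

noncomputable section

/-- Physical space, and velocity space, with the Euclidean norm. -/
abbrev R3 : Type := EuclideanSpace ℝ (Fin 3)

/-- The constant uniform magnetic field `B = (0, 0, ω)`. -/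
def magneticField (ω : ℝ) : R3 := !₂[0, 0, ω]

/-- The vector product `v ∧ w` on Euclidean space. -/
def wedge (v w : R3) : R3 := WithLp.toLp 2 (v.ofLp ⨯₃ w.ofLp)

/-- The macroscopic density `ρ(t,x) = ∫ f(t,x,v) dv`. -/
def density (f : ℝ → R3 × R3 → ℝ) (t : ℝ) (x : R3) : ℝ :=
  ∫ v : R3, f t (x, v)

/-- The self-consistent electric field, i.e. the Coulomb solution of `div E = ρ`:
`E(t,x) = -(∇K ⋆ ρ(t))(x) = (1 / 4π) ∫ ρ(t,y) (x - y) / |x - y|³ dy`, with `K(x) = 1 / (4π |x|)`. -/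
def electricField (f : ℝ → R3 × R3 → ℝ) (t : ℝ) (x : R3) : R3 :=
  (1 / (4 * Real.pi)) • ∫ y : R3, (density f t y / ‖x - y‖ ^ 3) • (x - y)

/-- Probability densities on phase space `ℝ³ × ℝ³`. -/
structure IsProbabilityDensity (g : R3 × R3 → ℝ) : Prop where
  nonneg : ∀ᵐ z : R3 × R3, 0 ≤ g z
  integrable : Integrable g
  integral_eq_one : ∫ z : R3 × R3, g z = 1

/-- `f ∈ L^∞_loc([0,∞); L¹(ℝ³ × ℝ³))` is a weak (distributional) solution on `[0,∞)` of the Cauchy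
problem for the Vlasov–Poisson system with magnetic field `B = (0, 0, ω)` and initial datum `fin`.
Only the values of `f` at times `t ≥ 0` matter. -/
structure IsWeakSolution (ω : ℝ) (fin : R3 × R3 → ℝ) (f : ℝ → R3 × R3 → ℝ) : Prop where
  /-- Joint measurability in `(t, x, v)`. -/
  measurable : AEStronglyMeasurable (Function.uncurry f) (volume.restrict (Ici 0 ×ˢ univ))
  /-- `f ∈ L^∞([0,T]; L¹)` for every `T`. -/
  mass_bound : ∀ T : ℝ, 0 < T → ∃ C : ℝ, ∀ᵐ t ∂(volume.restrict (Icc 0 T)),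
    eLpNorm (f t) 1 volume ≤ ENNReal.ofReal C
  /-- The product `f E` is locally integrable, so that the weak formulation makes sense. -/
  force_locallyIntegrable : LocallyIntegrableOn
    (fun p : ℝ × R3 × R3 => f p.1 p.2 • electricField f p.1 p.2.1) (Ici 0 ×ˢ univ) volume
  /-- The Vlasov equation and the initial condition, tested against `φ ∈ C_c^∞([0,∞) × ℝ³ × ℝ³)`.
  The derivative of `φ` at `(t, x, v)` in the direction `(1, v, E + v ∧ B)` is
  `∂_t φ + v · ∇_x φ + (E + v ∧ B) · ∇_v φ`, and `div_v (E + v ∧ B) = 0`. -/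
  weak_eq : ∀ φ : ℝ × R3 × R3 → ℝ, ContDiff ℝ (⊤ : ℕ∞) φ → HasCompactSupport φ →
    (∫ p in Ici (0 : ℝ) ×ˢ (univ : Set (R3 × R3)),
        f p.1 p.2 * fderiv ℝ φ p
          (1, p.2.2, electricField f p.1 p.2.1 + wedge p.2.2 (magneticField ω)))
      + ∫ z : R3 × R3, fin z * φ (0, z) = 0

/-- `ρ ∈ L^∞([0,T] × ℝ³)` for every `T > 0`. -/
def HasBoundedDensity (f : ℝ → R3 × R3 → ℝ) : Prop :=
  ∀ T : ℝ, 0 < T →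
    MemLp (fun p : ℝ × R3 => density f p.1 p.2) ⊤ (volume.restrict (Icc 0 T ×ˢ univ))

end

end VlasovPoisson

set_option linter.unusedSectionVars false

namespace VlasovPoisson

open Filter Topology Real
open scoped NNReal ENNReal Convolution

/-! ### An integral Grönwall inequality -/

/-! The proof is Lagrangian. A source `ρ` in `L¹ ∩ L^∞` generates a bounded Coulomb field satisfying
`|E(x) - E(x')| ≤ C n (|x - x'| + e^{-n})` for every `n ≥ 1`. Taking `n` of order `|log |x - x'||`
recovers the usual log-Lipschitz modulus `r |log r|`, but keeping `n` free turns every Osgood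
argument into a linear Grönwall argument with a parameter. The parameter moves with time: for `n(t)
= N e^{2C(S-t)}` the Grönwall rate `C n` has primitive `-n/2`, so the growth factor `e^{n/2}` is
beaten by the error `e^{-n}`, and what remains is at most a constant times `e^{-N/2}`. Letting `N →
∞` reaches any final time `S` in one step. The lemmas are `osgood_integral` and
`osgood_integral_zero`.

With the field of a given weak solution frozen, the equation is a linear transport equation with
log-Lipschitz coefficients. It has unique characteristics (`exists_isSolution`,
`IsSolution.unique`), and `f(t)` is the image of the initial datum under them. This representation
(`IsLinearWeakSolution.integral_mul_eq`) is proved by duality: the field is replaced by a field with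
Lipschitz constant `C' n(t)` at distance `C' n(t) e^{-n(t)}`, the backward transport problem for the
new field is solved along its flow, and the solution is used as a Lipschitz test function. Its
spatial gradient grows like `e^{(n(t)-N)/2}`, which the field error again compensates. No regularity
of `f` is needed, and its nonnegativity is a consequence: the identity reads `f⁺ = (transported
datum) + f⁻`, which forces `f⁻ = 0`.

For two solutions with flows `Z₁`, `Z₂` and common initial measure `m₀`, both fields are averages of
the Coulomb kernel over `m₀`, so `E₁ - E₂` is an average of kernel differences. Evaluating it along
`Z₂` and integrating against `m₀` replaces the evaluation point by an integration against the
bounded density of the second solution. Tonelli's theorem and the log-Lipschitz kernel estimate then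
give `∫ |E₁ - E₂|(X₂) dm₀ ≤ C n ∫ (|Z₁ - Z₂| + e^{-n}) dm₀` (`lintegral_coulombField_sub_comp_le`).
Hence `∫ |Z₁ - Z₂| dm₀` satisfies the Osgood inequality with zero initial value and vanishes
(`ae_trajectory_eq`). Both solutions are then images of the same measure under the same flow. -/

theorem gronwall_integral_of_continuous {u w ℓ σ Λ : ℝ → ℝ} {a t₀ S : ℝ}
    (hℓ : Continuous ℓ) (hσ : Continuous σ) (hℓ0 : ∀ t, 0 ≤ ℓ t)
    (hΛ : ∀ t, HasDerivAt Λ (ℓ t) t) (hw : Continuous w)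
    (huw : ∀ t ∈ Icc t₀ S, u t ≤ w t)
    (hu : ∀ t ∈ Icc t₀ S, w t ≤ a + ∫ s in t₀..t, (ℓ s * w s + σ s)) :
    ∀ t ∈ Icc t₀ S,
      u t ≤ exp (Λ t) * (exp (-Λ t₀) * a + ∫ s in t₀..t, σ s * exp (-Λ s)) := by
  have hΛc : Continuous Λ := continuous_iff_continuousAt.2 fun t => (hΛ t).continuousAt
  set W : ℝ → ℝ := fun t => a + ∫ s in t₀..t, (ℓ s * w s + σ s) with hW
  have hWd : ∀ t, HasDerivAt W (ℓ t * w t + σ t) t := fun t => by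
    have hc : Continuous fun s => ℓ s * w s + σ s := by fun_prop
    exact (intervalIntegral.integral_hasDerivAt_right (hc.intervalIntegrable _ _)
      (hc.stronglyMeasurableAtFilter _ _) hc.continuousAt).const_add a
  have hIc : Continuous fun s => σ s * exp (-Λ s) := by fun_prop
  -- `H` is nonincreasing on `[t₀, S]`: its derivative is `e^{-Λ} ℓ (w - W)`, and `w ≤ W` there.
  set H : ℝ → ℝ := fun t => exp (-Λ t) * W t - ∫ s in t₀..t, σ s * exp (-Λ s) with hH
  have hHd : ∀ t, HasDerivAt H (exp (-Λ t) * ℓ t * (w t - W t)) t := fun t => by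
    have h1 : HasDerivAt (fun t => exp (-Λ t)) (exp (-Λ t) * (-ℓ t)) t := (hΛ t).neg.exp
    have h2 := (h1.mul (hWd t)).sub (intervalIntegral.integral_hasDerivAt_right
      (hIc.intervalIntegrable t₀ t) (hIc.stronglyMeasurableAtFilter _ _) hIc.continuousAt)
    refine h2.congr_deriv ?_
    ring
  have hanti : AntitoneOn H (Icc t₀ S) := by
    refine antitoneOn_of_deriv_nonpos (convex_Icc _ _)
      (fun t _ => (hHd t).continuousAt.continuousWithinAt)
      (fun t _ => (hHd t).differentiableAt.differentiableWithinAt) fun t ht => ?_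
    rw [interior_Icc] at ht
    rw [(hHd t).deriv]
    have := hu t (Ioo_subset_Icc_self ht)
    exact mul_nonpos_of_nonneg_of_nonpos (mul_nonneg (exp_pos _).le (hℓ0 t)) (sub_nonpos.2 this)
  intro t ht
  have h0 := hanti (left_mem_Icc.2 (ht.1.trans ht.2)) ht ht.1
  simp only [hH, hW, intervalIntegral.integral_same, add_zero, sub_zero] at h0
  have h1 : exp (-Λ t) * W t ≤ exp (-Λ t₀) * a + ∫ s in t₀..t, σ s * exp (-Λ s) := by
    simp only [hW]; linarith
  calc u t ≤ W t := (huw t ht).trans (hu t ht)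
    _ = exp (Λ t) * (exp (-Λ t) * W t) := by
      rw [← mul_assoc, ← exp_add, add_neg_cancel, exp_zero, one_mul]
    _ ≤ _ := mul_le_mul_of_nonneg_left h1 (exp_pos _).le

/-- Grönwall's inequality in integral form, with variable coefficients, for a function which is
only assumed to be integrable. -/
theorem gronwall_integral {u ℓ σ Λ : ℝ → ℝ} {a t₀ S : ℝ}
    (hℓ : Continuous ℓ) (hσ : Continuous σ) (hℓ0 : ∀ t, 0 ≤ ℓ t)
    (hΛ : ∀ t, HasDerivAt Λ (ℓ t) t) (hui : IntegrableOn u (Icc t₀ S))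
    (hu : ∀ t ∈ Icc t₀ S, u t ≤ a + ∫ s in t₀..t, (ℓ s * u s + σ s)) :
    ∀ t ∈ Icc t₀ S,
      u t ≤ exp (Λ t) * (exp (-Λ t₀) * a + ∫ s in t₀..t, σ s * exp (-Λ s)) := by
  -- Cutting `u` off outside `[t₀, S]` makes the primitive `w` continuous on the whole line. It lies
  -- above `u`, so it satisfies the same integral inequality because `ℓ ≥ 0`.
  set u₁ : ℝ → ℝ := (Icc t₀ S).indicator u with hu₁
  have hu₁i : Integrable u₁ := (integrable_indicator_iff measurableSet_Icc).2 hui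
  have hint : ∀ c d, IntervalIntegrable (fun s => ℓ s * u₁ s + σ s) volume c d := fun c d =>
    ((hu₁i.intervalIntegrable).continuousOn_mul hℓ.continuousOn).add (hσ.intervalIntegrable _ _)
  set w : ℝ → ℝ := fun t => a + ∫ s in t₀..t, (ℓ s * u₁ s + σ s) with hw
  have hwc : Continuous w := continuous_const.add (intervalIntegral.continuous_primitive hint _)
  have huw : ∀ t ∈ Icc t₀ S, u t ≤ w t := fun t ht => by
    refine (hu t ht).trans_eq ?_
    simp only [hw]
    congr 1
    refine intervalIntegral.integral_congr fun s hs => ?_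
    rw [uIcc_of_le ht.1] at hs
    have : s ∈ Icc t₀ S := ⟨hs.1, hs.2.trans ht.2⟩
    simp only [hu₁, indicator_of_mem this]
  refine gronwall_integral_of_continuous hℓ hσ hℓ0 hΛ hwc huw fun t ht => ?_
  simp only [hw]
  have hwc' : Continuous fun s => ℓ s * w s + σ s := by fun_prop
  refine add_le_add le_rfl (intervalIntegral.integral_mono_on ht.1 (hint _ _)
    (hwc'.intervalIntegrable _ _) fun s hs => ?_)
  have hs' : s ∈ Icc t₀ S := ⟨hs.1, hs.2.trans ht.2⟩
  simp only [hu₁, indicator_of_mem hs']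
  have := mul_le_mul_of_nonneg_left (huw s hs') (hℓ0 s)
  simp only [hw] at this
  exact add_le_add this le_rfl

theorem gronwall_integral_const {u : ℝ → ℝ} {a t₀ S L σ : ℝ} (hL : 0 ≤ L) (hσ : 0 ≤ σ)
    (hui : IntegrableOn u (Icc t₀ S))
    (hu : ∀ t ∈ Icc t₀ S, u t ≤ a + ∫ s in t₀..t, (L * u s + σ)) :
    ∀ t ∈ Icc t₀ S, u t ≤ exp (L * (t - t₀)) * (a + σ * (t - t₀)) := by
  intro t ht
  have h := gronwall_integral (ℓ := fun _ => L) (σ := fun _ => σ) (Λ := fun t => L * (t - t₀))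
    continuous_const continuous_const (fun _ => hL)
    (fun t => by simpa using ((hasDerivAt_id t).sub_const t₀).const_mul L) hui hu t ht
  refine h.trans (mul_le_mul_of_nonneg_left ?_ (exp_pos _).le)
  simp only [sub_self, mul_zero, neg_zero, exp_zero, one_mul]
  gcongr
  have hc : Continuous fun s : ℝ => σ * exp (-(L * (s - t₀))) := by fun_prop
  calc ∫ s in t₀..t, σ * exp (-(L * (s - t₀))) ≤ ∫ _s in t₀..t, σ := by
        refine intervalIntegral.integral_mono_on ht.1 (hc.intervalIntegrable _ _)
          (by simp) fun s hs => ?_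
        have : exp (-(L * (s - t₀))) ≤ 1 :=
          exp_le_one_iff.2 (neg_nonpos.2 (mul_nonneg hL (sub_nonneg.2 hs.1)))
        exact mul_le_of_le_one_right hσ this
    _ = σ * (t - t₀) := by simp [mul_comm]

/-! ### Osgood's inequality with a moving cutoff. -/

/-- The time-dependent regularisation parameter used to exploit log-Lipschitz bounds up to an
arbitrary time `S`. -/
noncomputable def scale (C S N : ℝ) (t : ℝ) : ℝ := N * exp (2 * C * (S - t))

theorem scale_pos {C S N : ℝ} (hN : 0 < N) (t : ℝ) : 0 < scale C S N t :=
  mul_pos hN (exp_pos _)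

theorem le_scale {C S N : ℝ} (hC : 0 ≤ C) (hN : 0 ≤ N) {t : ℝ} (ht : t ≤ S) :
    N ≤ scale C S N t :=
  le_mul_of_one_le_right hN (one_le_exp (by have := sub_nonneg.2 ht; positivity))

theorem scale_anti {C S N : ℝ} (hC : 0 ≤ C) (hN : 0 ≤ N) {s t : ℝ} (h : s ≤ t) :
    scale C S N t ≤ scale C S N s := by
  unfold scale; gcongr

/-- The factor 2 in the exponent is chosen so that `-scale / 2` is a primitive of the Grönwall rate
`C * scale`. -/
theorem hasDerivAt_scale (C S N t : ℝ) :
    HasDerivAt (scale C S N) (-(2 * C * scale C S N t)) t := by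
  have h : HasDerivAt (fun t => 2 * C * (S - t)) (2 * C * (-1)) t :=
    ((hasDerivAt_id t).const_sub S).const_mul _
  refine ((h.exp).const_mul N).congr_deriv ?_
  simp only [scale]; ring

theorem continuous_scale (C S N : ℝ) : Continuous (scale C S N) := by
  unfold scale; fun_prop

theorem self_mul_exp_neg_half_le_one {x : ℝ} (hx : 0 ≤ x) : x * exp (-(x / 2)) ≤ 1 := by
  rw [exp_neg, ← div_eq_mul_inv, div_le_one (exp_pos _)]
  nlinarith [quadratic_le_exp_of_nonneg (div_nonneg hx zero_le_two)]

/-- Osgood's lemma for the modulus `r ↦ inf_n n (r + e^{-n})`, in quantitative form. -/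
theorem osgood_integral {u : ℝ → ℝ} {a t₀ S C N σ : ℝ} (hC : 0 ≤ C) (hN : 0 < N) (hσ : 0 ≤ σ)
    (hui : IntegrableOn u (Icc t₀ S))
    (hu : ∀ t ∈ Icc t₀ S, u t ≤ a + ∫ s in t₀..t,
      C * scale C S N s * (u s + σ * exp (-scale C S N s))) :
    ∀ t ∈ Icc t₀ S, u t ≤ exp ((scale C S N t₀ - scale C S N t) / 2) * a
      + σ * C * (S - t₀) * exp (-(N / 2)) := by
  intro t ht
  have hsc := continuous_scale C S N
  -- The source term `C n σ e^{-n}` is weighted by `e^{-Λ} = e^{n/2}`. The remaining `e^{-n/2}`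
  -- absorbs the factor `n`, and the prefactor `e^{Λ(t)} = e^{-n(t)/2}` is at most `e^{-N/2}` since
  -- `n ≥ N` before `S`.
  have h := gronwall_integral (u := u) (ℓ := fun s => C * scale C S N s)
    (σ := fun s => C * scale C S N s * (σ * exp (-scale C S N s)))
    (Λ := fun s => -(scale C S N s / 2)) (a := a) (t₀ := t₀) (S := S)
    (by fun_prop) (by fun_prop) (fun t => mul_nonneg hC (scale_pos hN t).le)
    (fun t => by
      refine ((hasDerivAt_scale C S N t).div_const 2).neg.congr_deriv ?_; ring) hui
    (fun t ht => by simpa only [mul_add] using hu t ht) t ht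
  refine h.trans ?_
  rw [mul_add, ← mul_assoc, ← exp_add]
  have hI : ∫ s in t₀..t, C * scale C S N s * (σ * exp (-scale C S N s))
      * exp (- -(scale C S N s / 2)) ≤ σ * C * (S - t₀) := by
    calc _ ≤ ∫ _s in t₀..t, σ * C := by
          refine intervalIntegral.integral_mono_on ht.1
            ((by fun_prop : Continuous _).intervalIntegrable _ _) (by simp) fun s hs => ?_
          have h1 := self_mul_exp_neg_half_le_one (scale_pos (C := C) (S := S) hN s).le
          calc _ = σ * C * (scale C S N s * (exp (-scale C S N s)
                * exp (- -(scale C S N s / 2)))) := by ring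
            _ = σ * C * (scale C S N s * exp (-(scale C S N s / 2))) := by
                rw [← exp_add]; congr 3; ring
            _ ≤ _ := mul_le_of_le_one_right (by positivity) h1
      _ = σ * C * (t - t₀) := by simp; ring
      _ ≤ _ := by have := ht.2; gcongr
  have h2 : exp (-(scale C S N t / 2)) ≤ exp (-(N / 2)) :=
    exp_le_exp.2 (by have := le_scale hC hN.le ht.2; linarith)
  have h3 : 0 ≤ σ * C * (S - t₀) := by
    have := sub_nonneg.2 (ht.1.trans ht.2); positivity
  refine add_le_add (le_of_eq ?_) ?_
  · congr 2; ring
  · calc _ ≤ exp (-(scale C S N t / 2)) * (σ * C * (S - t₀)) :=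
          mul_le_mul_of_nonneg_left hI (exp_pos _).le
      _ ≤ exp (-(N / 2)) * (σ * C * (S - t₀)) := mul_le_mul_of_nonneg_right h2 h3
      _ = _ := mul_comm _ _

theorem tendsto_const_mul_exp_neg_half (c : ℝ) :
    Tendsto (fun N : ℝ => c * exp (-(N / 2))) atTop (𝓝 0) := by
  have : Tendsto (fun N : ℝ => exp (-(N / 2))) atTop (𝓝 0) :=
    tendsto_exp_neg_atTop_nhds_zero.comp (tendsto_id.atTop_div_const two_pos)
  simpa using this.const_mul c

/-- Osgood's lemma with zero initial value. -/
theorem osgood_integral_zero {u : ℝ → ℝ} {t₀ S C : ℝ} (hC : 0 ≤ C)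
    (hui : IntegrableOn u (Icc t₀ S))
    (hu : ∀ N : ℝ, 1 ≤ N → ∀ t ∈ Icc t₀ S, u t ≤ ∫ s in t₀..t,
      C * scale C S N s * (u s + exp (-scale C S N s))) :
    ∀ t ∈ Icc t₀ S, u t ≤ 0 := by
  intro t ht
  refine ge_of_tendsto (tendsto_const_mul_exp_neg_half (C * (S - t₀))) ?_
  filter_upwards [eventually_ge_atTop 1] with N hN
  have h := osgood_integral (a := 0) (σ := 1) hC (one_pos.trans_le hN) zero_le_one hui
    (fun t ht => by simpa using hu N hN t ht) t ht
  simpa using h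

/-! ### Carathéodory solutions for log-Lipschitz vector fields -/

section Flow

variable {F : Type*} [NormedAddCommGroup F] [NormedSpace ℝ F] [MeasurableSpace F] [BorelSpace F]

/-- Time-dependent vector fields, measurable in time, with linear growth and a log-Lipschitz
modulus of continuity `r ↦ C inf_{n ≥ 1} n (r + e^{-n})`. -/
structure LogLipschitzField (C A : ℝ) (b : ℝ → F → F) : Prop where
  measurable : Measurable (Function.uncurry b)
  nonneg : 0 ≤ C
  nonneg_growth : 0 ≤ A
  growth : ∀ t z, ‖b t z‖ ≤ A * (1 + ‖z‖)
  modulus : ∀ t z z' n, 1 ≤ n → ‖b t z - b t z'‖ ≤ C * n * (‖z - z'‖ + exp (-n))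

/-- Solutions of `Z' = b(t, Z)`, `Z(t₀) = z`, forward in time, in integral form. -/
structure IsSolution (b : ℝ → F → F) (t₀ : ℝ) (z : F) (Z : ℝ → F) : Prop where
  continuous : Continuous Z
  eq : ∀ s, t₀ ≤ s → Z s = z + ∫ r in t₀..s, b r (Z r)

theorem exists_mul_exp_neg_lt (C : ℝ) {ε : ℝ} (hε : 0 < ε) :
    ∃ n : ℝ, 1 ≤ n ∧ C * n * exp (-n) < ε := by
  have h : Tendsto (fun n : ℝ => C * (n ^ 1 * exp (-n))) atTop (𝓝 (C * 0)) :=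
    (tendsto_pow_mul_exp_neg_atTop_nhds_zero 1).const_mul C
  rw [mul_zero] at h
  obtain ⟨n, h1, h2⟩ := ((h.eventually (gt_mem_nhds hε)).and (eventually_ge_atTop 1)).exists
  exact ⟨n, h2, by simpa [mul_assoc] using h1⟩

namespace LogLipschitzField

variable {C A : ℝ} {b : ℝ → F → F}

theorem continuous (hb : LogLipschitzField C A b) (t : ℝ) : Continuous (b t) := by
  refine Metric.continuous_iff.2 fun z ε hε => ?_
  obtain ⟨n, hn, hlt⟩ := exists_mul_exp_neg_lt C (half_pos hε)
  have hC := hb.nonneg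
  refine ⟨ε / 2 / (C * n + 1), by positivity, fun z' hz' => ?_⟩
  rw [dist_eq_norm] at hz' ⊢
  have h1 : C * n * ‖z' - z‖ ≤ ε / 2 := by
    rw [lt_div_iff₀ (by positivity)] at hz'
    nlinarith [norm_nonneg (z' - z)]
  calc _ ≤ C * n * (‖z' - z‖ + exp (-n)) := hb.modulus t z' z n hn
    _ < ε := by rw [mul_add]; linarith

variable [SecondCountableTopology F]

theorem intervalIntegrable (hb : LogLipschitzField C A b) {Z : ℝ → F} (hZ : Continuous Z)
    (s t : ℝ) : IntervalIntegrable (fun r => b r (Z r)) volume s t := by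
  have hm : Measurable fun r => b r (Z r) :=
    hb.measurable.comp (measurable_id.prodMk hZ.measurable)
  have hc : Continuous fun r => A * (1 + ‖Z r‖) := by fun_prop
  exact (hc.intervalIntegrable s t).mono_fun hm.aestronglyMeasurable
    (ae_of_all _ fun r => (hb.growth r (Z r)).trans (le_abs_self _))

end LogLipschitzField

namespace IsSolution

variable {C A : ℝ} {b : ℝ → F → F} {t₀ : ℝ} {z : F} {Z : ℝ → F}

theorem initial (hZ : IsSolution b t₀ z Z) : Z t₀ = z := by
  simpa using hZ.eq t₀ le_rfl

variable [SecondCountableTopology F]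

theorem sub_eq (hb : LogLipschitzField C A b) (hZ : IsSolution b t₀ z Z) {s t : ℝ}
    (hs : t₀ ≤ s) (hst : s ≤ t) : Z t - Z s = ∫ r in s..t, b r (Z r) := by
  rw [hZ.eq t (hs.trans hst), hZ.eq s hs, add_sub_add_left_eq_sub,
    intervalIntegral.integral_interval_sub_left (hb.intervalIntegrable hZ.continuous _ _)
      (hb.intervalIntegrable hZ.continuous _ _)]

theorem restart (hb : LogLipschitzField C A b) (hZ : IsSolution b t₀ z Z) {t₁ : ℝ}
    (h : t₀ ≤ t₁) : IsSolution b t₁ (Z t₁) Z :=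
  ⟨hZ.continuous, fun s hs => by rw [← hZ.sub_eq hb h hs, add_sub_cancel]⟩

theorem one_add_norm_le (hb : LogLipschitzField C A b) (hZ : IsSolution b t₀ z Z) {s : ℝ}
    (hs : t₀ ≤ s) : 1 + ‖Z s‖ ≤ exp (A * (s - t₀)) * (1 + ‖z‖) := by
  have hcZ := hZ.continuous
  have hc : Continuous fun r => 1 + ‖Z r‖ := by fun_prop
  have h := gronwall_integral_const (u := fun r => 1 + ‖Z r‖) (a := 1 + ‖z‖) (S := s) (σ := 0)
    hb.nonneg_growth le_rfl (hc.continuousOn.integrableOn_Icc) (fun t ht => ?_) s ⟨hs, le_rfl⟩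
  · simpa using h
  · rw [hZ.eq t ht.1]
    have h1 : ‖∫ r in t₀..t, b r (Z r)‖ ≤ ∫ r in t₀..t, A * (1 + ‖Z r‖) :=
      intervalIntegral.norm_integral_le_of_norm_le ht.1
        (ae_of_all _ fun r _ => hb.growth r (Z r))
        ((by fun_prop : Continuous fun r => A * (1 + ‖Z r‖)).intervalIntegrable _ _)
    simp only [add_zero]
    linarith [norm_add_le z (∫ r in t₀..t, b r (Z r))]

/-- Grönwall run backward from time `s`. It shows that a trajectory visiting a ball must have
started in a controlled ball, which gives compact support to solutions of the backward problem. -/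
theorem one_add_norm_initial_le (hb : LogLipschitzField C A b) (hZ : IsSolution b t₀ z Z) {s : ℝ}
    (hs : t₀ ≤ s) : 1 + ‖z‖ ≤ exp (A * (s - t₀)) * (1 + ‖Z s‖) := by
  have hcZ := hZ.continuous
  have hc : Continuous fun r => 1 + ‖Z (s - r)‖ := by fun_prop
  have h := gronwall_integral_const (u := fun r => 1 + ‖Z (s - r)‖) (a := 1 + ‖Z s‖) (t₀ := 0)
    (S := s - t₀) (σ := 0)
    hb.nonneg_growth le_rfl (hc.continuousOn.integrableOn_Icc) (fun t ht => ?_)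
    (s - t₀) ⟨sub_nonneg.2 hs, le_rfl⟩
  · simpa [hZ.initial] using h
  · have h0 := hZ.sub_eq hb (s := s - t) (t := s) (by linarith [ht.2]) (by linarith [ht.1])
    have h1 : ‖∫ r in (s - t)..s, b r (Z r)‖ ≤ ∫ r in (s - t)..s, A * (1 + ‖Z r‖) :=
      intervalIntegral.norm_integral_le_of_norm_le (by linarith [ht.1])
        (ae_of_all _ fun r _ => hb.growth r (Z r))
        ((by fun_prop : Continuous fun r => A * (1 + ‖Z r‖)).intervalIntegrable _ _)
    have h2 : ∫ r in (0 : ℝ)..t, (A * (1 + ‖Z (s - r)‖) + 0)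
        = ∫ r in (s - t)..s, A * (1 + ‖Z r‖) := by
      have := intervalIntegral.integral_comp_sub_left (a := 0) (b := t)
        (fun r => A * (1 + ‖Z r‖)) s
      simpa using this
    rw [h2]
    have h3 : ‖Z (s - t)‖ ≤ ‖Z s‖ + ‖Z s - Z (s - t)‖ := by
      have := norm_sub_le (Z s) (Z s - Z (s - t)); simpa using this
    rw [h0] at h3
    linarith

theorem norm_sub_le_integral {C' A' : ℝ} {b' : ℝ → F → F} {z' : F} {Z' : ℝ → F}
    (hb : LogLipschitzField C A b) (hb' : LogLipschitzField C' A' b')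
    (hZ : IsSolution b t₀ z Z) (hZ' : IsSolution b' t₀ z' Z') {s : ℝ} (hs : t₀ ≤ s) :
    ‖Z s - Z' s‖ ≤ ‖z - z'‖ + ∫ r in t₀..s, ‖b r (Z r) - b' r (Z' r)‖ := by
  rw [hZ.eq s hs, hZ'.eq s hs, add_sub_add_comm, ← intervalIntegral.integral_sub
    (hb.intervalIntegrable hZ.continuous _ _) (hb'.intervalIntegrable hZ'.continuous _ _)]
  exact (norm_add_le _ _).trans
    (add_le_add le_rfl (intervalIntegral.norm_integral_le_integral_norm hs))

theorem norm_sub_le_of_le {C' A' : ℝ} {b' : ℝ → F → F} {z' : F} {Z' : ℝ → F} {g : ℝ → ℝ}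
    (hb : LogLipschitzField C A b) (hb' : LogLipschitzField C' A' b')
    (hZ : IsSolution b t₀ z Z) (hZ' : IsSolution b' t₀ z' Z') {s : ℝ} (hs : t₀ ≤ s)
    (hg : Continuous g) (h : ∀ r ∈ Icc t₀ s, ‖b r (Z r) - b' r (Z' r)‖ ≤ g r) :
    ‖Z s - Z' s‖ ≤ ‖z - z'‖ + ∫ r in t₀..s, g r := by
  refine (norm_sub_le_integral hb hb' hZ hZ' hs).trans (add_le_add le_rfl ?_)
  exact intervalIntegral.integral_mono_on hs
    ((hb.intervalIntegrable hZ.continuous _ _).sub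
      (hb'.intervalIntegrable hZ'.continuous _ _)).norm (hg.intervalIntegrable _ _) h

/-- Comparison of a solution for the field `b` with one for a field `b'` which is close to `b` at
the scale `e^{-scale}`. -/
theorem norm_sub_le_scale {C₀ C' A' : ℝ} {b' : ℝ → F → F} {z' : F} {Z' : ℝ → F} {S N σ : ℝ}
    (hb : LogLipschitzField C A b) (hb' : LogLipschitzField C' A' b')
    (hZ : IsSolution b t₀ z Z) (hZ' : IsSolution b' t₀ z' Z')
    (hC₀ : 0 ≤ C₀) (hN : 0 < N) (hσ : 0 ≤ σ)
    (h : ∀ r ∈ Icc t₀ S, ‖b r (Z r) - b' r (Z' r)‖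
      ≤ C₀ * scale C₀ S N r * (‖Z r - Z' r‖ + σ * exp (-scale C₀ S N r))) :
    ∀ t ∈ Icc t₀ S, ‖Z t - Z' t‖ ≤ exp ((scale C₀ S N t₀ - scale C₀ S N t) / 2) * ‖z - z'‖
      + σ * C₀ * (S - t₀) * exp (-(N / 2)) := by
  have hZc := hZ.continuous
  have hZc' := hZ'.continuous
  have hsc := continuous_scale C₀ S N
  refine osgood_integral hC₀ hN hσ
    ((by fun_prop : Continuous fun r => ‖Z r - Z' r‖).continuousOn.integrableOn_Icc)
    fun t ht => ?_
  exact norm_sub_le_of_le hb hb' hZ hZ' ht.1 (by fun_prop)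
    fun r hr => h r ⟨hr.1, hr.2.trans ht.2⟩

/-- The second term does not involve the initial points. Fixing a large `N` and then letting `z' →
z` gives continuity of the flow; taking `z' = z` and letting `N → ∞` gives uniqueness. -/
theorem norm_sub_le (hb : LogLipschitzField C A b) {z' : F} {Z' : ℝ → F}
    (hZ : IsSolution b t₀ z Z) (hZ' : IsSolution b t₀ z' Z') {N s : ℝ} (hN : 1 ≤ N)
    (hs : t₀ ≤ s) :
    ‖Z s - Z' s‖ ≤ exp (scale C s N t₀ / 2) * ‖z - z'‖
      + C * (s - t₀) * exp (-(N / 2)) := by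
  have hN0 := one_pos.trans_le hN
  have h := norm_sub_le_scale (S := s) (N := N) (σ := 1) hb hb hZ hZ' hb.nonneg hN0
    zero_le_one (fun r hr => by
      simpa using hb.modulus r (Z r) (Z' r) _ (hN.trans (le_scale hb.nonneg hN0.le hr.2)))
    s ⟨hs, le_rfl⟩
  rw [one_mul] at h
  refine h.trans (add_le_add (mul_le_mul_of_nonneg_right (exp_le_exp.2 ?_) (norm_nonneg _)) le_rfl)
  linarith [scale_pos (C := C) (S := s) hN0 s]

theorem unique (hb : LogLipschitzField C A b) {Z' : ℝ → F}
    (hZ : IsSolution b t₀ z Z) (hZ' : IsSolution b t₀ z Z') {s : ℝ} (hs : t₀ ≤ s) :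
    Z s = Z' s := by
  rw [← sub_eq_zero, ← norm_le_zero_iff]
  refine ge_of_tendsto (tendsto_const_mul_exp_neg_half (C * (s - t₀))) ?_
  filter_upwards [eventually_ge_atTop 1] with N hN
  simpa using norm_sub_le hb hZ hZ' hN hs

end IsSolution

/-! ### Existence of characteristics by Picard iteration. -/

/-- Picard iterates, frozen before the initial time. -/
noncomputable def picard (b : ℝ → F → F) (t₀ : ℝ) (z : F) : ℕ → ℝ → F
  | 0 => fun _ => z
  | k + 1 => fun s => z + ∫ r in t₀..max t₀ s, b r (picard b t₀ z k r)

section Picard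

variable [SecondCountableTopology F]
variable {C A : ℝ} {b : ℝ → F → F}

theorem continuous_picard (hb : LogLipschitzField C A b) (t₀ : ℝ) (z : F) (k : ℕ) :
    Continuous (picard b t₀ z k) := by
  induction k with
  | zero => exact continuous_const
  | succ k ih =>
    exact continuous_const.add ((intervalIntegral.continuous_primitive
      (fun c d => hb.intervalIntegrable ih c d) t₀).comp (continuous_const.max continuous_id))

theorem one_add_norm_picard_le (hb : LogLipschitzField C A b) (t₀ : ℝ) (z : F) (k : ℕ) (s : ℝ) :
    1 + ‖picard b t₀ z k s‖ ≤ exp (A * (max t₀ s - t₀)) * (1 + ‖z‖) := by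
  have hA := hb.nonneg_growth
  induction k generalizing s with
  | zero =>
    refine le_mul_of_one_le_left (by positivity) (one_le_exp ?_)
    have := le_max_left t₀ s
    have := sub_nonneg.2 this
    positivity
  | succ k ih =>
    have hle := le_max_left t₀ s
    have hc : Continuous fun r => A * (exp (A * (r - t₀)) * (1 + ‖z‖)) := by fun_prop
    have h1 : ‖∫ r in t₀..max t₀ s, b r (picard b t₀ z k r)‖
        ≤ ∫ r in t₀..max t₀ s, A * (exp (A * (r - t₀)) * (1 + ‖z‖)) := by
      refine intervalIntegral.norm_integral_le_of_norm_le hle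
        (ae_of_all _ fun r hr => (hb.growth r _).trans ?_) (hc.intervalIntegrable _ _)
      have := ih r
      rw [max_eq_right hr.1.le] at this
      gcongr
    have h2 : ∫ r in t₀..max t₀ s, A * (exp (A * (r - t₀)) * (1 + ‖z‖))
        = exp (A * (max t₀ s - t₀)) * (1 + ‖z‖) - (1 + ‖z‖) := by
      rw [intervalIntegral.integral_eq_sub_of_hasDerivAt
        (f := fun r => exp (A * (r - t₀)) * (1 + ‖z‖))]
      · simp
      · intro r _
        refine ((((hasDerivAt_id r).sub_const t₀).const_mul A).exp.mul_const _).congr_deriv ?_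
        simp; ring
      · exact hc.intervalIntegrable _ _
    have h3 := norm_add_le z (∫ r in t₀..max t₀ s, b r (picard b t₀ z k r))
    simp only [picard]
    linarith

/-- Oscillation of the tail of the sequence of Picard iterates. -/
noncomputable def picardOsc (b : ℝ → F → F) (t₀ : ℝ) (z : F) (k : ℕ) (s : ℝ) : ℝ :=
  ⨆ p : ℕ × ℕ, ‖picard b t₀ z (k + p.1) s - picard b t₀ z (k + p.2) s‖

theorem norm_picard_sub_le (hb : LogLipschitzField C A b) (t₀ : ℝ) (z : F) (i j : ℕ) (s : ℝ) :
    ‖picard b t₀ z i s - picard b t₀ z j s‖ ≤ 2 * (exp (A * (max t₀ s - t₀)) * (1 + ‖z‖)) := by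
  have h1 := one_add_norm_picard_le hb t₀ z i s
  have h2 := one_add_norm_picard_le hb t₀ z j s
  linarith [norm_sub_le (picard b t₀ z i s) (picard b t₀ z j s)]

theorem norm_picard_sub_le_osc (hb : LogLipschitzField C A b) (t₀ : ℝ) (z : F) {k i j : ℕ}
    (hi : k ≤ i) (hj : k ≤ j) (s : ℝ) :
    ‖picard b t₀ z i s - picard b t₀ z j s‖ ≤ picardOsc b t₀ z k s := by
  have hbdd : BddAbove (range fun p : ℕ × ℕ =>
      ‖picard b t₀ z (k + p.1) s - picard b t₀ z (k + p.2) s‖) :=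
    ⟨_, forall_mem_range.2 fun p => norm_picard_sub_le hb t₀ z _ _ s⟩
  have := le_ciSup hbdd (i - k, j - k)
  simpa [Nat.add_sub_cancel' hi, Nat.add_sub_cancel' hj, picardOsc] using this

theorem picardOsc_le (hb : LogLipschitzField C A b) (t₀ : ℝ) (z : F) (k : ℕ) (s : ℝ) :
    picardOsc b t₀ z k s ≤ 2 * (exp (A * (max t₀ s - t₀)) * (1 + ‖z‖)) :=
  ciSup_le fun _ => norm_picard_sub_le hb t₀ z _ _ s

theorem picardOsc_nonneg (t₀ : ℝ) (z : F) (k : ℕ) (s : ℝ) : 0 ≤ picardOsc b t₀ z k s :=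
  Real.iSup_nonneg fun _ => norm_nonneg _

theorem picardOsc_antitone (hb : LogLipschitzField C A b) (t₀ : ℝ) (z : F) (s : ℝ) :
    Antitone fun k => picardOsc b t₀ z k s := fun _ _ h =>
  ciSup_le fun _ => norm_picard_sub_le_osc hb t₀ z (h.trans (Nat.le_add_right _ _))
    (h.trans (Nat.le_add_right _ _)) s

theorem measurable_picardOsc (hb : LogLipschitzField C A b) (t₀ : ℝ) (z : F) (k : ℕ) :
    Measurable (picardOsc b t₀ z k) :=
  Measurable.iSup fun _ => ((continuous_picard hb t₀ z _).sub
    (continuous_picard hb t₀ z _)).norm.measurable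

/-- The modulus holds for every `n ≥ 1`, so at each time `r` it may be used with its own parameter
`scale C S N r`. -/
theorem picardOsc_succ_le (hb : LogLipschitzField C A b) (t₀ : ℝ) (z : F) (k : ℕ) {S s N : ℝ}
    (hs : s ∈ Icc t₀ S) (hN : 1 ≤ N) :
    picardOsc b t₀ z (k + 1) s ≤ ∫ r in t₀..s,
      C * scale C S N r * (picardOsc b t₀ z k r + exp (-scale C S N r)) := by
  have hN0 := one_pos.trans_le hN
  refine ciSup_le fun p => ?_
  have hi := hb.intervalIntegrable (continuous_picard hb t₀ z (k + p.1))
  have hj := hb.intervalIntegrable (continuous_picard hb t₀ z (k + p.2))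
  have e1 : k + 1 + p.1 = (k + p.1) + 1 := by ring
  have e2 : k + 1 + p.2 = (k + p.2) + 1 := by ring
  rw [e1, e2]
  simp only [picard, max_eq_right hs.1]
  rw [add_sub_add_left_eq_sub, ← intervalIntegral.integral_sub (hi _ _) (hj _ _)]
  refine intervalIntegral.norm_integral_le_of_norm_le hs.1 (ae_of_all _ fun r hr => ?_) ?_
  · refine (hb.modulus r _ _ _ (hN.trans (le_scale hb.nonneg hN0.le (hr.2.trans hs.2)))).trans ?_
    have h1 := norm_picard_sub_le_osc hb t₀ z (Nat.le_add_right k p.1) (Nat.le_add_right k p.2) r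
    have h2 := hb.nonneg
    have h3 := (scale_pos (C := C) (S := S) hN0 r).le
    gcongr
  · have hsc := continuous_scale C S N
    have hint : IntervalIntegrable (picardOsc b t₀ z k) volume t₀ s := by
      have hc : Continuous fun r => 2 * (exp (A * (max t₀ r - t₀)) * (1 + ‖z‖)) := by fun_prop
      refine (hc.intervalIntegrable _ _).mono_fun
        (measurable_picardOsc hb t₀ z k).aestronglyMeasurable (ae_of_all _ fun r => ?_)
      simp only [Real.norm_eq_abs, abs_of_nonneg (picardOsc_nonneg t₀ z k r)]
      exact (picardOsc_le hb t₀ z k r).trans (le_abs_self _)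
    exact (hint.add ((by fun_prop : Continuous fun r =>
      exp (-scale C S N r)).intervalIntegrable _ _)).continuousOn_mul (by fun_prop)

/-- The Picard map need not be a contraction for a log-Lipschitz field. The tail oscillations
decrease in `k`, however, and by dominated convergence their limit satisfies Osgood's inequality
with zero initial value, so it vanishes. -/
theorem tendsto_picardOsc (hb : LogLipschitzField C A b) (t₀ : ℝ) (z : F) {s : ℝ} (hs : t₀ ≤ s) :
    Tendsto (fun k => picardOsc b t₀ z k s) atTop (𝓝 0) := by
  set D : ℝ → ℝ := fun r => ⨅ k, picardOsc b t₀ z k r with hD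
  have hbdd : ∀ r, BddBelow (range fun k => picardOsc b t₀ z k r) := fun r =>
    ⟨0, forall_mem_range.2 fun k => picardOsc_nonneg t₀ z k r⟩
  have hlim : ∀ r, Tendsto (fun k => picardOsc b t₀ z k r) atTop (𝓝 (D r)) := fun r =>
    tendsto_atTop_ciInf (picardOsc_antitone hb t₀ z r) (hbdd r)
  have hD0 : ∀ r, 0 ≤ D r := fun r => le_ciInf fun k => picardOsc_nonneg t₀ z k r
  have hDm : Measurable D := Measurable.iInf fun k => measurable_picardOsc hb t₀ z k
  have hc : Continuous fun r => 2 * (exp (A * (max t₀ r - t₀)) * (1 + ‖z‖)) := by fun_prop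
  have hDi : IntegrableOn D (Icc t₀ s) := by
    refine (hc.continuousOn.integrableOn_Icc).mono' hDm.aestronglyMeasurable
      (ae_of_all _ fun r => ?_)
    rw [Real.norm_eq_abs, abs_of_nonneg (hD0 r)]
    exact (ciInf_le (hbdd r) 0).trans (picardOsc_le hb t₀ z 0 r)
  have key : D s ≤ 0 := by
    refine osgood_integral_zero hb.nonneg hDi (fun N hN t ht => ?_) s ⟨hs, le_rfl⟩
    have hsc := continuous_scale C s N
    have hN0 := one_pos.trans_le hN
    refine ge_of_tendsto (f := fun k => ∫ r in t₀..t,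
      C * scale C s N r * (picardOsc b t₀ z k r + exp (-scale C s N r))) (x := atTop) ?_ ?_
    · refine intervalIntegral.tendsto_integral_filter_of_dominated_convergence
        (fun r => C * scale C s N r * (2 * (exp (A * (max t₀ r - t₀)) * (1 + ‖z‖))
          + exp (-scale C s N r))) ?_ ?_ ?_ ?_
      · refine Eventually.of_forall fun k => Measurable.aestronglyMeasurable ?_
        have := measurable_picardOsc hb t₀ z k
        have := hsc.measurable
        fun_prop
      · refine Eventually.of_forall fun k => ae_of_all _ fun r _ => ?_
        have h1 := picardOsc_nonneg (b := b) t₀ z k r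
        have h2 := (scale_pos (C := C) (S := s) hN0 r).le
        have h3 := hb.nonneg
        have h4 := picardOsc_le hb t₀ z k r
        rw [Real.norm_eq_abs, abs_of_nonneg (by positivity)]
        gcongr
      · exact (by fun_prop : Continuous _).intervalIntegrable _ _
      · exact ae_of_all _ fun r _ => ((hlim r).add_const _).const_mul _
    · exact Eventually.of_forall fun k =>
        (ciInf_le (hbdd t) (k + 1)).trans (picardOsc_succ_le hb t₀ z k ht hN)
  have := hlim s
  rwa [le_antisymm key (hD0 s)] at this

theorem exists_isSolution [CompleteSpace F] (hb : LogLipschitzField C A b) (t₀ : ℝ) (z : F) :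
    ∃ Z, IsSolution b t₀ z Z := by
  have hconv : ∀ s, ∃ y, t₀ ≤ s → Tendsto (fun k => picard b t₀ z k s) atTop (𝓝 y) := fun s => by
    by_cases hs : t₀ ≤ s
    · have : CauchySeq fun k => picard b t₀ z k s := by
        refine cauchySeq_of_le_tendsto_0 (fun k => picardOsc b t₀ z k s) (fun i j k hi hj => ?_)
          (tendsto_picardOsc hb t₀ z hs)
        rw [dist_eq_norm]
        exact norm_picard_sub_le_osc hb t₀ z hi hj s
      obtain ⟨y, hy⟩ := cauchySeq_tendsto_of_complete this
      exact ⟨y, fun _ => hy⟩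
    · exact ⟨0, fun h => absurd h hs⟩
  choose Y hY using hconv
  have hbm : ∀ s, t₀ ≤ s → Tendsto (fun k => picard b t₀ z (k + 1) s) atTop
      (𝓝 (z + ∫ r in t₀..s, b r (Y r))) := fun s hs => by
    simp only [picard, max_eq_right hs]
    refine Tendsto.const_add z ?_
    refine intervalIntegral.tendsto_integral_filter_of_dominated_convergence
      (fun r => A * (exp (A * (max t₀ r - t₀)) * (1 + ‖z‖))) ?_ ?_ ?_ ?_
    · exact Eventually.of_forall fun k => (hb.measurable.comp (measurable_id.prodMk
        (continuous_picard hb t₀ z k).measurable)).aestronglyMeasurable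
    · refine Eventually.of_forall fun k => ae_of_all _ fun r _ => (hb.growth r _).trans ?_
      exact mul_le_mul_of_nonneg_left (one_add_norm_picard_le hb t₀ z k r) hb.nonneg_growth
    · exact (by fun_prop : Continuous _).intervalIntegrable _ _
    · refine ae_of_all _ fun r hr => ?_
      rw [uIoc_of_le hs] at hr
      exact ((hb.continuous r).tendsto _).comp (hY r hr.1.le)
  have hYeq : ∀ s, t₀ ≤ s → Y s = z + ∫ r in t₀..s, b r (Y r) := fun s hs =>
    tendsto_nhds_unique ((tendsto_add_atTop_iff_nat 1).2 (hY s hs)) (hbm s hs)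
  -- extend by a constant before the initial time
  have hYmax : Measurable fun r => Y (max t₀ r) := by
    refine measurable_of_tendsto_metrizable (f := fun k r => picard b t₀ z k (max t₀ r))
      (fun k => ((continuous_picard hb t₀ z k).comp
        (continuous_const.max continuous_id)).measurable) ?_
    exact tendsto_pi_nhds.2 fun r => hY _ (le_max_left _ _)
  have hYbound : ∀ r, 1 + ‖Y (max t₀ r)‖ ≤ exp (A * (max t₀ r - t₀)) * (1 + ‖z‖) := fun r => by
    refine le_of_tendsto ((hY _ (le_max_left t₀ r)).norm.const_add 1)
      (Eventually.of_forall fun k => ?_)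
    simpa using one_add_norm_picard_le hb t₀ z k (max t₀ r)
  have hint : ∀ c d, IntervalIntegrable (fun r => b r (Y (max t₀ r))) volume c d := fun c d => by
    have hc : Continuous fun r => A * (exp (A * (max t₀ r - t₀)) * (1 + ‖z‖)) := by fun_prop
    refine (hc.intervalIntegrable c d).mono_fun
      (hb.measurable.comp (measurable_id.prodMk hYmax)).aestronglyMeasurable
      (ae_of_all _ fun r => ((hb.growth r _).trans ?_).trans (le_abs_self _))
    exact mul_le_mul_of_nonneg_left (hYbound r) hb.nonneg_growth
  have hZ : ∀ s, Y (max t₀ s) = z + ∫ r in t₀..max t₀ s, b r (Y (max t₀ r)) := fun s => by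
    rw [hYeq _ (le_max_left _ _)]
    congr 1
    refine intervalIntegral.integral_congr fun r hr => ?_
    rw [uIcc_of_le (le_max_left _ _)] at hr
    simp only [max_eq_right hr.1]
  refine ⟨fun s => Y (max t₀ s), ?_, fun s hs => ?_⟩
  · rw [funext hZ]
    exact continuous_const.add ((intervalIntegral.continuous_primitive hint t₀).comp
      (continuous_const.max continuous_id))
  · conv_lhs => rw [hZ s]
    rw [max_eq_right hs]

end Picard

/-- The flow of a vector field: `flow b t₀ z s` is the position at time `s` of the solution which
starts at `z` at time `t₀`. -/
noncomputable def flow (b : ℝ → F → F) (t₀ : ℝ) (z : F) (s : ℝ) : F :=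
  Classical.epsilon (fun Z => IsSolution b t₀ z Z) s

variable [SecondCountableTopology F] [CompleteSpace F]
variable {C A : ℝ} {b : ℝ → F → F}

theorem isSolution_flow (hb : LogLipschitzField C A b) (t₀ : ℝ) (z : F) :
    IsSolution b t₀ z (flow b t₀ z) :=
  Classical.epsilon_spec (exists_isSolution hb t₀ z)

theorem flow_flow (hb : LogLipschitzField C A b) {t₀ t₁ s : ℝ} (z : F) (h : t₀ ≤ t₁)
    (hs : t₁ ≤ s) : flow b t₁ (flow b t₀ z t₁) s = flow b t₀ z s :=
  (isSolution_flow hb _ _).unique hb ((isSolution_flow hb t₀ z).restart hb h) hs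

theorem continuous_flow_initial (hb : LogLipschitzField C A b) {t₀ s : ℝ} (hs : t₀ ≤ s) :
    Continuous fun z => flow b t₀ z s := by
  refine continuous_iff_continuousAt.2 fun z => ?_
  refine Metric.tendsto_nhds.2 fun ε hε => ?_
  obtain ⟨N, hlt, hN⟩ := (((tendsto_const_mul_exp_neg_half (C * (s - t₀))).eventually
    (gt_mem_nhds (half_pos hε))).and (eventually_ge_atTop 1)).exists
  have hc : Tendsto (fun z' => exp (scale C s N t₀ / 2) * ‖z' - z‖) (𝓝 z) (𝓝 0) := by
    have : Continuous fun z' => exp (scale C s N t₀ / 2) * ‖z' - z‖ := by fun_prop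
    simpa using this.tendsto z
  filter_upwards [hc.eventually (gt_mem_nhds (half_pos hε))] with z' hz'
  rw [dist_eq_norm]
  have := (isSolution_flow hb t₀ z').norm_sub_le hb (isSolution_flow hb t₀ z) hN hs
  linarith

end Flow

/-! ### Mollification of Lipschitz functions, and Lipschitz test functions -/

section Mollify

variable {G : Type*} [NormedAddCommGroup G] [NormedSpace ℝ G] [FiniteDimensional ℝ G]
  [MeasurableSpace G] [BorelSpace G]

/-- A standard sequence of bump functions concentrating at the origin. -/
noncomputable def bumpSeq (G : Type*) [NormedAddCommGroup G] (k : ℕ) : ContDiffBump (0 : G) where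
  rIn := 1 / (2 * (k + 1))
  rOut := 1 / (k + 1)
  rIn_pos := by positivity
  rIn_lt_rOut := by
    apply one_div_lt_one_div_of_lt <;> [positivity; linarith [(k.cast_nonneg : (0 : ℝ) ≤ k)]]

theorem tendsto_bumpSeq_rOut : Tendsto (fun k => (bumpSeq G k).rOut) atTop (𝓝 0) :=
  tendsto_one_div_add_atTop_nhds_zero_nat

variable (μ : Measure G) [μ.IsAddHaarMeasure]

noncomputable def mollify {E : Type*} [NormedAddCommGroup E] [NormedSpace ℝ E]
    (k : ℕ) (φ : G → E) : G → E :=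
  (bumpSeq G k).normed μ ⋆[ContinuousLinearMap.lsmul ℝ ℝ, μ] φ

theorem mollify_apply {E : Type*} [NormedAddCommGroup E] [NormedSpace ℝ E] (k : ℕ) (φ : G → E)
    (x : G) : mollify μ k φ x = ∫ q, (bumpSeq G k).normed μ q • φ (x - q) ∂μ := rfl

theorem integrable_mollify_integrand (k : ℕ) {φ : G → ℝ} (hφ : Continuous φ) (x : G) :
    Integrable (fun q => (bumpSeq G k).normed μ q • φ (x - q)) μ := by
  have hc := ((bumpSeq G k).contDiff_normed (μ := μ) (n := 0)).continuous
  refine Continuous.integrable_of_hasCompactSupport (by fun_prop) ?_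
  exact (bumpSeq G k).hasCompactSupport_normed.smul_right

theorem contDiff_mollify (k : ℕ) {φ : G → ℝ} (hφ : Continuous φ) :
    ContDiff ℝ (⊤ : ℕ∞) (mollify μ k φ) :=
  (bumpSeq G k).hasCompactSupport_normed.contDiff_convolution_left _
    (bumpSeq G k).contDiff_normed hφ.locallyIntegrable

theorem norm_mollify_sub_le (k : ℕ) {φ : G → ℝ} {K : ℝ≥0} (hφ : LipschitzWith K φ) (x y : G) :
    ‖mollify μ k φ x - mollify μ k φ y‖ ≤ K * ‖x - y‖ := by
  rw [mollify_apply, mollify_apply, ← integral_sub (integrable_mollify_integrand μ k hφ.continuous x)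
    (integrable_mollify_integrand μ k hφ.continuous y)]
  have hi := ((bumpSeq G k).integrable_normed (μ := μ)).mul_const (K * ‖x - y‖)
  refine (norm_integral_le_of_norm_le hi (ae_of_all _ fun q => ?_)).trans_eq ?_
  · have h := hφ.norm_sub_le (x - q) (y - q)
    rw [sub_sub_sub_cancel_right] at h
    rw [← smul_sub, norm_smul, Real.norm_eq_abs, abs_of_nonneg ((bumpSeq G k).nonneg_normed q)]
    exact mul_le_mul_of_nonneg_left h ((bumpSeq G k).nonneg_normed q)
  · rw [integral_mul_const, (bumpSeq G k).integral_normed, one_mul]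

theorem lipschitzWith_mollify (k : ℕ) {φ : G → ℝ} {K : ℝ≥0} (hφ : LipschitzWith K φ) :
    LipschitzWith K (mollify μ k φ) :=
  LipschitzWith.of_dist_le_mul fun x y => by
    simpa only [dist_eq_norm] using norm_mollify_sub_le μ k hφ x y

theorem exists_ne_zero_of_mollify_ne_zero (k : ℕ) {φ : G → ℝ} {x : G}
    (hx : mollify μ k φ x ≠ 0) : ∃ y, φ y ≠ 0 ∧ ‖x - y‖ ≤ 1 / ((k : ℝ) + 1) := by
  by_contra! h
  refine hx ?_
  rw [mollify_apply]
  refine integral_eq_zero_of_ae (ae_of_all _ fun q => ?_)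
  by_cases hq : φ (x - q) = 0
  · simp [hq]
  · have h1 := h _ hq
    rw [sub_sub_cancel] at h1
    have : q ∉ Function.support ((bumpSeq G k).normed μ) := by
      rw [(bumpSeq G k).support_normed_eq]
      simpa [bumpSeq] using h1.le
    simp [Function.notMem_support.1 this]

/-- By Rademacher's theorem `φ` is differentiable at `x - q` for almost every `q`, so the derivative
can fall on `φ` instead of the bump; the Lipschitz bound justifies differentiation under the
integral. -/
theorem fderiv_mollify (k : ℕ) {φ : G → ℝ} {K : ℝ≥0} (hφ : LipschitzWith K φ) (x : G) :
    fderiv ℝ (mollify μ k φ) x = mollify μ k (fderiv ℝ φ) x := by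
  have hc := ((bumpSeq G k).contDiff_normed (μ := μ) (n := 0)).continuous
  have hφc := hφ.continuous
  have hae : ∀ᵐ q ∂μ, DifferentiableAt ℝ φ (x - q) :=
    (quasiMeasurePreserving_sub_left μ x).ae hφ.ae_differentiableAt
  refine HasFDerivAt.fderiv ?_
  refine (hasFDerivAt_integral_of_dominated_loc_of_lip (s := univ)
    (bound := fun q => (bumpSeq G k).normed μ q * K) univ_mem ?_
    (integrable_mollify_integrand μ k hφ.continuous x) ?_ ?_ ?_ ?_).2
  · exact Eventually.of_forall fun y =>
      (integrable_mollify_integrand μ k hφ.continuous y).aestronglyMeasurable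
  · refine hc.aestronglyMeasurable.smul ?_
    exact ((measurable_fderiv ℝ φ).comp (measurable_const.sub measurable_id)).aestronglyMeasurable
  · refine ae_of_all _ fun q => LipschitzOnWith.of_dist_le_mul fun y _ z _ => ?_
    have h := hφ.norm_sub_le (y - q) (z - q)
    have h0 := (bumpSeq G k).nonneg_normed (μ := μ) q
    rw [sub_sub_sub_cancel_right] at h
    rw [dist_eq_norm, dist_eq_norm, coe_nnabs, abs_of_nonneg (by positivity)]
    simp only [ContinuousLinearMap.lsmul_apply]
    rw [← smul_sub, norm_smul, Real.norm_eq_abs, abs_of_nonneg h0, mul_assoc]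
    exact mul_le_mul_of_nonneg_left h h0
  · exact ((bumpSeq G k).integrable_normed (μ := μ)).mul_const _
  · filter_upwards [hae] with q hq
    have h1 : HasFDerivAt (fun y => φ (y - q)) (fderiv ℝ φ (x - q)) x := by
      exact (hq.hasFDerivAt.comp x ((hasFDerivAt_id x).sub_const q)).congr_fderiv
        (ContinuousLinearMap.comp_id _)
    exact h1.const_smul ((bumpSeq G k).normed μ q)

theorem ae_tendsto_fderiv_mollify {φ : G → ℝ} {K : ℝ≥0} (hφ : LipschitzWith K φ) :
    ∀ᵐ x ∂μ, Tendsto (fun k => fderiv ℝ (mollify μ k φ) x) atTop (𝓝 (fderiv ℝ φ x)) := by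
  simp only [fderiv_mollify μ _ hφ]
  -- Convergence at Lebesgue points requires the ratio of outer to inner radius of the bumps to stay
  -- bounded; here it equals 2.
  refine ContDiffBump.ae_convolution_tendsto_right_of_locallyIntegrable (K := 2)
    tendsto_bumpSeq_rOut (Eventually.of_forall fun k => le_of_eq ?_) ?_
  · simp only [bumpSeq]; field_simp
  · refine (locallyIntegrable_const (K : ℝ)).mono (measurable_fderiv ℝ φ).aestronglyMeasurable
      (ae_of_all _ fun x => ?_)
    exact (norm_fderiv_le_of_lipschitz ℝ hφ).trans (le_abs_self _)

theorem tendsto_mollify {φ : G → ℝ} (hφ : Continuous φ) (x : G) :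
    Tendsto (fun k => mollify μ k φ x) atTop (𝓝 (φ x)) :=
  ContDiffBump.convolution_tendsto_right_of_continuous tendsto_bumpSeq_rOut hφ x

theorem norm_mollify_le (k : ℕ) {φ : G → ℝ} {M : ℝ} (h : ∀ x, ‖φ x‖ ≤ M) (x : G) :
    ‖mollify μ k φ x‖ ≤ M := by
  have hi := ((bumpSeq G k).integrable_normed (μ := μ)).mul_const M
  rw [mollify_apply]
  refine (norm_integral_le_of_norm_le hi (ae_of_all _ fun q => ?_)).trans_eq ?_
  · rw [norm_smul, Real.norm_eq_abs, abs_of_nonneg ((bumpSeq G k).nonneg_normed q)]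
    exact mul_le_mul_of_nonneg_left (h _) ((bumpSeq G k).nonneg_normed q)
  · rw [integral_mul_const, (bumpSeq G k).integral_normed, one_mul]

end Mollify

/-! ### Linear transport equations tested against Lipschitz functions. -/

section LinearTransport

variable {F : Type*} [NormedAddCommGroup F] [NormedSpace ℝ F] [FiniteDimensional ℝ F]
  [MeasureSpace F] [BorelSpace F] [SecondCountableTopology F]
  [(volume : Measure F).IsAddHaarMeasure]

/-- Weak integrable solutions on `[0, T]` of `∂_t f + div (b f) = 0`, `f(0) = f₀`. -/
structure IsLinearWeakSolution (b : ℝ → F → F) (T : ℝ) (f₀ : F → ℝ) (f : ℝ × F → ℝ) : Prop where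
  integrable_initial : Integrable f₀
  integrable : IntegrableOn f (Icc 0 T ×ˢ univ)
  weak_eq : ∀ φ : ℝ × F → ℝ, ContDiff ℝ (⊤ : ℕ∞) φ → HasCompactSupport φ →
    (∀ t z, T ≤ t → φ (t, z) = 0) →
    (∫ p in Icc 0 T ×ˢ (univ : Set F), f p * fderiv ℝ φ p (1, b p.1 p.2))
      + ∫ z, f₀ z * φ (0, z) = 0

instance : (volume : Measure (ℝ × F)).IsAddHaarMeasure :=
  inferInstanceAs ((volume : Measure ℝ).prod (volume : Measure F)).IsAddHaarMeasure

/-- Solutions of the backward problem are only Lipschitz, so they are mollified first. The mollified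
gradients are bounded by `K`, converge almost everywhere and live in a fixed ball, where the field
is bounded; dominated convergence applies because `f` is integrable. -/
theorem IsLinearWeakSolution.weak_eq_lipschitz {C A T δ : ℝ} {b : ℝ → F → F} {f₀ : F → ℝ}
    {f : ℝ × F → ℝ} (hf : IsLinearWeakSolution b T f₀ f) (hb : LogLipschitzField C A b)
    {φ : ℝ × F → ℝ} {K : ℝ≥0} (hφ : LipschitzWith K φ) (hφc : HasCompactSupport φ)
    (hδ : 0 < δ) (hφT : ∀ t z, T - δ ≤ t → φ (t, z) = 0) :
    (∫ p in Icc 0 T ×ˢ (univ : Set F), f p * fderiv ℝ φ p (1, b p.1 p.2))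
      + ∫ z, f₀ z * φ (0, z) = 0 := by
  set ψ : ℕ → ℝ × F → ℝ := fun k => mollify volume k φ with hψ
  obtain ⟨R, hR⟩ : ∃ R, ∀ p, φ p ≠ 0 → ‖p‖ ≤ R := by
    obtain ⟨R, hR⟩ := hφc.isCompact.isBounded.exists_norm_le
    exact ⟨R, fun p hp => hR p (subset_tsupport φ hp)⟩
  obtain ⟨M, hM⟩ : ∃ M, ∀ p, ‖φ p‖ ≤ M := hφc.exists_bound_of_continuous hφ.continuous
  have hψR : ∀ k p, ψ k p ≠ 0 → ‖p‖ ≤ R + 1 := fun k p hp => by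
    obtain ⟨y, hy, hxy⟩ := exists_ne_zero_of_mollify_ne_zero volume k hp
    have h1 : 1 / ((k : ℝ) + 1) ≤ 1 := by
      rw [div_le_one (by positivity)]; linarith [(k.cast_nonneg : (0 : ℝ) ≤ k)]
    have h2 := norm_le_norm_add_norm_sub' p y
    linarith [hR y hy]
  have hψs : ∀ k, tsupport (ψ k) ⊆ Metric.closedBall 0 (R + 1) := fun k =>
    closure_minimal (fun p hp => mem_closedBall_zero_iff.2 (hψR k p hp)) Metric.isClosed_closedBall
  have hψc : ∀ k, HasCompactSupport (ψ k) := fun k =>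
    (isCompact_closedBall (0 : ℝ × F) (R + 1)).of_isClosed_subset (isClosed_tsupport _) (hψs k)
  have hfd : ∀ k p, ‖fderiv ℝ (ψ k) p‖ ≤ K := fun k p =>
    norm_fderiv_le_of_lipschitz ℝ (lipschitzWith_mollify volume k hφ)
  have hA := hb.nonneg_growth
  have hbound : ∀ k p, ‖f p * fderiv ℝ (ψ k) p (1, b p.1 p.2)‖
      ≤ ‖f p‖ * (K * (1 + A * (1 + (|R| + 1)))) := fun k p => by
    rw [norm_mul]
    refine mul_le_mul_of_nonneg_left ?_ (norm_nonneg _)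
    by_cases hp : p ∈ tsupport (ψ k)
    · have hp1 : ‖p‖ ≤ |R| + 1 :=
        (mem_closedBall_zero_iff.1 (hψs k hp)).trans (by linarith [le_abs_self R])
      have hp2 : ‖p.2‖ ≤ |R| + 1 := (norm_snd_le p).trans hp1
      refine (ContinuousLinearMap.le_opNorm _ _).trans ?_
      have h3 : ‖((1 : ℝ), b p.1 p.2)‖ ≤ 1 + A * (1 + (|R| + 1)) := by
        refine (Prod.norm_def _).trans_le (max_le ?_ ?_)
        · have : 0 ≤ A * (1 + (|R| + 1)) := by positivity
          simpa using this
        · refine (hb.growth _ _).trans ?_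
          have : A * (1 + ‖p.2‖) ≤ A * (1 + (|R| + 1)) := by gcongr
          linarith
      exact mul_le_mul (hfd k p) h3 (norm_nonneg _) K.2
    · have : fderiv ℝ (ψ k) p = 0 := by
        by_contra h
        exact hp (support_fderiv_subset ℝ h)
      rw [this]
      simp only [zero_apply, norm_zero]
      positivity
  have hbm : Measurable fun p : ℝ × F => ((1 : ℝ), b p.1 p.2) :=
    measurable_const.prodMk hb.measurable
  have happ : ∀ χ : ℝ × F → ℝ, Measurable fun p => fderiv ℝ χ p (1, b p.1 p.2) := fun χ =>
    (ContinuousLinearMap.measurable_apply₂ (E := ℝ × F) (F := ℝ)).comp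
      ((measurable_fderiv ℝ χ).prodMk hbm)
  have hlim1 : Tendsto (fun k => ∫ p in Icc 0 T ×ˢ (univ : Set F),
      f p * fderiv ℝ (ψ k) p (1, b p.1 p.2)) atTop
      (𝓝 (∫ p in Icc 0 T ×ˢ (univ : Set F), f p * fderiv ℝ φ p (1, b p.1 p.2))) := by
    refine tendsto_integral_of_dominated_convergence
      (fun p => ‖f p‖ * (K * (1 + A * (1 + (|R| + 1))))) (fun k => ?_) ?_ ?_ ?_
    · exact hf.integrable.aestronglyMeasurable.mul (happ _).aestronglyMeasurable
    · exact hf.integrable.norm.mul_const _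
    · exact fun k => ae_of_all _ (hbound k)
    · filter_upwards [ae_restrict_of_ae (ae_tendsto_fderiv_mollify volume hφ)] with p hp
      exact ((((ContinuousLinearMap.apply ℝ ℝ ((1 : ℝ), b p.1 p.2)).continuous.tendsto _).comp
        hp)).const_mul _
  have hlim2 : Tendsto (fun k => ∫ z, f₀ z * ψ k (0, z)) atTop (𝓝 (∫ z, f₀ z * φ (0, z))) := by
    refine tendsto_integral_of_dominated_convergence (fun z => ‖f₀ z‖ * M) (fun k => ?_)
      (hf.integrable_initial.norm.mul_const _) (fun k => ae_of_all _ fun z => ?_)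
      (ae_of_all _ fun z => (tendsto_mollify volume hφ.continuous _).const_mul _)
    · refine hf.integrable_initial.aestronglyMeasurable.mul
        (Continuous.aestronglyMeasurable ?_)
      exact (contDiff_mollify volume k hφ.continuous).continuous.comp (by fun_prop)
    · rw [norm_mul]
      exact mul_le_mul_of_nonneg_left (norm_mollify_le volume k hM _) (norm_nonneg _)
  refine tendsto_nhds_unique (hlim1.add hlim2) (tendsto_const_nhds.congr' ?_)
  -- Mollification enlarges the support by at most `1 / (k + 1)`, so the margin `δ` keeps the test
  -- function zero from time `T` on once `k` is large.
  filter_upwards [tendsto_one_div_add_atTop_nhds_zero_nat.eventually (gt_mem_nhds hδ)] with k hk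
  refine (hf.weak_eq (ψ k) (contDiff_mollify volume k hφ.continuous) (hψc k)
    fun t z ht => ?_).symm
  by_contra h
  obtain ⟨y, hy, hxy⟩ := exists_ne_zero_of_mollify_ne_zero volume k h
  refine hy (hφT y.1 y.2 ?_)
  have := (norm_fst_le ((t, z) - y)).trans hxy
  have := (abs_le.1 ((Real.norm_eq_abs _).symm.trans_le this)).2
  simp only [Prod.fst_sub] at this
  linarith

end LinearTransport

/-! ### Lipschitz regularisation by inf-convolution -/

section InfConvolution

variable {F : Type*} [NormedAddCommGroup F] [SecondCountableTopology F]

/-- The inf-convolution of `h` with `L ‖·‖`, over a countable dense set. -/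
noncomputable def infConv (h : F → ℝ) (L : ℝ) (z : F) : ℝ :=
  ⨅ k : ℕ, (h (TopologicalSpace.denseSeq F k) + L * ‖z - TopologicalSpace.denseSeq F k‖)

variable {h : F → ℝ} {L e : ℝ}

theorem le_infConv_term (hh : ∀ z z', |h z - h z'| ≤ L * (‖z - z'‖ + e)) (z w : F) :
    h z - L * e ≤ h w + L * ‖z - w‖ := by
  have := (abs_le.1 (hh z w)).2
  linarith

theorem bddBelow_infConv (hh : ∀ z z', |h z - h z'| ≤ L * (‖z - z'‖ + e)) (z : F) :
    BddBelow (range fun k : ℕ => h (TopologicalSpace.denseSeq F k)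
      + L * ‖z - TopologicalSpace.denseSeq F k‖) :=
  ⟨h z - L * e, forall_mem_range.2 fun _ => le_infConv_term hh z _⟩

theorem infConv_le_add (hL : 0 ≤ L) (hh : ∀ z z', |h z - h z'| ≤ L * (‖z - z'‖ + e)) (z z' : F) :
    infConv h L z ≤ infConv h L z' + L * ‖z - z'‖ := by
  rw [← sub_le_iff_le_add]
  refine le_ciInf fun k => ?_
  have h1 := ciInf_le (bddBelow_infConv hh z) k
  have h2 := norm_sub_le_norm_sub_add_norm_sub z z' (TopologicalSpace.denseSeq F k)
  have h3 := mul_le_mul_of_nonneg_left h2 hL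
  unfold infConv
  linarith

theorem abs_infConv_sub_infConv_le (hL : 0 ≤ L) (hh : ∀ z z', |h z - h z'| ≤ L * (‖z - z'‖ + e))
    (z z' : F) : |infConv h L z - infConv h L z'| ≤ L * ‖z - z'‖ := by
  have h1 := infConv_le_add hL hh z z'
  have h2 := infConv_le_add hL hh z' z
  rw [norm_sub_rev] at h2
  exact abs_le.2 ⟨by linarith, by linarith⟩

theorem abs_infConv_sub_le (hL : 0 ≤ L) (hh : ∀ z z', |h z - h z'| ≤ L * (‖z - z'‖ + e))
    (z : F) : |infConv h L z - h z| ≤ L * e := by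
  have h1 : h z - L * e ≤ infConv h L z := le_ciInf fun _ => le_infConv_term hh z _
  have h2 : infConv h L z ≤ h z + L * e := by
    refine le_of_forall_pos_le_add fun ε hε => ?_
    -- The distance `‖z - w‖` is paid twice with weight `L`, in the penalisation and in the
    -- oscillation of `h`; this explains `2 * L`, and the `+ 1` covers `L = 0`.
    obtain ⟨k, hk⟩ := (TopologicalSpace.denseRange_denseSeq F).exists_dist_lt z
      (ε := ε / (2 * L + 1)) (by positivity)
    set w := TopologicalSpace.denseSeq F k
    have h3 : infConv h L z ≤ h w + L * ‖z - w‖ := ciInf_le (bddBelow_infConv hh z) k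
    have h4 := (abs_le.1 (hh w z)).2
    rw [norm_sub_rev] at h4
    rw [dist_eq_norm, lt_div_iff₀ (by positivity)] at hk
    nlinarith [norm_nonneg (z - w)]
  exact abs_le.2 ⟨by linarith, by linarith⟩

theorem measurable_infConv [MeasurableSpace F] [BorelSpace F] {h : ℝ → F → ℝ} {L : ℝ → ℝ}
    (hh : Measurable (Function.uncurry h)) (hL : Measurable L) :
    Measurable (Function.uncurry fun t z => infConv (h t) (L t) z) := by
  refine Measurable.iInf fun k => ?_
  have h1 : Measurable fun p : ℝ × F => h p.1 (TopologicalSpace.denseSeq F k) :=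
    hh.comp (measurable_fst.prodMk measurable_const)
  have h2 : Measurable fun p : ℝ × F => ‖p.2 - TopologicalSpace.denseSeq F k‖ :=
    (by fun_prop : Continuous fun p : ℝ × F =>
      ‖p.2 - TopologicalSpace.denseSeq F k‖).measurable
  exact h1.add ((hL.comp measurable_fst).mul h2)

end InfConvolution

section Regularisation

variable (F : Type*) [NormedAddCommGroup F] [NormedSpace ℝ F] [FiniteDimensional ℝ F]
  [MeasurableSpace F] [BorelSpace F] [SecondCountableTopology F]

/-- A vector field which is Lipschitz at scale `e` is close to a Lipschitz field. -/
theorem exists_lipschitz_approx : ∃ K : ℝ, 1 ≤ K ∧ ∀ (b : ℝ → F → F) (L e : ℝ → ℝ),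
    Measurable (Function.uncurry b) → Measurable L → (∀ t, 0 ≤ L t) →
    (∀ t, 0 ≤ e t) → (∀ t z z', ‖b t z - b t z'‖ ≤ L t * (‖z - z'‖ + e t)) →
    ∃ b' : ℝ → F → F, Measurable (Function.uncurry b') ∧
      (∀ t z z', ‖b' t z - b' t z'‖ ≤ K * L t * ‖z - z'‖) ∧
      ∀ t z, ‖b' t z - b t z‖ ≤ K * L t * e t := by
  set ι := Module.Basis.ofVectorSpaceIndex ℝ F
  -- Inf-convolution is a scalar operation, so it is applied to each coordinate. The constant
  -- collects the norms of the coordinate isomorphism and of its inverse.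
  let E : F ≃L[ℝ] (ι → ℝ) := (Module.Basis.ofVectorSpace ℝ F).equivFunL
  set M : ℝ := ‖(E.symm : (ι → ℝ) →L[ℝ] F)‖
  set P : ℝ := ‖(E : F →L[ℝ] (ι → ℝ))‖
  have hM : 0 ≤ M := norm_nonneg _
  have hP : 0 ≤ P := norm_nonneg _
  refine ⟨max 1 (M * P), le_max_left _ _, fun b L e hb hLm hL he hbL => ?_⟩
  have hcoord : ∀ i t z z', |E (b t z) i - E (b t z') i| ≤ P * L t * (‖z - z'‖ + e t) := by
    intro i t z z'
    have h1 : |E (b t z) i - E (b t z') i| ≤ ‖E (b t z - b t z')‖ := by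
      rw [map_sub]; exact norm_le_pi_norm (E (b t z) - E (b t z')) i
    refine h1.trans (((E : F →L[ℝ] (ι → ℝ)).le_opNorm _).trans ?_)
    rw [mul_assoc]
    exact mul_le_mul_of_nonneg_left (hbL t z z') hP
  have hPL : ∀ t, 0 ≤ P * L t := fun t => mul_nonneg hP (hL t)
  refine ⟨fun t z => E.symm fun i => infConv (fun w => E (b t w) i) (P * L t) z, ?_, ?_, ?_⟩
  · refine E.symm.continuous.measurable.comp (measurable_pi_lambda _ fun i => ?_)
    refine measurable_infConv (h := fun t w => E (b t w) i) (L := fun t => P * L t) ?_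
      (hLm.const_mul P)
    exact ((measurable_pi_apply i).comp E.continuous.measurable).comp hb
  · intro t z z'
    rw [← map_sub]
    refine ((E.symm : (ι → ℝ) →L[ℝ] F).le_opNorm _).trans ?_
    have h1 : ‖(fun i => infConv (fun w => E (b t w) i) (P * L t) z)
        - fun i => infConv (fun w => E (b t w) i) (P * L t) z'‖ ≤ P * L t * ‖z - z'‖ :=
      (pi_norm_le_iff_of_nonneg (mul_nonneg (hPL t) (norm_nonneg _))).2 fun i =>
        abs_infConv_sub_infConv_le (hPL t) (hcoord i t) z z'
    calc _ ≤ M * (P * L t * ‖z - z'‖) := mul_le_mul_of_nonneg_left h1 hM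
      _ = M * P * (L t * ‖z - z'‖) := by ring
      _ ≤ max 1 (M * P) * (L t * ‖z - z'‖) :=
        mul_le_mul_of_nonneg_right (le_max_right _ _) (mul_nonneg (hL t) (norm_nonneg _))
      _ = _ := by ring
  · intro t z
    have h0 : b t z = E.symm (E (b t z)) := (E.symm_apply_apply _).symm
    conv_lhs => rw [h0]
    rw [← map_sub]
    refine ((E.symm : (ι → ℝ) →L[ℝ] F).le_opNorm _).trans ?_
    have h1 : ‖(fun i => infConv (fun w => E (b t w) i) (P * L t) z) - E (b t z)‖
        ≤ P * L t * e t :=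
      (pi_norm_le_iff_of_nonneg (mul_nonneg (hPL t) (he t))).2 fun i =>
        abs_infConv_sub_le (hPL t) (hcoord i t) z
    calc _ ≤ M * (P * L t * e t) := mul_le_mul_of_nonneg_left h1 hM
      _ = M * P * (L t * e t) := by ring
      _ ≤ max 1 (M * P) * (L t * e t) :=
        mul_le_mul_of_nonneg_right (le_max_right _ _) (mul_nonneg (hL t) (he t))
      _ = _ := by ring

theorem self_mul_exp_neg_le_one {x : ℝ} : x * exp (-x) ≤ 1 := by
  rw [exp_neg, ← div_eq_mul_inv, div_le_one (exp_pos _)]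
  linarith [add_one_le_exp x]

/-- Regularising at the time-dependent scale `e^{-n(t)}` balances two effects: the Lipschitz
constant `K C n(t)` makes gradients grow like `e^{n/2}`, while the field error carries `e^{-n}`. The
scale is built with `K * C` rather than `C` so that its decay matches the Lipschitz constant of the
regularised field. -/
theorem exists_regularisation : ∃ K : ℝ, 1 ≤ K ∧ ∀ {C A : ℝ} {b : ℝ → F → F},
    LogLipschitzField C A b → ∀ {T N : ℝ}, 0 ≤ T → 1 ≤ N → ∃ (b' : ℝ → F → F) (L : ℝ),
      LogLipschitzField L (A + K * C) b' ∧
      (∀ t z z', ‖b' t z - b' t z'‖ ≤ L * ‖z - z'‖) ∧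
      (∀ t ∈ Icc 0 T, ∀ z z', ‖b' t z - b' t z'‖
        ≤ K * C * scale (K * C) T N t * ‖z - z'‖) ∧
      ∀ t ∈ Icc 0 T, ∀ z, ‖b' t z - b t z‖
        ≤ K * C * scale (K * C) T N t * exp (-scale (K * C) T N t) := by
  classical
  obtain ⟨K, hK, H⟩ := exists_lipschitz_approx F
  have hK0 : 0 ≤ K := zero_le_one.trans hK
  refine ⟨K, hK, fun {C A b} hb {T N} hT hN => ?_⟩
  have hC := hb.nonneg
  have hA := hb.nonneg_growth
  have hN0 := one_pos.trans_le hN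
  have hKC : 0 ≤ K * C := mul_nonneg hK0 hC
  set n := scale (K * C) T N
  have hn0 : ∀ t, 0 < n t := fun t => scale_pos hN0 t
  have hn1 : ∀ t ∈ Icc (0 : ℝ) T, 1 ≤ n t := fun t ht => hN.trans (le_scale hKC hN0.le ht.2)
  -- After `T` the scale may drop below 1, where the modulus is not available, and in the distant
  -- past it may be unbounded. Replacing the field by zero outside `[0, T]` gives a single Lipschitz
  -- constant, `K * C * n 0`, for all times.
  set b₁ : ℝ → F → F := fun t z => (Icc (0 : ℝ) T).indicator (fun t => b t z) t with hb₁
  set L₁ : ℝ → ℝ := (Icc (0 : ℝ) T).indicator fun t => C * n t with hL₁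
  have hmem : ∀ t ∈ Icc (0 : ℝ) T, b₁ t = b t ∧ L₁ t = C * n t := fun t ht =>
    ⟨funext fun z => indicator_of_mem ht _, indicator_of_mem ht _⟩
  have hnot : ∀ t ∉ Icc (0 : ℝ) T, b₁ t = 0 ∧ L₁ t = 0 := fun t ht =>
    ⟨funext fun z => indicator_of_notMem ht _, indicator_of_notMem ht _⟩
  have hL₁0 : ∀ t, 0 ≤ L₁ t := indicator_nonneg fun t _ => mul_nonneg hC (hn0 t).le
  have hb₁m : Measurable (Function.uncurry b₁) := by
    have : Function.uncurry b₁
        = (Icc (0 : ℝ) T ×ˢ (univ : Set F)).indicator (Function.uncurry b) := by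
      funext p
      by_cases hp : p.1 ∈ Icc (0 : ℝ) T
      · rw [indicator_of_mem (by simpa using hp)]
        exact congrFun (hmem p.1 hp).1 p.2
      · rw [indicator_of_notMem (by simpa using hp)]
        exact congrFun (hnot p.1 hp).1 p.2
    rw [this]
    exact hb.measurable.indicator (measurableSet_Icc.prod MeasurableSet.univ)
  have hL₁m : Measurable L₁ :=
    ((continuous_scale _ _ _).measurable.const_mul C).indicator measurableSet_Icc
  have hmod : ∀ t z z', ‖b₁ t z - b₁ t z'‖ ≤ L₁ t * (‖z - z'‖ + exp (-n t)) := by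
    intro t z z'
    by_cases ht : t ∈ Icc (0 : ℝ) T
    · rw [(hmem t ht).1, (hmem t ht).2]
      exact hb.modulus t z z' _ (hn1 t ht)
    · rw [(hnot t ht).1, (hnot t ht).2]
      simp
  obtain ⟨b', hm, hlip, herr⟩ := H b₁ L₁ (fun t => exp (-n t)) hb₁m hL₁m hL₁0
    (fun t => (exp_pos _).le) hmod
  have hLe : ∀ t, K * L₁ t ≤ K * C * n 0 := fun t => by
    by_cases ht : t ∈ Icc (0 : ℝ) T
    · rw [(hmem t ht).2, ← mul_assoc]
      exact mul_le_mul_of_nonneg_left (scale_anti hKC hN0.le ht.1) hKC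
    · rw [(hnot t ht).2, mul_zero]
      exact mul_nonneg hKC (hn0 0).le
  have hlip' : ∀ t z z', ‖b' t z - b' t z'‖ ≤ K * C * n 0 * ‖z - z'‖ := fun t z z' =>
    (hlip t z z').trans (mul_le_mul_of_nonneg_right (hLe t) (norm_nonneg _))
  refine ⟨b', K * C * n 0, ⟨hm, mul_nonneg hKC (hn0 0).le, by positivity, fun t z => ?_,
    fun t z z' m hm => ?_⟩, hlip', fun t ht z z' => ?_, fun t ht z => ?_⟩
  · have h1 : ‖b₁ t z‖ ≤ A * (1 + ‖z‖) := by
      by_cases ht : t ∈ Icc (0 : ℝ) T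
      · rw [(hmem t ht).1]; exact hb.growth t z
      · rw [(hnot t ht).1]; simp only [Pi.zero_apply, norm_zero]; positivity
    have h2 : ‖b' t z - b₁ t z‖ ≤ K * C := by
      refine (herr t z).trans ?_
      by_cases ht : t ∈ Icc (0 : ℝ) T
      · rw [(hmem t ht).2]
        calc K * (C * n t) * exp (-n t) = K * C * (n t * exp (-n t)) := by ring
          _ ≤ K * C := mul_le_of_le_one_right hKC self_mul_exp_neg_le_one
      · rw [(hnot t ht).2]; simpa using hKC
    have h3 := norm_le_norm_add_norm_sub' (b' t z) (b₁ t z)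
    nlinarith [norm_nonneg z]
  · refine (hlip' t z z').trans ?_
    have h1 : 0 ≤ K * C * n 0 := mul_nonneg hKC (hn0 0).le
    rw [mul_assoc (K * C * n 0)]
    refine mul_le_mul_of_nonneg_left ?_ h1
    nlinarith [norm_nonneg (z - z'), exp_pos (-m)]
  · refine (hlip t z z').trans_eq ?_
    rw [(hmem t ht).2]; ring
  · have := herr t z
    rw [(hmem t ht).1, (hmem t ht).2] at this
    refine this.trans_eq ?_
    ring

end Regularisation

/-! ### Differentiability of flows in time -/

section FlowDeriv

variable {F : Type*} [NormedAddCommGroup F] [NormedSpace ℝ F] [CompleteSpace F]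
  [MeasurableSpace F] [BorelSpace F] [SecondCountableTopology F]

/-- The null set of times must not depend on `z`. It is chosen for the countably many functions `t ↦
b t w` with `w` in a dense sequence, and the spatial Lipschitz bound transfers the derivative to
every `z`. The derivative is one-sided because `flow b t z` solves the equation only after time `t`.
-/
theorem ae_hasDerivWithinAt_flow {C A L : ℝ} {b : ℝ → F → F} (hb : LogLipschitzField C A b)
    (hL : 0 ≤ L) (hLip : ∀ t z z', ‖b t z - b t z'‖ ≤ L * ‖z - z'‖) :
    ∀ᵐ t : ℝ, ∀ z, HasDerivWithinAt (flow b t z) (b t z) (Ici t) t := by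
  have hint : ∀ w, LocallyIntegrable (fun t => b t w) := fun w => by
    refine (locallyIntegrable_const (A * (1 + ‖w‖))).mono
      (hb.measurable.comp (measurable_id.prodMk measurable_const)).aestronglyMeasurable
      (ae_of_all _ fun t => (hb.growth t w).trans (le_abs_self _))
  have hae : ∀ᵐ t : ℝ, ∀ k c, HasDerivAt
      (fun x => ∫ s in c..x, b s (TopologicalSpace.denseSeq F k))
      (b t (TopologicalSpace.denseSeq F k)) t :=
    ae_all_iff.2 fun k => LocallyIntegrable.ae_hasDerivAt_integral (hint _)
  filter_upwards [hae] with t ht z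
  have hZ := isSolution_flow hb t z
  have hZc := hZ.continuous
  rw [hasDerivWithinAt_iff_isLittleO, Asymptotics.isLittleO_iff]
  intro ε hε
  obtain ⟨k, hk⟩ := (TopologicalSpace.denseRange_denseSeq F).exists_dist_lt z
    (ε := ε / (4 * (L + 1))) (by positivity)
  set w := TopologicalSpace.denseSeq F k
  rw [dist_eq_norm, lt_div_iff₀ (by positivity)] at hk
  have hLw : L * ‖z - w‖ ≤ ε / 4 := by nlinarith [norm_nonneg (z - w)]
  have h1 := Asymptotics.isLittleO_iff.1 (hasDerivAt_iff_isLittleO.1 (ht k t))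
    (c := ε / 4) (by positivity)
  obtain ⟨δ, hδ, hcont⟩ := Metric.continuousAt_iff.1 (hZc.continuousAt (x := t))
    (ε / (4 * (L + 1))) (by positivity)
  filter_upwards [nhdsWithin_le_nhds h1, nhdsWithin_le_nhds (Metric.ball_mem_nhds t hδ),
    self_mem_nhdsWithin] with s hs1 hs2 hs3
  have hts : t ≤ s := hs3
  have hst0 : 0 ≤ s - t := sub_nonneg.2 hts
  have hnear : ∀ r ∈ Icc t s, L * ‖flow b t z r - z‖ ≤ ε / 4 := fun r hr => by
    have hr' : dist r t < δ := by
      rw [Metric.mem_ball, Real.dist_eq, abs_of_nonneg hst0] at hs2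
      rw [Real.dist_eq, abs_of_nonneg (sub_nonneg.2 hr.1)]
      linarith [hr.2]
    have := hcont hr'
    rw [hZ.initial, dist_eq_norm, lt_div_iff₀ (by positivity)] at this
    nlinarith [norm_nonneg (flow b t z r - z)]
  have hiw : IntervalIntegrable (fun r => b r w) volume t s :=
    (hint w).integrableOn_isCompact isCompact_uIcc |>.intervalIntegrable
  have hI := hb.intervalIntegrable hZc t s
  -- Three errors: replacing the trajectory by the nearby dense point `w` (at most `ε / 2`), the
  -- Lebesgue point property at `w` (`ε / 4`), and returning from `w` to `z` (`ε / 4`), each times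
  -- `s - t`.
  have e1 : flow b t z s - flow b t z t - (s - t) • b t z
      = (∫ r in t..s, (b r (flow b t z r) - b r w))
        + ((∫ r in t..s, b r w) - (∫ r in t..t, b r w) - (s - t) • b t w)
        + (s - t) • (b t w - b t z) := by
    rw [intervalIntegral.integral_sub hI hiw, hZ.initial, hZ.eq s hts,
      intervalIntegral.integral_same, smul_sub]
    abel
  have n1 : ‖∫ r in t..s, (b r (flow b t z r) - b r w)‖ ≤ ε / 2 * (s - t) := by
    refine (intervalIntegral.norm_integral_le_of_norm_le_const (C := ε / 2)
      fun r hr => ?_).trans_eq (by rw [abs_of_nonneg hst0])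
    rw [uIoc_of_le hts] at hr
    have := hnear r ⟨hr.1.le, hr.2⟩
    have h3 := mul_le_mul_of_nonneg_left
      (norm_sub_le_norm_sub_add_norm_sub (flow b t z r) z w) hL
    linarith [hLip r (flow b t z r) w]
  have n2 : ‖(s - t) • (b t w - b t z)‖ ≤ ε / 4 * (s - t) := by
    rw [norm_smul, Real.norm_eq_abs, abs_of_nonneg hst0, mul_comm]
    refine mul_le_mul_of_nonneg_right ?_ hst0
    have := hLip t w z
    rw [norm_sub_rev w z] at this
    linarith
  rw [Real.norm_eq_abs, abs_of_nonneg hst0] at hs1 ⊢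
  rw [e1]
  refine (norm_add₃_le).trans ?_
  linarith

end FlowDeriv

/-! ### The backward transport equation -/

section Dual

variable {F : Type*} [NormedAddCommGroup F] [NormedSpace ℝ F]
  [MeasureSpace F] [BorelSpace F]

/-- The solution of the backward problem `∂_t φ + b · ∇ φ = g`, `φ(T) = 0`. -/
noncomputable def dualSolution (b : ℝ → F → F) (T : ℝ) (g : ℝ × F → ℝ) (t : ℝ) (z : F) : ℝ :=
  -∫ s in t..T, g (s, flow b t z s)

variable [SecondCountableTopology F] [CompleteSpace F]
variable {C A L T δ M R : ℝ} {b : ℝ → F → F} {g : ℝ × F → ℝ} {Kg : ℝ≥0}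

theorem norm_flow_sub_flow_le (hb : LogLipschitzField C A b) (hL : 0 ≤ L)
    (hLip : ∀ t z z', ‖b t z - b t z'‖ ≤ L * ‖z - z'‖) {t s : ℝ} (hts : t ≤ s) (z z' : F) :
    ‖flow b t z s - flow b t z' s‖ ≤ exp (L * (s - t)) * ‖z - z'‖ := by
  have h1 := isSolution_flow hb t z
  have h2 := isSolution_flow hb t z'
  have c1 := h1.continuous
  have c2 := h2.continuous
  have := gronwall_integral_const (u := fun r => ‖flow b t z r - flow b t z' r‖)
    (a := ‖z - z'‖) (σ := 0) (S := s) (t₀ := t) hL le_rfl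
    ((by fun_prop : Continuous _).continuousOn.integrableOn_Icc) (fun r hr => ?_) s ⟨hts, le_rfl⟩
  · simpa using this
  · exact h1.norm_sub_le_of_le hb hb h2 hr.1 (by fun_prop) fun q _ => by
      simpa using hLip q _ _

theorem norm_flow_sub_initial_le (hb : LogLipschitzField C A b) {t s : ℝ} (hts : t ≤ s) (z : F) :
    ‖flow b t z s - z‖ ≤ A * (exp (A * (s - t)) * (1 + ‖z‖)) * (s - t) := by
  have h1 := isSolution_flow hb t z
  have hA := hb.nonneg_growth
  rw [h1.eq s hts, add_sub_cancel_left]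
  refine (intervalIntegral.norm_integral_le_of_norm_le_const fun r hr => ?_).trans_eq
    (by rw [abs_of_nonneg (sub_nonneg.2 hts)])
  rw [uIoc_of_le hts] at hr
  refine (hb.growth r _).trans (mul_le_mul_of_nonneg_left ?_ hA)
  refine (h1.one_add_norm_le hb hr.1.le).trans ?_
  have := hr.2
  gcongr

theorem continuous_comp_flow (hb : LogLipschitzField C A b) (hg : Continuous g) (t : ℝ) (z : F) :
    Continuous fun s => g (s, flow b t z s) := by
  have := (isSolution_flow hb t z).continuous
  fun_prop

/-- The bound `c` on the distance of trajectories is left free because two are used: a crude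
exponential one, for Lipschitz continuity alone, and the one adapted to the moving scale, for the
quantitative estimate. -/
theorem abs_dualSolution_sub_le (hb : LogLipschitzField C A b) (hg : LipschitzWith Kg g)
    {t c : ℝ} (ht : t ∈ Icc 0 T) (z z' : F) (hc : 0 ≤ c)
    (h : ∀ s ∈ Icc t T, ‖flow b t z s - flow b t z' s‖ ≤ c) :
    |dualSolution b T g t z - dualSolution b T g t z'| ≤ T * Kg * c := by
  unfold dualSolution
  rw [neg_sub_neg, ← intervalIntegral.integral_sub
    ((continuous_comp_flow hb hg.continuous _ _).intervalIntegrable _ _)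
    ((continuous_comp_flow hb hg.continuous _ _).intervalIntegrable _ _), ← Real.norm_eq_abs]
  refine (intervalIntegral.norm_integral_le_of_norm_le_const (C := Kg * c) fun r hr => ?_).trans ?_
  · rw [uIoc_of_le ht.2] at hr
    refine (hg.norm_sub_le _ _).trans (mul_le_mul_of_nonneg_left ?_ Kg.2)
    rw [Prod.mk_sub_mk, sub_self, Prod.norm_def, norm_zero, norm_sub_rev]
    exact max_le hc (h r ⟨hr.1.le, hr.2⟩)
  · rw [abs_of_nonneg (sub_nonneg.2 ht.2)]
    have h1 : 0 ≤ Kg * c := mul_nonneg Kg.2 hc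
    nlinarith [ht.1]

/-- This is the backward equation in integral form along a characteristic, a consequence of the
semigroup property of the flow. -/
theorem dualSolution_eq (hb : LogLipschitzField C A b) (hg : Continuous g) {t t' : ℝ}
    (h : t ≤ t') (hT : t' ≤ T) (z : F) :
    dualSolution b T g t' (flow b t z t')
      = dualSolution b T g t z + ∫ s in t..t', g (s, flow b t z s) := by
  have h1 : ∫ s in t'..T, g (s, flow b t' (flow b t z t') s)
      = ∫ s in t'..T, g (s, flow b t z s) := by
    refine intervalIntegral.integral_congr fun s hs => ?_
    rw [uIcc_of_le hT] at hs
    simp only [flow_flow hb z h hs.1]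
  have hc := continuous_comp_flow hb hg t z
  unfold dualSolution
  rw [h1, ← intervalIntegral.integral_add_adjacent_intervals (hc.intervalIntegrable t t')
    (hc.intervalIntegrable t' T)]
  ring

omit [BorelSpace F] [SecondCountableTopology F] [CompleteSpace F] in
theorem abs_dualSolution_le (hM : ∀ p, ‖g p‖ ≤ M) {t : ℝ} (ht : t ∈ Icc 0 T) (z : F) :
    |dualSolution b T g t z| ≤ T * M := by
  unfold dualSolution
  rw [abs_neg, ← Real.norm_eq_abs]
  refine (intervalIntegral.norm_integral_le_of_norm_le_const fun r _ => hM _).trans ?_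
  rw [abs_of_nonneg (sub_nonneg.2 ht.2)]
  have h0 : 0 ≤ M := (norm_nonneg _).trans (hM 0)
  nlinarith [ht.1]

omit [BorelSpace F] [SecondCountableTopology F] [CompleteSpace F] in
theorem dualSolution_eq_zero (hgT : ∀ t z, T - δ ≤ t → g (t, z) = 0) {t : ℝ} (htT : t ≤ T)
    (ht : T - δ ≤ t) (z : F) : dualSolution b T g t z = 0 := by
  unfold dualSolution
  rw [neg_eq_zero]
  refine intervalIntegral.integral_zero_ae (ae_of_all _ fun s hs => hgT _ _ ?_)
  rw [uIoc_of_le htT] at hs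
  linarith [hs.1]

/-- By linear growth, a trajectory started far away cannot reach the support of `g` before time `T`.
-/
theorem norm_le_of_dualSolution_ne_zero (hb : LogLipschitzField C A b)
    (hR : ∀ p, g p ≠ 0 → ‖p‖ ≤ R) {t : ℝ} (ht : t ∈ Icc 0 T) {z : F}
    (h : dualSolution b T g t z ≠ 0) : ‖z‖ ≤ exp (A * T) * (1 + |R|) := by
  by_contra hlt
  push Not at hlt
  refine h ?_
  unfold dualSolution
  rw [neg_eq_zero]
  refine intervalIntegral.integral_zero_ae (ae_of_all _ fun s hs => ?_)
  rw [uIoc_of_le ht.2] at hs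
  by_contra hne
  have h1 := (norm_snd_le _).trans (hR _ hne)
  have h2 := (isSolution_flow hb t z).one_add_norm_initial_le hb hs.1.le
  have hA := hb.nonneg_growth
  have h3 : exp (A * (s - t)) * (1 + ‖flow b t z s‖) ≤ exp (A * T) * (1 + |R|) := by
    have : s - t ≤ T := by linarith [ht.1, hs.2]
    have : ‖flow b t z s‖ ≤ |R| := h1.trans (le_abs_self R)
    gcongr
  linarith

/-- The value at `(t, z)` is carried along the characteristic to time `t'`, where the spatial
Lipschitz bound compares the endpoint with `z`. The displacement is uniformly bounded only for `z`
in a ball; outside it both values are zero. -/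
theorem abs_dualSolution_sub_le_time (hb : LogLipschitzField C A b) (hL : 0 ≤ L)
    (hLip : ∀ t z z', ‖b t z - b t z'‖ ≤ L * ‖z - z'‖) (hg : LipschitzWith Kg g)
    (hM : ∀ p, ‖g p‖ ≤ M) (hR : ∀ p, g p ≠ 0 → ‖p‖ ≤ R) :
    ∃ K : ℝ, ∀ t t', 0 ≤ t → t ≤ t' → t' ≤ T → ∀ z,
      |dualSolution b T g t z - dualSolution b T g t' z| ≤ K * (t' - t) := by
  have hA := hb.nonneg_growth
  set R' := exp (A * T) * (1 + |R|)
  have hM0 : 0 ≤ M := (norm_nonneg _).trans (hM 0)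
  have hR0 : 0 ≤ R' := by positivity
  refine ⟨T * Kg * (exp (L * T) * (A * (exp (A * T) * (1 + R')))) + M, fun t t' h0 h hT z => ?_⟩
  have hT0 : 0 ≤ T := h0.trans (h.trans hT)
  have htt : 0 ≤ t' - t := sub_nonneg.2 h
  by_cases hz : ‖z‖ ≤ R'
  · have e := dualSolution_eq (T := T) hb hg.continuous h hT z
    have n1 : |∫ s in t..t', g (s, flow b t z s)| ≤ M * (t' - t) := by
      rw [← Real.norm_eq_abs]
      exact (intervalIntegral.norm_integral_le_of_norm_le_const fun r _ => hM _).trans_eq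
        (by rw [abs_of_nonneg htt])
    have n2 := abs_dualSolution_sub_le (T := T) (t := t') hb hg ⟨h0.trans h, hT⟩
      (flow b t z t') z (c := exp (L * T) * (A * (exp (A * T) * (1 + R')) * (t' - t)))
      (by positivity) fun s hs => by
        refine (norm_flow_sub_flow_le hb hL hLip hs.1 _ _).trans ?_
        have h1 := norm_flow_sub_initial_le hb h z
        have h2 : A * (exp (A * (t' - t)) * (1 + ‖z‖)) * (t' - t)
            ≤ A * (exp (A * T) * (1 + R')) * (t' - t) := by
          have : t' - t ≤ T := by linarith
          gcongr
        have h3 : s - t' ≤ T := by linarith [hs.2]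
        have h4 := h1.trans h2
        gcongr
    have : dualSolution b T g t z - dualSolution b T g t' z
        = (dualSolution b T g t' (flow b t z t') - dualSolution b T g t' z)
          - ∫ s in t..t', g (s, flow b t z s) := by rw [e]; ring
    rw [this]
    refine (abs_sub _ _).trans ?_
    nlinarith
  · have z1 : dualSolution b T g t z = 0 := by
      by_contra hne
      exact hz (norm_le_of_dualSolution_ne_zero hb hR ⟨h0, h.trans hT⟩ hne)
    have z2 : dualSolution b T g t' z = 0 := by
      by_contra hne
      exact hz (norm_le_of_dualSolution_ne_zero hb hR ⟨h0.trans h, hT⟩ hne)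
    rw [z1, z2, sub_zero, abs_zero]
    positivity

/-- Differentiability at almost every point comes from Rademacher's theorem, so the equation need
only be read off along the curve `s ↦ (s, flow b t z s)`, which has a right derivative at almost
every starting time. -/
theorem exists_lipschitz_dual [FiniteDimensional ℝ F] [(volume : Measure F).IsAddHaarMeasure]
    (hb : LogLipschitzField C A b) (hL : 0 ≤ L)
    (hLip : ∀ t z z', ‖b t z - b t z'‖ ≤ L * ‖z - z'‖) (hT : 0 < T) (hδ : 0 < δ)
    (hg : LipschitzWith Kg g) (hgc : HasCompactSupport g)
    (hgT : ∀ t z, T - δ ≤ t → g (t, z) = 0) :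
    ∃ (φ : ℝ × F → ℝ) (K : ℝ≥0), LipschitzWith K φ ∧ HasCompactSupport φ ∧
      (∀ t z, T - δ ≤ t → φ (t, z) = 0) ∧
      (∀ t ∈ Icc 0 T, ∀ z, φ (t, z) = dualSolution b T g t z) ∧
      ∀ᵐ p ∂(volume.restrict (Icc 0 T ×ˢ (univ : Set F))),
        DifferentiableAt ℝ φ p ∧ fderiv ℝ φ p (1, b p.1 p.2) = g p := by
  obtain ⟨R, hR⟩ : ∃ R, ∀ p, g p ≠ 0 → ‖p‖ ≤ R := by
    obtain ⟨R, hR⟩ := hgc.isCompact.isBounded.exists_norm_le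
    exact ⟨R, fun p hp => hR p (subset_tsupport g hp)⟩
  obtain ⟨M, hM⟩ : ∃ M, ∀ p, ‖g p‖ ≤ M := hgc.exists_bound_of_continuous hg.continuous
  have hM0 : 0 ≤ M := (norm_nonneg _).trans (hM 0)
  obtain ⟨K₁, hK₁⟩ := abs_dualSolution_sub_le_time (T := T) hb hL hLip hg hM hR
  set D := dualSolution b T g with hD
  -- Extension to all times: `cl` clamps time to `[0, T]`, and the ramp `θ`, equal to 1 for `t ≥ 0`
  -- and to 0 for `t ≤ -1`, makes the support compact.
  set cl : ℝ → ℝ := fun t => max 0 (min t T) with hcl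
  set θ : ℝ → ℝ := fun t => max 0 (min 1 (1 + t)) with hθ
  have hclmem : ∀ t, cl t ∈ Icc 0 T := fun t =>
    ⟨le_max_left _ _, max_le hT.le (min_le_right _ _)⟩
  have hclid : ∀ t ∈ Icc 0 T, cl t = t := fun t ht => by
    simp only [hcl, min_eq_left ht.2, max_eq_right ht.1]
  have hclLip : ∀ t t', |cl t - cl t'| ≤ |t - t'| := fun t t' => by
    simp only [hcl]
    refine (abs_max_sub_max_le_max _ _ _ _).trans ?_
    rw [sub_self, abs_zero]
    refine max_le (abs_nonneg _) ((abs_min_sub_min_le_max _ _ _ _).trans ?_)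
    simp
  have hθLip : ∀ t t', |θ t - θ t'| ≤ |t - t'| := fun t t' => by
    simp only [hθ]
    refine (abs_max_sub_max_le_max _ _ _ _).trans ?_
    rw [sub_self, abs_zero]
    refine max_le (abs_nonneg _) ((abs_min_sub_min_le_max _ _ _ _).trans ?_)
    simp
  have hθ0 : ∀ t, 0 ≤ θ t := fun t => le_max_left _ _
  have hθ1 : ∀ t, θ t ≤ 1 := fun t => max_le zero_le_one (min_le_left _ _)
  have hθid : ∀ t, 0 ≤ t → θ t = 1 := fun t ht => by
    simp only [hθ, min_eq_left (by linarith : (1 : ℝ) ≤ 1 + t), max_eq_right zero_le_one]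
  set φ : ℝ × F → ℝ := fun p => θ p.1 * D (cl p.1) p.2 with hφ
  set K₂ : ℝ := T * Kg * exp (L * T) with hK₂
  have hK₂0 : 0 ≤ K₂ := by positivity
  have hDz : ∀ t ∈ Icc 0 T, ∀ z z', |D t z - D t z'| ≤ K₂ * ‖z - z'‖ := fun t ht z z' => by
    refine (abs_dualSolution_sub_le hb hg ht z z' (c := exp (L * T) * ‖z - z'‖)
      (by positivity) fun s hs => ?_).trans_eq (by rw [hK₂]; ring)
    refine (norm_flow_sub_flow_le hb hL hLip hs.1 z z').trans ?_
    have : s - t ≤ T := by linarith [hs.2, ht.1]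
    gcongr
  have hDt : ∀ t ∈ Icc 0 T, ∀ t' ∈ Icc 0 T, ∀ z, |D t z - D t' z| ≤ |K₁| * |t - t'| := by
    intro t ht t' ht' z
    rcases le_total t t' with h | h
    · rw [abs_sub_comm t t', abs_of_nonneg (sub_nonneg.2 h)]
      exact (hK₁ t t' ht.1 h ht'.2 z).trans
        (mul_le_mul_of_nonneg_right (le_abs_self _) (sub_nonneg.2 h))
    · rw [abs_sub_comm (D t z), abs_of_nonneg (sub_nonneg.2 h)]
      exact (hK₁ t' t ht'.1 h ht.2 z).trans
        (mul_le_mul_of_nonneg_right (le_abs_self _) (sub_nonneg.2 h))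
  have hφLip : LipschitzWith (Real.toNNReal (T * M + |K₁| + K₂)) φ := by
    refine LipschitzWith.of_dist_le_mul fun p q => ?_
    rw [Real.coe_toNNReal _ (by positivity), dist_eq_norm, dist_eq_norm, Real.norm_eq_abs]
    have e : φ p - φ q = (θ p.1 - θ q.1) * D (cl p.1) p.2
        + θ q.1 * ((D (cl p.1) p.2 - D (cl q.1) p.2) + (D (cl q.1) p.2 - D (cl q.1) q.2)) := by
      simp only [hφ]; ring
    have t1 : |p.1 - q.1| ≤ ‖p - q‖ := norm_fst_le (p - q)
    have t2 : ‖p.2 - q.2‖ ≤ ‖p - q‖ := norm_snd_le (p - q)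
    have a1 : |(θ p.1 - θ q.1) * D (cl p.1) p.2| ≤ ‖p - q‖ * (T * M) := by
      rw [abs_mul]
      exact mul_le_mul ((hθLip _ _).trans t1) (abs_dualSolution_le hM (hclmem _) _)
        (abs_nonneg _) (norm_nonneg _)
    have a2 : |D (cl p.1) p.2 - D (cl q.1) p.2| ≤ |K₁| * ‖p - q‖ :=
      (hDt _ (hclmem _) _ (hclmem _) _).trans
        (mul_le_mul_of_nonneg_left ((hclLip _ _).trans t1) (abs_nonneg _))
    have a3 : |D (cl q.1) p.2 - D (cl q.1) q.2| ≤ K₂ * ‖p - q‖ :=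
      (hDz _ (hclmem _) _ _).trans (mul_le_mul_of_nonneg_left t2 hK₂0)
    have a4 : |θ q.1 * ((D (cl p.1) p.2 - D (cl q.1) p.2)
        + (D (cl q.1) p.2 - D (cl q.1) q.2))| ≤ |K₁| * ‖p - q‖ + K₂ * ‖p - q‖ := by
      rw [abs_mul, abs_of_nonneg (hθ0 _)]
      exact (mul_le_of_le_one_left (abs_nonneg _) (hθ1 _)).trans
        ((abs_add_le _ _).trans (add_le_add a2 a3))
    rw [e]
    refine (abs_add_le _ _).trans ?_
    nlinarith
  have hφT : ∀ t z, T - δ ≤ t → φ (t, z) = 0 := fun t z ht => by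
    have : D (cl t) z = 0 := dualSolution_eq_zero hgT (hclmem t).2
      (le_trans (le_min ht (by linarith)) (le_max_right _ _)) z
    simp only [hφ, this, mul_zero]
  have hφD : ∀ t ∈ Icc 0 T, ∀ z, φ (t, z) = D t z := fun t ht z => by
    simp only [hφ, hclid t ht, hθid t ht.1, one_mul]
  refine ⟨φ, _, hφLip, ?_, hφT, hφD, ?_⟩
  · refine HasCompactSupport.of_support_subset_isCompact
      (K := Icc (-1) T ×ˢ Metric.closedBall (0 : F) (exp (A * T) * (1 + |R|)))
      (isCompact_Icc.prod (isCompact_closedBall _ _)) fun p hp => ?_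
    have hp' : φ p ≠ 0 := hp
    refine ⟨⟨?_, ?_⟩, mem_closedBall_zero_iff.2
      (norm_le_of_dualSolution_ne_zero hb hR (hclmem p.1) (right_ne_zero_of_mul hp'))⟩
    · by_contra hlt
      push Not at hlt
      refine left_ne_zero_of_mul hp' ?_
      simp only [hθ]
      exact max_eq_left ((min_le_right _ _).trans (by linarith))
    · by_contra hlt
      push Not at hlt
      exact hp' (hφT p.1 p.2 (by linarith))
  · have hae : ∀ᵐ p : ℝ × F, ∀ z,
        HasDerivWithinAt (flow b p.1 z) (b p.1 z) (Ici p.1) p.1 :=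
      (Measure.quasiMeasurePreserving_fst (μ := (volume : Measure ℝ))
        (ν := (volume : Measure F))).ae (ae_hasDerivWithinAt_flow hb hL hLip)
    have hneT : ∀ᵐ p : ℝ × F, p.1 ≠ T :=
      (Measure.quasiMeasurePreserving_fst (μ := (volume : Measure ℝ))
        (ν := (volume : Measure F))).ae
        (compl_mem_ae_iff.2 (measure_singleton T))
    have hmeas : MeasurableSet (Icc 0 T ×ˢ (univ : Set F)) :=
      measurableSet_Icc.prod MeasurableSet.univ
    filter_upwards [ae_restrict_of_ae hae, ae_restrict_of_ae hneT,
      ae_restrict_of_ae (hφLip.ae_differentiableAt (μ := volume)), ae_restrict_mem hmeas]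
      with p hp1 hp2 hp3 hp4
    refine ⟨hp3, ?_⟩
    obtain ⟨t, z⟩ := p
    have ht : t ∈ Icc 0 T := hp4.1
    have htT : t < T := lt_of_le_of_ne ht.2 hp2
    have hZ := isSolution_flow hb t z
    -- The right derivative at `t` of `φ` along the characteristic is computed twice, by the chain
    -- rule (`d1`) and from the integral formula (`d2`); uniqueness of one-sided derivatives gives
    -- the equation.
    have d1 : HasDerivWithinAt (fun s => φ (s, flow b t z s)) (fderiv ℝ φ (t, z) (1, b t z))
        (Ici t) t := by
      have hγ : HasDerivWithinAt (fun s => (s, flow b t z s)) ((1 : ℝ), b t z) (Ici t) t :=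
        (hasDerivWithinAt_id t _).prodMk (hp1 z)
      have hfd : HasFDerivAt φ (fderiv ℝ φ (t, z)) ((fun s => (s, flow b t z s)) t) := by
        simpa only [hZ.initial] using hp3.hasFDerivAt
      exact hfd.comp_hasDerivWithinAt t hγ
    have hc := continuous_comp_flow hb hg.continuous t z
    have d2 : HasDerivWithinAt (fun s => D t z + ∫ r in t..s, g (r, flow b t z r)) (g (t, z))
        (Ici t) t := by
      have := (intervalIntegral.integral_hasDerivAt_right (hc.intervalIntegrable t t)
        (hc.stronglyMeasurableAtFilter _ _) hc.continuousAt).const_add (D t z)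
      rw [hZ.initial] at this
      exact this.hasDerivWithinAt
    have heq : (fun s => φ (s, flow b t z s))
        =ᶠ[𝓝[Ici t] t] fun s => D t z + ∫ r in t..s, g (r, flow b t z r) := by
      filter_upwards [self_mem_nhdsWithin, nhdsWithin_le_nhds (Iio_mem_nhds htT)] with s hs1 hs2
      rw [hφD s ⟨ht.1.trans hs1, hs2.le⟩]
      exact dualSolution_eq hb hg.continuous hs1 hs2.le z
    have d3 := d2.congr_of_eventuallyEq heq (by
      simp [hφD t ht, hZ.initial])
    exact (uniqueDiffWithinAt_Ici t).eq_deriv _ d1 d3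

end Dual

/-! ### Lagrangian representation of weak solutions -/

section Representation

variable {F : Type*} [NormedAddCommGroup F] [NormedSpace ℝ F] [FiniteDimensional ℝ F]
  [MeasureSpace F] [BorelSpace F] [SecondCountableTopology F] [CompleteSpace F]
  [(volume : Measure F).IsAddHaarMeasure]

-- The error between two fields has no time component, so only the spatial Lipschitz constant of the
-- test function matters; its Lipschitz constant in time is never controlled quantitatively.
omit [FiniteDimensional ℝ F] [MeasureSpace F] [BorelSpace F] [SecondCountableTopology F]
  [CompleteSpace F] [(volume : Measure F).IsAddHaarMeasure] in
theorem abs_fderiv_apply_zero_le {φ : ℝ × F → ℝ} {p : ℝ × F} (hφ : DifferentiableAt ℝ φ p) {c : ℝ}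
    (hc : 0 ≤ c) (h : ∀ z z', |φ (p.1, z) - φ (p.1, z')| ≤ c * ‖z - z'‖) (w : F) :
    |fderiv ℝ φ p (0, w)| ≤ c * ‖w‖ := by
  have h1 : HasFDerivAt (fun z => φ (p.1, z))
      ((fderiv ℝ φ p).comp (ContinuousLinearMap.inr ℝ ℝ F)) p.2 :=
    hφ.hasFDerivAt.comp p.2 (hasFDerivAt_prodMk_right p.1 p.2)
  have h2 : LipschitzWith (Real.toNNReal c) (fun z => φ (p.1, z)) :=
    LipschitzWith.of_dist_le_mul fun z z' => by
      rw [Real.coe_toNNReal _ hc, Real.dist_eq, dist_eq_norm]; exact h z z'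
  have h3 := h1.le_of_lipschitz h2
  rw [Real.coe_toNNReal _ hc] at h3
  have h4 := ((fderiv ℝ φ p).comp (ContinuousLinearMap.inr ℝ ℝ F)).le_of_opNorm_le h3 w
  simpa using h4

/-- The test function solves the backward problem for the regularised field `b'`. Inserting it in
the weak equation for `b` leaves two errors: `∫ f ∇φ · (b - b')`, and the difference of the two
flows in the initial term. Both are of size `e^{-N/2}`, and `N` is arbitrary. -/
theorem IsLinearWeakSolution.integral_mul_eq {C A T δ : ℝ} {b : ℝ → F → F} {f₀ : F → ℝ}
    {f : ℝ × F → ℝ} (hf : IsLinearWeakSolution b T f₀ f) (hb : LogLipschitzField C A b)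
    (hT : 0 < T) {g : ℝ × F → ℝ} {Kg : ℝ≥0} (hg : LipschitzWith Kg g) (hgc : HasCompactSupport g)
    (hδ : 0 < δ) (hgT : ∀ t z, T - δ ≤ t → g (t, z) = 0) :
    ∫ p in Icc 0 T ×ˢ (univ : Set F), f p * g p
      = ∫ z, f₀ z * ∫ s in (0 : ℝ)..T, g (s, flow b 0 z s) := by
  obtain ⟨K, hK, H⟩ := exists_regularisation F
  set C' := K * C with hC'
  have hC'0 : 0 ≤ C' := mul_nonneg (zero_le_one.trans hK) hb.nonneg
  have hgi : Integrable (fun p => f p * g p) (volume.restrict (Icc 0 T ×ˢ (univ : Set F))) := by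
    obtain ⟨M, hM⟩ : ∃ M, ∀ p, ‖g p‖ ≤ M := hgc.exists_bound_of_continuous hg.continuous
    exact hf.integrable.mul_bdd (c := M) hg.continuous.aestronglyMeasurable (ae_of_all _ hM)
  set I₁ := ∫ p in Icc 0 T ×ˢ (univ : Set F), ‖f p‖
  set I₂ := ∫ z, ‖f₀ z‖
  set G : F → ℝ := fun z => ∫ s in (0 : ℝ)..T, g (s, flow b 0 z s) with hG
  have key : ∀ N : ℝ, 1 ≤ N → |(∫ p in Icc 0 T ×ˢ (univ : Set F), f p * g p)
      - ∫ z, f₀ z * G z| ≤ (I₁ * (T * Kg * C') + I₂ * (T * Kg * (C' * T))) * exp (-(N / 2)) := by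
    intro N hN
    have hN0 : 0 < N := one_pos.trans_le hN
    obtain ⟨b', L, hb', hLip, hLip', herr⟩ := H hb hT.le hN
    set n := scale C' T N with hn
    have hL0 : 0 ≤ L := hb'.nonneg
    obtain ⟨φ, Kφ, hφLip, hφc, hφT, hφD, hφae⟩ :=
      exists_lipschitz_dual hb' hL0 hLip hT hδ hg hgc hgT
    have hweak := hf.weak_eq_lipschitz hb hφLip hφc hδ hφT
    obtain ⟨Mφ, hMφ⟩ : ∃ M, ∀ p, ‖φ p‖ ≤ M := hφc.exists_bound_of_continuous hφLip.continuous
    -- spatial Lipschitz bound of the dual solution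
    have hφz : ∀ t ∈ Icc 0 T, ∀ z z', |φ (t, z) - φ (t, z')|
        ≤ T * Kg * exp ((n t - N) / 2) * ‖z - z'‖ := fun t ht z z' => by
      rw [hφD t ht, hφD t ht, mul_assoc (T * Kg : ℝ)]
      refine abs_dualSolution_sub_le hb' hg ht z z' (by positivity) fun s hs => ?_
      have h1 := (isSolution_flow hb' t z).norm_sub_le_scale (S := T) (N := N) (σ := 0) hb' hb'
        (isSolution_flow hb' t z') hC'0 hN0 le_rfl
        (fun r hr => by simpa using hLip' r ⟨ht.1.trans hr.1, hr.2⟩ _ _) s hs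
      simp only [zero_mul, add_zero] at h1
      refine h1.trans ?_
      have h2 : N ≤ n s := le_scale hC'0 hN0.le hs.2
      have h3 : (scale C' T N t - scale C' T N s) / 2 ≤ (n t - N) / 2 := by
        simp only [hn] at h2 ⊢; linarith
      gcongr
    -- the error in the transport operator
    have herr1 : ∀ᵐ p ∂(volume.restrict (Icc 0 T ×ˢ (univ : Set F))),
        ‖f p * fderiv ℝ φ p (1, b p.1 p.2) - f p * g p‖
          ≤ ‖f p‖ * (T * Kg * C' * exp (-(N / 2))) := by
      filter_upwards [hφae, ae_restrict_mem (measurableSet_Icc.prod MeasurableSet.univ)]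
        with p hp1 hp2
      have ht : p.1 ∈ Icc 0 T := hp2.1
      rw [← mul_sub, norm_mul]
      refine mul_le_mul_of_nonneg_left ?_ (norm_nonneg _)
      rw [← hp1.2, ← map_sub, Prod.mk_sub_mk, sub_self, Real.norm_eq_abs]
      refine (abs_fderiv_apply_zero_le hp1.1 (by positivity) (hφz p.1 ht) _).trans ?_
      have h1 := herr p.1 ht p.2
      rw [norm_sub_rev] at h1
      -- The gradient growth times the field error is `e^{(n-N)/2} · n e^{-n} = n e^{-n/2} ·
      -- e^{-N/2}`, and `n e^{-n/2} ≤ 1`.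
      have h2 := self_mul_exp_neg_half_le_one (scale_pos (C := C') (S := T) hN0 p.1).le
      calc T * Kg * exp ((n p.1 - N) / 2) * ‖b p.1 p.2 - b' p.1 p.2‖
          ≤ T * Kg * exp ((n p.1 - N) / 2) * (C' * n p.1 * exp (-n p.1)) := by gcongr
        _ = T * Kg * C' * (n p.1 * (exp ((n p.1 - N) / 2) * exp (-n p.1))) := by ring
        _ = T * Kg * C' * (n p.1 * exp (-(n p.1 / 2))) * exp (-(N / 2)) := by
            have : exp ((n p.1 - N) / 2) * exp (-n p.1)
                = exp (-(n p.1 / 2)) * exp (-(N / 2)) := by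
              rw [← exp_add, ← exp_add]; congr 1; ring
            rw [this]; ring
        _ ≤ T * Kg * C' * 1 * exp (-(N / 2)) := by gcongr
        _ = _ := by ring
    have hmeasb : Measurable fun p : ℝ × F => fderiv ℝ φ p (1, b p.1 p.2) :=
      (ContinuousLinearMap.measurable_apply₂ (E := ℝ × F) (F := ℝ)).comp
        ((measurable_fderiv ℝ φ).prodMk (measurable_const.prodMk hb.measurable))
    have hdiffi : Integrable (fun p => f p * fderiv ℝ φ p (1, b p.1 p.2) - f p * g p)
        (volume.restrict (Icc 0 T ×ˢ (univ : Set F))) :=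
      (hf.integrable.norm.mul_const _).mono'
        ((hf.integrable.aestronglyMeasurable.mul hmeasb.aestronglyMeasurable).sub
          hgi.aestronglyMeasurable) herr1
    have hfi : Integrable (fun p => f p * fderiv ℝ φ p (1, b p.1 p.2))
        (volume.restrict (Icc 0 T ×ˢ (univ : Set F))) := by
      have := hdiffi.add hgi
      refine this.congr (ae_of_all _ fun p => ?_)
      simp
    have e1 : |(∫ p in Icc 0 T ×ˢ (univ : Set F), f p * fderiv ℝ φ p (1, b p.1 p.2))
        - ∫ p in Icc 0 T ×ˢ (univ : Set F), f p * g p| ≤ I₁ * (T * Kg * C' * exp (-(N / 2))) := by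
      rw [← integral_sub hfi hgi, ← Real.norm_eq_abs]
      exact (norm_integral_le_of_norm_le (hf.integrable.norm.mul_const _) herr1).trans_eq
        (integral_mul_const _ _)
    -- the error at the initial time
    have hG' : ∀ z, |φ (0, z) + G z| ≤ T * Kg * (C' * T * exp (-(N / 2))) := fun z => by
      rw [hφD 0 ⟨le_rfl, hT.le⟩]
      simp only [hG, dualSolution]
      rw [neg_add_eq_sub, ← intervalIntegral.integral_sub
        ((continuous_comp_flow hb hg.continuous _ _).intervalIntegrable _ _)
        ((continuous_comp_flow hb' hg.continuous _ _).intervalIntegrable _ _),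
        ← Real.norm_eq_abs]
      -- Both flows start at the same point. The Lipschitz bound of `b'` compares the trajectories,
      -- and `b' - b` is evaluated along the flow of `b`.
      have hflow : ∀ r ∈ Icc 0 T, ‖flow b' 0 z r - flow b 0 z r‖ ≤ C' * T * exp (-(N / 2)) := by
        intro r hr
        have h1 := (isSolution_flow hb' 0 z).norm_sub_le_scale (S := T) (N := N) (σ := 1) hb' hb
          (isSolution_flow hb 0 z) hC'0 hN0 zero_le_one (fun r hr => by
            refine (norm_sub_le_norm_sub_add_norm_sub _ (b' r (flow b 0 z r)) _).trans ?_
            rw [one_mul, mul_add]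
            exact add_le_add (hLip' r hr _ _) (herr r hr _)) r hr
        simpa using h1
      refine (intervalIntegral.norm_integral_le_of_norm_le_const
        (C := Kg * (C' * T * exp (-(N / 2)))) fun r hr => ?_).trans_eq ?_
      · rw [uIoc_of_le hT.le] at hr
        refine (hg.norm_sub_le _ _).trans (mul_le_mul_of_nonneg_left ?_ Kg.2)
        rw [Prod.mk_sub_mk, sub_self, Prod.norm_def, norm_zero, norm_sub_rev]
        exact max_le (by positivity) (hflow r ⟨hr.1.le, hr.2⟩)
      · rw [sub_zero, abs_of_pos hT]; ring
    have hφ0c : Continuous fun z => φ (0, z) := hφLip.continuous.comp (by fun_prop)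
    have hi1 : Integrable fun z => f₀ z * φ (0, z) :=
      hf.integrable_initial.mul_bdd (c := Mφ) hφ0c.aestronglyMeasurable (ae_of_all _ fun z => hMφ _)
    have hGm : Continuous G := by
      obtain ⟨M, hM⟩ : ∃ M, ∀ p, ‖g p‖ ≤ M := hgc.exists_bound_of_continuous hg.continuous
      refine intervalIntegral.continuous_of_dominated_interval (bound := fun _ => M)
        (fun z => (continuous_comp_flow hb hg.continuous 0 z).aestronglyMeasurable)
        (fun z => ae_of_all _ fun _ _ => hM _) (by simp) (ae_of_all _ fun s hs => ?_)
      rw [uIoc_of_le hT.le] at hs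
      have := continuous_flow_initial hb hs.1.le
      exact hg.continuous.comp (by fun_prop)
    have hbd2 : ∀ z, ‖f₀ z * φ (0, z) + f₀ z * G z‖
        ≤ ‖f₀ z‖ * (T * Kg * (C' * T * exp (-(N / 2)))) := fun z => by
      rw [← mul_add, norm_mul]
      exact mul_le_mul_of_nonneg_left (hG' z) (norm_nonneg _)
    have hi3 : Integrable fun z => f₀ z * φ (0, z) + f₀ z * G z :=
      (hf.integrable_initial.norm.mul_const _).mono' (hi1.aestronglyMeasurable.add
        (hf.integrable_initial.aestronglyMeasurable.mul hGm.aestronglyMeasurable))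
        (ae_of_all _ hbd2)
    have hi2 : Integrable fun z => f₀ z * G z :=
      (hi3.sub hi1).congr (ae_of_all _ fun z => by simp)
    have e2 : |(∫ z, f₀ z * φ (0, z)) + ∫ z, f₀ z * G z|
        ≤ I₂ * (T * Kg * (C' * T * exp (-(N / 2)))) := by
      rw [← integral_add hi1 hi2, ← Real.norm_eq_abs]
      exact (norm_integral_le_of_norm_le (hf.integrable_initial.norm.mul_const _)
        (ae_of_all _ hbd2)).trans_eq (integral_mul_const _ _)
    have e3 := abs_le.1 e1
    have e4 := abs_le.1 e2
    rw [abs_le]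
    constructor <;> nlinarith
  have h0 : |(∫ p in Icc 0 T ×ˢ (univ : Set F), f p * g p) - ∫ z, f₀ z * G z| ≤ 0 := by
    refine ge_of_tendsto (tendsto_const_mul_exp_neg_half
      (I₁ * (T * Kg * C') + I₂ * (T * Kg * (C' * T)))) ?_
    filter_upwards [eventually_ge_atTop 1] with N hN using key N hN
  exact sub_eq_zero.1 (abs_nonpos_iff.1 h0)

end Representation

/-! ### Slices of measures on a product -/

/-- Finite intersections of a countable generating sequence. Countability lets one null set serve
for all members, and the empty intersection supplies the whole space, needed to compare total
masses. -/
theorem exists_countable_piSystem (X : Type*) [m : MeasurableSpace X]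
    [MeasurableSpace.CountablyGenerated X] :
    ∃ c : Finset ℕ → Set X, IsPiSystem (range c) ∧ m = MeasurableSpace.generateFrom (range c) ∧
      (∀ t, MeasurableSet (c t)) ∧ c ∅ = univ := by
  set s := MeasurableSpace.natGeneratingSequence X
  have hs : ∀ t : Finset ℕ, MeasurableSet (⋂ i ∈ t, s i) := fun t =>
    Finset.measurableSet_biInter t fun i _ => MeasurableSpace.measurableSet_natGeneratingSequence i
  refine ⟨fun t => ⋂ i ∈ t, s i, ?_, le_antisymm ?_ ?_, hs, by simp⟩
  · rintro _ ⟨t, rfl⟩ _ ⟨t', rfl⟩ _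
    exact ⟨t ∪ t', by ext x; simp [or_imp, forall_and]⟩
  · conv_lhs => rw [← MeasurableSpace.generateFrom_natGeneratingSequence X]
    refine MeasurableSpace.generateFrom_mono ?_
    rintro _ ⟨i, rfl⟩
    exact ⟨{i}, by simp [s]⟩
  · exact MeasurableSpace.generateFrom_le (by rintro _ ⟨t, rfl⟩; exact hs t)

/-- Testing the identity on rectangles `A ×ˢ c t` with `A` arbitrary identifies the mass of `c t` in
almost every slice. The `c t` being countably many, the slices agree on a π-system outside one null
set, and they are finite measures. -/
theorem ae_withDensity_eq_map {X Y : Type*} [MeasurableSpace X] [MeasurableSpace Y]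
    [MeasurableSpace.CountablyGenerated Y] {μ : Measure X} {ν m₀ : Measure Y} [SigmaFinite μ]
    [SFinite ν] [IsFiniteMeasure m₀] {h : X × Y → ℝ≥0∞} (hh : AEMeasurable h (μ.prod ν))
    {Ψ : X × Y → Y} (hΨ : Measurable Ψ)
    (heq : (μ.prod ν).withDensity h = (μ.prod m₀).map fun p => (p.1, Ψ p)) :
    ∀ᵐ x ∂μ, ν.withDensity (fun y => h (x, y)) = m₀.map fun y => Ψ (x, y) := by
  obtain ⟨c, hpi, hgen, hmeas, huniv⟩ := exists_countable_piSystem Y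
  have hae : ∀ᵐ x ∂μ, ∀ t, ∫⁻ y in c t, h (x, y) ∂ν = m₀ ((fun y => Ψ (x, y)) ⁻¹' c t) := by
    refine ae_all_iff.2 fun t => ?_
    have hΨt : MeasurableSet (Ψ ⁻¹' c t) := hΨ (hmeas t)
    have hht : AEMeasurable h (μ.prod (ν.restrict (c t))) :=
      hh.mono_measure (Measure.prod_mono le_rfl Measure.restrict_le_self)
    refine ae_eq_of_forall_setLIntegral_eq_of_sigmaFinite₀ hht.lintegral_prod_right'
      (measurable_measure_prodMk_left hΨt).aemeasurable fun A hA _ => ?_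
    have h1 := congrArg (fun m : Measure (X × Y) => m (A ×ˢ c t)) heq
    rw [withDensity_apply _ (hA.prod (hmeas t)), Measure.map_apply (measurable_fst.prodMk hΨ)
      (hA.prod (hmeas t)), ← Measure.prod_restrict, lintegral_prod _ (hh.mono_measure
        (Measure.prod_mono Measure.restrict_le_self Measure.restrict_le_self)),
      Measure.prod_apply ((measurable_fst.prodMk hΨ) (hA.prod (hmeas t)))] at h1
    rw [h1, ← lintegral_indicator hA]
    refine lintegral_congr fun x => ?_
    by_cases hx : x ∈ A
    · rw [indicator_of_mem hx]
      congr 1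
      ext y
      simp [hx]
    · rw [indicator_of_notMem hx]
      refine (measure_mono_null (t := ∅) (fun y hy => ?_) measure_empty)
      exact hx hy.1
  filter_upwards [hae] with x hx
  have hΨx : Measurable fun y => Ψ (x, y) := hΨ.comp measurable_prodMk_left
  have hval : ∀ t, ν.withDensity (fun y => h (x, y)) (c t) = (m₀.map fun y => Ψ (x, y)) (c t) :=
    fun t => by rw [withDensity_apply _ (hmeas t), Measure.map_apply hΨx (hmeas t), hx t]
  have hfin : IsFiniteMeasure (ν.withDensity fun y => h (x, y)) :=
    ⟨by rw [← huniv, hval, huniv]; exact measure_lt_top _ _⟩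
  refine ext_of_generate_finite (range c) hgen hpi (by rintro _ ⟨t, rfl⟩; exact hval t) ?_
  rw [← huniv, hval]

/-! ### Weak solutions are transported by the flow -/

section Pushforward

variable {F : Type*} [NormedAddCommGroup F] [NormedSpace ℝ F]
  [MeasureSpace F] [BorelSpace F] [SecondCountableTopology F] [CompleteSpace F]

/-- The trajectory starting at `z` at time `0`, frozen for negative times. -/
noncomputable def trajectory (b : ℝ → F → F) (t : ℝ) (z : F) : F := flow b 0 z (max 0 t)

theorem trajectory_of_nonneg (b : ℝ → F → F) {t : ℝ} (ht : 0 ≤ t) (z : F) :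
    trajectory b t z = flow b 0 z t := by rw [trajectory, max_eq_right ht]

theorem continuous_trajectory {C A : ℝ} {b : ℝ → F → F} (hb : LogLipschitzField C A b) (z : F) :
    Continuous fun t => trajectory b t z :=
  (isSolution_flow hb 0 z).continuous.comp (continuous_const.max continuous_id)

theorem measurable_trajectory {C A : ℝ} {b : ℝ → F → F} (hb : LogLipschitzField C A b) :
    Measurable (Function.uncurry (trajectory b)) :=
  measurable_uncurry_of_continuous_of_measurable (continuous_trajectory hb)
    fun _ => (continuous_flow_initial hb (le_max_left _ _)).measurable

/-- The measure with density `f₀` with respect to Lebesgue measure. -/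
noncomputable def densityMeasure {X : Type*} [MeasureSpace X] (f₀ : X → ℝ) : Measure X :=
  volume.withDensity fun z => ENNReal.ofReal (f₀ z)

theorem isFiniteMeasure_densityMeasure {X : Type*} [MeasureSpace X] {f₀ : X → ℝ}
    (h : Integrable f₀) : IsFiniteMeasure (densityMeasure f₀) :=
  isFiniteMeasure_withDensity_ofReal h.2

/-- The test functions of the weak formulation have compact support and vanish near time `T`, so
they reach only these compact sets. Such sets exhaust the part before `T` of any closed set, and the
rest is null. -/
theorem measure_eq_of_isCompact_lt {μ ν : Measure (ℝ × F)} [IsFiniteMeasure μ] [IsFiniteMeasure ν]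
    [ProperSpace F] {T : ℝ} (hμ : μ {p | T ≤ p.1} = 0) (hν : ν {p | T ≤ p.1} = 0)
    (h : ∀ (K : Set (ℝ × F)) (δ : ℝ), IsCompact K → 0 < δ → (∀ p ∈ K, p.1 ≤ T - δ) → μ K = ν K) :
    μ = ν := by
  have hclosed : ∀ S : Set (ℝ × F), IsClosed S → μ S = ν S := fun S hS => by
    set K : ℕ → Set (ℝ × F) := fun k =>
      S ∩ (Metric.closedBall 0 k ∩ {p | p.1 ≤ T - 1 / ((k : ℝ) + 1)})
    have hKc : ∀ k, IsCompact (K k) := fun k =>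
      ((isCompact_closedBall (0 : ℝ × F) k).inter_right
        (isClosed_le continuous_fst continuous_const)).inter_left hS
    have hmono : Monotone K := fun i j hij => by
      refine inter_subset_inter_right _ (inter_subset_inter
        (Metric.closedBall_subset_closedBall (by exact_mod_cast hij)) fun p hp => ?_)
      have : 1 / ((j : ℝ) + 1) ≤ 1 / ((i : ℝ) + 1) := Nat.one_div_le_one_div hij
      simp only [mem_ofPred_eq] at hp ⊢
      linarith
    have hU : ⋃ k, K k = S ∩ {p | p.1 < T} := by
      ext p
      simp only [K, mem_iUnion, mem_inter_iff, mem_closedBall_zero_iff, mem_ofPred_eq]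
      constructor
      · rintro ⟨k, h1, -, h3⟩
        have : 0 < 1 / ((k : ℝ) + 1) := by positivity
        exact ⟨h1, by linarith⟩
      · rintro ⟨h1, h2⟩
        obtain ⟨i, hi⟩ := exists_nat_ge ‖p‖
        obtain ⟨j, hj⟩ := exists_nat_one_div_lt (sub_pos.2 h2)
        refine ⟨max i j, h1, hi.trans (by exact_mod_cast le_max_left i j), ?_⟩
        have : 1 / (((max i j : ℕ) : ℝ) + 1) ≤ 1 / ((j : ℝ) + 1) :=
          Nat.one_div_le_one_div (le_max_right i j)
        linarith
    have hKeq : ∀ k, μ (K k) = ν (K k) := fun k =>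
      h (K k) (1 / ((k : ℝ) + 1)) (hKc k) (by positivity) fun p hp => hp.2.2
    have e1 : ∀ m : Measure (ℝ × F), m {p | T ≤ p.1} = 0 → m S = m (S ∩ {p | p.1 < T}) :=
      fun m hm => by
        refine (measure_inter_conull (measure_mono_null (fun p hp => ?_) hm)).symm
        simpa only [mem_compl_iff, mem_ofPred_eq, not_lt] using hp
    rw [e1 μ hμ, e1 ν hν, ← hU]
    refine tendsto_nhds_unique (tendsto_measure_iUnion_atTop hmono) ?_
    simp only [Function.comp_def, hKeq]
    exact tendsto_measure_iUnion_atTop hmono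
  refine ext_of_generate_finite {S | IsClosed S} ?_ isPiSystem_isClosed hclosed
    (hclosed univ isClosed_univ)
  rw [BorelSpace.measurable_eq (α := ℝ × F), borel_eq_generateFrom_isClosed]

variable [FiniteDimensional ℝ F] [(volume : Measure F).IsAddHaarMeasure]
variable {C A T : ℝ} {b : ℝ → F → F} {f₀ : F → ℝ} {f : ℝ × F → ℝ}

theorem volume_restrict_Icc_prod_univ (T : ℝ) :
    volume.restrict (Icc 0 T ×ˢ (univ : Set F))
      = (volume.restrict (Icc 0 T)).prod (volume : Measure F) := by
  rw [Measure.volume_eq_prod, ← Measure.prod_restrict, Measure.restrict_univ]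

/-- Since `f` has no sign yet, the representation is written as `f⁺ = η + f⁻`, an identity between
finite positive measures. It is tested on Lipschitz approximations of indicators of compact sets. -/
theorem IsLinearWeakSolution.withDensity_eq_add (hf : IsLinearWeakSolution b T f₀ f)
    (hb : LogLipschitzField C A b) (hT : 0 < T) (hf₀ : ∀ᵐ z, 0 ≤ f₀ z) :
    (volume.restrict (Icc 0 T ×ˢ (univ : Set F))).withDensity (fun p => ENNReal.ofReal (f p))
      = ((volume.restrict (Icc 0 T)).prod (densityMeasure f₀)).map
          (fun p => (p.1, trajectory b p.1 p.2))
        + (volume.restrict (Icc 0 T ×ˢ (univ : Set F))).withDensity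
          (fun p => ENNReal.ofReal (-f p)) := by
  have : ProperSpace F := FiniteDimensional.proper_real F
  have := isFiniteMeasure_densityMeasure hf.integrable_initial
  set μ := volume.restrict (Icc 0 T ×ˢ (univ : Set F)) with hμ
  set m₀ := densityMeasure f₀
  have := isFiniteMeasure_withDensity_ofReal (μ := μ) hf.integrable.2
  have := isFiniteMeasure_withDensity_ofReal (μ := μ) (f := fun p => -f p) hf.integrable.neg.2
  have hΨ : Measurable fun p : ℝ × F => (p.1, trajectory b p.1 p.2) :=
    measurable_fst.prodMk (measurable_trajectory hb)
  set η := ((volume.restrict (Icc 0 T)).prod m₀).map fun p => (p.1, trajectory b p.1 p.2) with hη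
  have hset : MeasurableSet {p : ℝ × F | T ≤ p.1} := measurableSet_le measurable_const measurable_fst
  have hT0 : volume.restrict (Icc 0 T) {t | T ≤ t} = 0 := by
    rw [show {t : ℝ | T ≤ t} = Ici T from rfl, Measure.restrict_apply measurableSet_Ici]
    exact measure_mono_null (fun t ht => le_antisymm ht.2.2 ht.1) (measure_singleton T)
  have hprod0 : ∀ m : Measure F, [SFinite m] →
      (volume.restrict (Icc 0 T)).prod m {p | T ≤ p.1} = 0 := fun m _ => by
    have : {p : ℝ × F | T ≤ p.1} = {t | T ≤ t} ×ˢ univ := by ext; simp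
    rw [this, Measure.prod_prod, hT0, zero_mul]
  have hμ0 : μ {p | T ≤ p.1} = 0 := by
    rw [hμ, volume_restrict_Icc_prod_univ]; exact hprod0 _
  refine measure_eq_of_isCompact_lt (T := T) (withDensity_absolutelyContinuous _ _ hμ0) ?_ ?_
  · rw [Measure.add_apply, withDensity_absolutelyContinuous _ _ hμ0, hη,
      Measure.map_apply hΨ hset, add_zero]
    exact hprod0 _
  intro K δ hK hδ hKT
  have hint : ∀ (g : ℝ × F → ℝ) (Kg : ℝ≥0), LipschitzWith Kg g → HasCompactSupport g →
      (∀ t z, T - δ / 2 ≤ t → g (t, z) = 0) →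
      ∫ p, g p ∂(μ.withDensity fun p => ENNReal.ofReal (f p))
        = ∫ p, g p ∂η + ∫ p, g p ∂(μ.withDensity fun p => ENNReal.ofReal (-f p)) := by
    intro g Kg hg hgc hgT
    obtain ⟨M, hM⟩ : ∃ M, ∀ p, ‖g p‖ ≤ M := hgc.exists_bound_of_continuous hg.continuous
    have hgm : AEStronglyMeasurable g μ := hg.continuous.aestronglyMeasurable
    have hfm : AEMeasurable f μ := hf.integrable.aestronglyMeasurable.aemeasurable
    rw [integral_withDensity_eq_integral_toReal_smul₀ hfm.ennreal_ofReal
        (ae_of_all _ fun _ => ENNReal.ofReal_lt_top),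
      integral_withDensity_eq_integral_toReal_smul₀ (f := fun p => ENNReal.ofReal (-f p))
        hfm.neg.ennreal_ofReal
        (ae_of_all _ fun _ => ENNReal.ofReal_lt_top)]
    have i1 : Integrable (fun p => (ENNReal.ofReal (f p)).toReal • g p) μ := by
      simp only [ENNReal.toReal_ofReal', smul_eq_mul]
      exact hf.integrable.pos_part.mul_bdd (c := M) hgm (ae_of_all _ hM)
    have i2 : Integrable (fun p => (ENNReal.ofReal (-f p)).toReal • g p) μ := by
      simp only [ENNReal.toReal_ofReal', smul_eq_mul]
      exact hf.integrable.neg_part.mul_bdd (c := M) hgm (ae_of_all _ hM)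
    rw [← sub_eq_iff_eq_add, ← integral_sub i1 i2]
    have e1 : ∀ p, (ENNReal.ofReal (f p)).toReal • g p - (ENNReal.ofReal (-f p)).toReal • g p
        = f p * g p := fun p => by
      simp only [ENNReal.toReal_ofReal', smul_eq_mul]
      rw [← sub_mul, max_zero_sub_eq_self]
    simp only [e1]
    rw [hf.integral_mul_eq hb hT hg hgc (half_pos hδ) hgT, hη,
      integral_map hΨ.aemeasurable hg.continuous.aestronglyMeasurable, integral_prod_symm]
    · simp only [m₀, densityMeasure]
      rw [integral_withDensity_eq_integral_toReal_smul₀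
        hf.integrable_initial.aestronglyMeasurable.aemeasurable.ennreal_ofReal
        (ae_of_all _ fun _ => ENNReal.ofReal_lt_top)]
      refine integral_congr_ae ?_
      filter_upwards [hf₀] with z hz
      rw [ENNReal.toReal_ofReal hz, smul_eq_mul, intervalIntegral.integral_of_le hT.le,
        ← integral_Icc_eq_integral_Ioc]
      congr 1
      refine setIntegral_congr_fun measurableSet_Icc fun s hs => ?_
      simp only [trajectory_of_nonneg b hs.1]
    · exact Integrable.of_bound (hg.continuous.measurable.comp hΨ).aestronglyMeasurable M
        (ae_of_all _ fun _ => hM _)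
  -- With thickness at most `δ / 4`, the neighbourhoods of `K` stay before time `T - 3δ/4`, hence
  -- before `T - δ/2`, where the test functions must vanish.
  have hδs : ∀ k : ℕ, 0 < δ / 4 / ((k : ℝ) + 1) := fun k => by positivity
  have hδlim : Tendsto (fun k : ℕ => δ / 4 / ((k : ℝ) + 1)) atTop (𝓝 0) := by
    have := tendsto_one_div_add_atTop_nhds_zero_nat (𝕜 := ℝ) |>.const_mul (δ / 4)
    simpa [mul_one_div, div_eq_mul_inv] using this
  have hind : ∀ k, ∫ p, (thickenedIndicator (hδs k) K p : ℝ)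
        ∂(μ.withDensity fun p => ENNReal.ofReal (f p))
      = ∫ p, (thickenedIndicator (hδs k) K p : ℝ) ∂η
        + ∫ p, (thickenedIndicator (hδs k) K p : ℝ)
          ∂(μ.withDensity fun p => ENNReal.ofReal (-f p)) := fun k => by
    have hδk : δ / 4 / ((k : ℝ) + 1) ≤ δ / 4 := div_le_self (by positivity)
      (by linarith [(k.cast_nonneg : (0 : ℝ) ≤ k)])
    have hsupp : ∀ p, (thickenedIndicator (hδs k) K p : ℝ) ≠ 0 →
        p ∈ Metric.thickening (δ / 4 / ((k : ℝ) + 1)) K := fun p hp => by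
      by_contra hne
      exact hp (by rw [thickenedIndicator_zero (hδs k) K hne]; rfl)
    refine hint _ (1 * (Real.toNNReal (δ / 4 / ((k : ℝ) + 1)))⁻¹)
      ((LipschitzWith.of_dist_le_mul fun x y => by
        rw [NNReal.coe_one, one_mul]; exact le_rfl).comp
        (lipschitzWith_thickenedIndicator (hδs k) K)) ?_ ?_
    · exact HasCompactSupport.of_support_subset_isCompact (hK.cthickening (r := δ / 4 / (k + 1)))
        fun p hp => Metric.thickening_subset_cthickening _ _ (hsupp p hp)
    · intro t z ht
      by_contra hne
      obtain ⟨q, hq, hdist⟩ := Metric.mem_thickening_iff.1 (hsupp _ hne)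
      have h1 := hKT q hq
      have h2 : t - q.1 ≤ dist (t, z) q := (le_abs_self _).trans (by
        rw [← Real.dist_eq, Prod.dist_eq]; exact le_max_left _ _)
      linarith
  have hlim := fun m : Measure (ℝ × F) => fun _ : IsFiniteMeasure m =>
    tendsto_integral_thickenedIndicator_of_isClosed m hK.isClosed hδs hδlim
  have h1 := hlim (μ.withDensity fun p => ENNReal.ofReal (f p)) inferInstance
  have h2 := (hlim η inferInstance).add
    (hlim (μ.withDensity fun p => ENNReal.ofReal (-f p)) inferInstance)
  have h3 := tendsto_nhds_unique (h1.congr hind) h2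
  rw [← measureReal_add_apply] at h3
  exact (measureReal_eq_measureReal_iff).1 h3

/-- The transported measure is positive, so `f⁻ ≤ f⁺` almost everywhere; where `f < 0` this would
read `-f ≤ 0`. -/
theorem IsLinearWeakSolution.ae_nonneg (hf : IsLinearWeakSolution b T f₀ f)
    (hb : LogLipschitzField C A b) (hT : 0 < T) (hf₀ : ∀ᵐ z, 0 ≤ f₀ z) :
    ∀ᵐ p ∂(volume.restrict (Icc 0 T ×ˢ (univ : Set F))), 0 ≤ f p := by
  have h := hf.withDensity_eq_add hb hT hf₀
  set μ := volume.restrict (Icc 0 T ×ˢ (univ : Set F))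
  have hfm : AEMeasurable f μ := hf.integrable.aestronglyMeasurable.aemeasurable
  have hle : ∀ᵐ p ∂μ, ENNReal.ofReal (-f p) ≤ ENNReal.ofReal (f p) := by
    refine ae_le_of_forall_setLIntegral_le_of_sigmaFinite₀ hfm.neg.ennreal_ofReal fun s hs _ => ?_
    rw [← withDensity_apply _ hs, ← withDensity_apply _ hs, h]
    exact Measure.le_add_left le_rfl s
  filter_upwards [hle] with p hp
  by_contra hneg
  push Not at hneg
  rw [ENNReal.ofReal_of_nonpos hneg.le, nonpos_iff_eq_zero, ENNReal.ofReal_eq_zero] at hp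
  linarith

theorem IsLinearWeakSolution.withDensity_eq_map (hf : IsLinearWeakSolution b T f₀ f)
    (hb : LogLipschitzField C A b) (hT : 0 < T) (hf₀ : ∀ᵐ z, 0 ≤ f₀ z) :
    (volume.restrict (Icc 0 T ×ˢ (univ : Set F))).withDensity (fun p => ENNReal.ofReal (f p))
      = ((volume.restrict (Icc 0 T)).prod (densityMeasure f₀)).map
          (fun p => (p.1, trajectory b p.1 p.2)) := by
  rw [hf.withDensity_eq_add hb hT hf₀]
  have : (volume.restrict (Icc 0 T ×ˢ (univ : Set F))).withDensity
      (fun p => ENNReal.ofReal (-f p)) = 0 := by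
    rw [← withDensity_zero (μ := volume.restrict (Icc 0 T ×ˢ (univ : Set F)))]
    refine withDensity_congr_ae ?_
    filter_upwards [hf.ae_nonneg hb hT hf₀] with p hp
    simpa using hp
  rw [this, add_zero]

/-- At almost every time, `f(t)` is the image of `f₀` under the flow. -/
theorem IsLinearWeakSolution.ae_slice_eq_map (hf : IsLinearWeakSolution b T f₀ f)
    (hb : LogLipschitzField C A b) (hT : 0 < T) (hf₀ : ∀ᵐ z, 0 ≤ f₀ z) :
    ∀ᵐ t ∂(volume.restrict (Icc 0 T)),
      densityMeasure (fun z => f (t, z)) = (densityMeasure f₀).map (trajectory b t) := by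
  have := isFiniteMeasure_densityMeasure hf.integrable_initial
  have h := hf.withDensity_eq_map hb hT hf₀
  have hfm : AEMeasurable (fun p => ENNReal.ofReal (f p))
      (volume.restrict (Icc 0 T ×ˢ (univ : Set F))) :=
    hf.integrable.aestronglyMeasurable.aemeasurable.ennreal_ofReal
  rw [volume_restrict_Icc_prod_univ] at h hfm
  exact ae_withDensity_eq_map hfm (measurable_trajectory hb) h

end Pushforward

/-! ### The Coulomb kernel -/

/-- The Coulomb kernel `a / |a|³`, up to the factor `1 / 4π`. -/
noncomputable def coulombKernel (a : R3) : R3 := (‖a‖ ^ 3)⁻¹ • a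

theorem measurable_coulombKernel : Measurable coulombKernel :=
  ((measurable_norm.pow_const 3).inv).smul measurable_id

theorem norm_coulombKernel (a : R3) : ‖coulombKernel a‖ = (‖a‖ ^ 2)⁻¹ := by
  rcases eq_or_ne a 0 with rfl | ha
  · simp [coulombKernel]
  · have : 0 < ‖a‖ := norm_pos_iff.2 ha
    rw [coulombKernel, norm_smul, norm_inv, norm_pow, norm_norm]
    field_simp

/-- The constant is `4 = 1 + 3`: one from `|a|⁻³ (a - b)`, three from `|b|³ - |a|³ ≤ 3 |a - b|
|b|²`. The singular factor sits at the point nearer to the origin. -/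
theorem norm_coulombKernel_sub_le_of_le {a b : R3} (ha : a ≠ 0) (hab : ‖a‖ ≤ ‖b‖) :
    ‖coulombKernel a - coulombKernel b‖ ≤ 4 * ‖a - b‖ * (‖a‖ ^ 3)⁻¹ := by
  have h0 : 0 < ‖a‖ := norm_pos_iff.2 ha
  have h1 : 0 < ‖b‖ := h0.trans_le hab
  have e : coulombKernel a - coulombKernel b
      = (‖a‖ ^ 3)⁻¹ • (a - b) + ((‖a‖ ^ 3)⁻¹ - (‖b‖ ^ 3)⁻¹) • b := by
    simp only [coulombKernel, smul_sub, sub_smul]; abel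
  have hr : ‖b‖ - ‖a‖ ≤ ‖a - b‖ := by
    rw [norm_sub_rev]; exact norm_sub_norm_le b a
  have h2 : ‖((‖a‖ ^ 3)⁻¹ - (‖b‖ ^ 3)⁻¹) • b‖ ≤ 3 * ‖a - b‖ * (‖a‖ ^ 3)⁻¹ := by
    have h3 : 0 ≤ (‖a‖ ^ 3)⁻¹ - (‖b‖ ^ 3)⁻¹ := sub_nonneg.2 (by gcongr)
    rw [norm_smul, Real.norm_eq_abs, abs_of_nonneg h3,
      inv_sub_inv (by positivity) (by positivity), div_mul_eq_mul_div, ← div_eq_mul_inv,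
      div_le_div_iff₀ (by positivity) (by positivity)]
    have h4 : ‖b‖ ^ 3 - ‖a‖ ^ 3 ≤ 3 * ‖a - b‖ * ‖b‖ ^ 2 := by
      have h5 : ‖b‖ ^ 3 - ‖a‖ ^ 3 = (‖b‖ - ‖a‖) * (‖b‖ ^ 2 + ‖b‖ * ‖a‖ + ‖a‖ ^ 2) := by ring
      have h6 : ‖b‖ ^ 2 + ‖b‖ * ‖a‖ + ‖a‖ ^ 2 ≤ 3 * ‖b‖ ^ 2 := by nlinarith
      calc _ = _ := h5
        _ ≤ ‖a - b‖ * (3 * ‖b‖ ^ 2) :=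
          mul_le_mul hr h6 (by positivity) (norm_nonneg _)
        _ = _ := by ring
    calc (‖b‖ ^ 3 - ‖a‖ ^ 3) * ‖b‖ * ‖a‖ ^ 3
        ≤ 3 * ‖a - b‖ * ‖b‖ ^ 2 * ‖b‖ * ‖a‖ ^ 3 := by gcongr
      _ = 3 * ‖a - b‖ * (‖a‖ ^ 3 * ‖b‖ ^ 3) := by ring
  rw [e]
  refine (norm_add_le _ _).trans ?_
  have h7 : ‖(‖a‖ ^ 3)⁻¹ • (a - b)‖ = ‖a - b‖ * (‖a‖ ^ 3)⁻¹ := by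
    rw [norm_smul, norm_inv, norm_pow, norm_norm, mul_comm]
  linarith

/-- Interpolation between the Lipschitz bound, used when `|a - b| ≤ |a|`, and the size bound `2
|a|⁻²`, used otherwise. For `θ > 0` the singularity `|a|^{θ-3}` is locally integrable in dimension
three, unlike `|a|⁻³`. -/
theorem norm_coulombKernel_sub_le_rpow_of_le {a b : R3} (ha : a ≠ 0) (hab : ‖a‖ ≤ ‖b‖) {θ : ℝ}
    (hθ : 0 ≤ θ) (hθ1 : θ ≤ 1) :
    ‖coulombKernel a - coulombKernel b‖ ≤ 4 * ‖a - b‖ ^ (1 - θ) * ‖a‖ ^ (θ - 3) := by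
  have h0 : 0 < ‖a‖ := norm_pos_iff.2 ha
  have e3 : ‖a‖ ^ θ * (‖a‖ ^ 3)⁻¹ = ‖a‖ ^ (θ - 3) := by
    rw [rpow_sub h0, div_eq_mul_inv]; norm_cast
  rcases le_total ‖a - b‖ ‖a‖ with hr | hr
  · refine (norm_coulombKernel_sub_le_of_le ha hab).trans ?_
    rcases eq_or_ne a b with rfl | hne
    · simp; positivity
    have hr0 : 0 < ‖a - b‖ := norm_pos_iff.2 (sub_ne_zero.2 hne)
    have h1 : ‖a - b‖ = ‖a - b‖ ^ (1 - θ) * ‖a - b‖ ^ θ := by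
      rw [← rpow_add hr0]; simp
    calc 4 * ‖a - b‖ * (‖a‖ ^ 3)⁻¹
        = 4 * ‖a - b‖ ^ (1 - θ) * (‖a - b‖ ^ θ * (‖a‖ ^ 3)⁻¹) := by
          conv_lhs => rw [h1]
          ring
      _ ≤ 4 * ‖a - b‖ ^ (1 - θ) * (‖a‖ ^ θ * (‖a‖ ^ 3)⁻¹) := by gcongr
      _ = _ := by rw [e3]
  · have h1 : ‖coulombKernel a - coulombKernel b‖ ≤ 2 * (‖a‖ ^ 2)⁻¹ := by
      refine (norm_sub_le _ _).trans ?_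
      rw [norm_coulombKernel, norm_coulombKernel, two_mul]
      gcongr
    have h2 : (‖a‖ ^ 2)⁻¹ = ‖a‖ ^ (1 - θ) * ‖a‖ ^ (θ - 3) := by
      rw [← rpow_add h0, show 1 - θ + (θ - 3) = -(2 : ℕ) by push_cast; ring, rpow_neg h0.le,
        rpow_natCast]
    calc _ ≤ 2 * (‖a‖ ^ (1 - θ) * ‖a‖ ^ (θ - 3)) := by rw [← h2]; exact h1
      _ ≤ 4 * (‖a - b‖ ^ (1 - θ) * ‖a‖ ^ (θ - 3)) := by
        have : 0 ≤ 1 - θ := by linarith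
        gcongr
        norm_num
      _ = _ := by ring

theorem norm_coulombKernel_sub_le_rpow {a b : R3} (ha : a ≠ 0) (hb : b ≠ 0) {θ : ℝ}
    (hθ : 0 ≤ θ) (hθ1 : θ ≤ 1) :
    ‖coulombKernel a - coulombKernel b‖
      ≤ 4 * ‖a - b‖ ^ (1 - θ) * (‖a‖ ^ (θ - 3) + ‖b‖ ^ (θ - 3)) := by
  have h1 : 0 ≤ ‖a - b‖ ^ (1 - θ) := by positivity
  have h2 : 0 ≤ ‖a‖ ^ (θ - 3) := by positivity
  have h3 : 0 ≤ ‖b‖ ^ (θ - 3) := by positivity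
  rcases le_total ‖a‖ ‖b‖ with h | h
  · refine (norm_coulombKernel_sub_le_rpow_of_le ha h hθ hθ1).trans ?_
    gcongr
    linarith
  · rw [norm_sub_rev, norm_sub_rev a b]
    rw [norm_sub_rev] at h1
    refine (norm_coulombKernel_sub_le_rpow_of_le hb h hθ hθ1).trans ?_
    gcongr
    linarith

/-- For `s ≥ e^{-n}` the loss `s^{-1/n}` is at most `e`; adding `e^{-n}` to `r` puts it in that
range. -/
theorem rpow_one_sub_inv_le {r n : ℝ} (hr : 0 ≤ r) (hn : 1 ≤ n) :
    r ^ (1 - n⁻¹) ≤ exp 1 * (r + exp (-n)) := by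
  have hn0 : 0 < n := one_pos.trans_le hn
  have h1 : 0 ≤ 1 - n⁻¹ := sub_nonneg.2 (inv_le_one_of_one_le₀ hn)
  have h2 : ∀ s, exp (-n) ≤ s → s ^ (1 - n⁻¹) ≤ exp 1 * s := fun s hs => by
    have hs0 : 0 < s := (exp_pos _).trans_le hs
    rw [rpow_sub hs0, rpow_one, div_eq_mul_inv, mul_comm, ← rpow_neg hs0.le]
    refine mul_le_mul_of_nonneg_right ?_ hs0.le
    calc s ^ (-n⁻¹) ≤ (exp (-n)) ^ (-n⁻¹) :=
          rpow_le_rpow_of_nonpos (exp_pos _) hs (by simpa using hn0.le)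
      _ = exp 1 := by rw [← exp_mul]; congr 1; field_simp
  calc r ^ (1 - n⁻¹) ≤ (r + exp (-n)) ^ (1 - n⁻¹) := by
        gcongr; linarith [exp_pos (-n)]
    _ ≤ _ := h2 _ (by linarith)

/-- The integral of the radial power `|a|^{θ - 3}` over the unit ball is of order `1 / θ`. -/
theorem lintegral_ball_rpow {θ : ℝ} (hθ : 0 < θ) :
    ∫⁻ a : R3, ENNReal.ofReal ((Iio (1 : ℝ)).indicator (fun y => y ^ (θ - 3)) ‖a‖)
      = ENNReal.ofReal (3 * volume.real (Metric.ball (0 : R3) 1) / θ) := by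
  have hdim : Module.finrank ℝ R3 = 3 := by simp [R3]
  set f : ℝ → ℝ := (Iio (1 : ℝ)).indicator fun y => y ^ (θ - 3) with hf
  have hfe : ∀ y ∈ Ioi (0 : ℝ), y ^ (3 - 1) • f y = (Ioo (0 : ℝ) 1).indicator
      (fun y => y ^ (θ - 1)) y := fun y hy => by
    have hy0 : 0 < y := hy
    by_cases h1 : y < 1
    · rw [indicator_of_mem (show y ∈ Ioo (0 : ℝ) 1 from ⟨hy0, h1⟩), hf,
        indicator_of_mem (show y ∈ Iio (1 : ℝ) from h1), smul_eq_mul, ← rpow_natCast,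
        ← rpow_add hy0]
      congr 1; push_cast; ring
    · rw [indicator_of_notMem (fun h => h1 h.2), hf, indicator_of_notMem (by simpa using h1),
        smul_zero]
  have hint0 : IntegrableOn (fun y : ℝ => y ^ (θ - 1)) (Ioo 0 1) :=
    (intervalIntegral.integrableOn_Ioo_rpow_iff one_pos).2 (by linarith)
  have hi : Integrable (fun a : R3 => f ‖a‖) := by
    rw [integrable_fun_norm_addHaar, hdim, integrableOn_congr_fun hfe measurableSet_Ioi]
    exact ((integrable_indicator_iff measurableSet_Ioo).2 hint0).integrableOn
  have hf0 : ∀ a : R3, 0 ≤ f ‖a‖ := fun a =>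
    indicator_apply_nonneg fun _ => by positivity
  rw [← ofReal_integral_eq_lintegral_ofReal hi (ae_of_all _ hf0)]
  congr 1
  rw [integral_fun_norm_addHaar, hdim, setIntegral_congr_fun measurableSet_Ioi hfe,
    setIntegral_indicator measurableSet_Ioo, inter_eq_right.2 Ioo_subset_Ioi_self,
    ← integral_Ioc_eq_integral_Ioo, ← intervalIntegral.integral_of_le zero_le_one,
    integral_rpow (Or.inl (by linarith))]
  simp [hθ.ne']
  ring

/-- Bounded integrable charge densities. -/
structure IsRegularSource (M : ℝ) (ρ : R3 → ℝ) : Prop where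
  aestronglyMeasurable : AEStronglyMeasurable ρ
  bound : ∀ᵐ y, ‖ρ y‖ₑ ≤ ENNReal.ofReal M
  mass : ∫⁻ y, ‖ρ y‖ₑ ≤ ENNReal.ofReal M

/-- The constant in the estimates on Coulomb fields. -/
noncomputable def kernelConst : ℝ := 3 * volume.real (Metric.ball (0 : R3) 1) + 1

theorem kernelConst_nonneg : 0 ≤ kernelConst := by unfold kernelConst; positivity

/-- Within distance 1 of `x` the sup bound on `ρ` is used, and the kernel integrates to `3 |B₁| n`.
Farther away the kernel is at most 1 and the mass bound is used. This is the origin of `kernelConst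
= 3 |B₁| + 1`. -/
theorem lintegral_rpow_mul_le {M : ℝ} {ρ : R3 → ℝ} (hρ : IsRegularSource M ρ) (hM : 0 ≤ M)
    {n : ℝ} (hn : 1 ≤ n) (x : R3) :
    ∫⁻ y, ENNReal.ofReal (‖x - y‖ ^ (n⁻¹ - 3)) * ‖ρ y‖ₑ
      ≤ ENNReal.ofReal (kernelConst * n * M) := by
  have hn0 : 0 < n := one_pos.trans_le hn
  set f : ℝ → ℝ := (Iio (1 : ℝ)).indicator fun y => y ^ (n⁻¹ - 3) with hf
  have hfm : Measurable f := (measurable_id.pow_const _).indicator measurableSet_Iio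
  have hpt : ∀ a : R3, ENNReal.ofReal (‖a‖ ^ (n⁻¹ - 3)) ≤ ENNReal.ofReal (f ‖a‖) + 1 := fun a => by
    by_cases h : ‖a‖ < 1
    · rw [hf, indicator_of_mem (show ‖a‖ ∈ Iio (1 : ℝ) from h)]
      exact le_self_add
    · refine le_add_left (ENNReal.ofReal_le_one.2 ?_)
      have := inv_le_one_of_one_le₀ hn
      exact rpow_le_one_of_one_le_of_nonpos (not_lt.1 h) (by linarith)
  have hmf : Measurable fun y => ENNReal.ofReal (f ‖x - y‖) :=
    (hfm.comp (measurable_const.sub measurable_id).norm).ennreal_ofReal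
  calc ∫⁻ y, ENNReal.ofReal (‖x - y‖ ^ (n⁻¹ - 3)) * ‖ρ y‖ₑ
      ≤ ∫⁻ y, (ENNReal.ofReal (f ‖x - y‖) * ENNReal.ofReal M + ‖ρ y‖ₑ) := by
        refine lintegral_mono_ae ?_
        filter_upwards [hρ.bound] with y hy
        calc _ ≤ (ENNReal.ofReal (f ‖x - y‖) + 1) * ‖ρ y‖ₑ := by gcongr; exact hpt _
          _ = ENNReal.ofReal (f ‖x - y‖) * ‖ρ y‖ₑ + ‖ρ y‖ₑ := by rw [add_mul, one_mul]
          _ ≤ _ := by gcongr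
    _ = (∫⁻ y, ENNReal.ofReal (f ‖x - y‖)) * ENNReal.ofReal M + ∫⁻ y, ‖ρ y‖ₑ := by
        rw [lintegral_add_left (hmf.mul_const _), lintegral_mul_const _ hmf]
    _ ≤ ENNReal.ofReal (3 * volume.real (Metric.ball (0 : R3) 1) / n⁻¹) * ENNReal.ofReal M
        + ENNReal.ofReal M := by
        rw [lintegral_sub_left_eq_self (fun a : R3 => ENNReal.ofReal (f ‖a‖)) x,
          lintegral_ball_rpow (inv_pos.2 hn0)]
        gcongr
        exact hρ.mass
    _ ≤ _ := by
        rw [← ENNReal.ofReal_mul (by positivity), ← ENNReal.ofReal_add (by positivity) hM]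
        refine ENNReal.ofReal_le_ofReal ?_
        rw [div_inv_eq_mul, kernelConst]
        nlinarith

theorem lintegral_coulombKernel_le {M : ℝ} {ρ : R3 → ℝ} (hρ : IsRegularSource M ρ) (hM : 0 ≤ M)
    (x : R3) : ∫⁻ y, ‖coulombKernel (x - y)‖ₑ * ‖ρ y‖ₑ ≤ ENNReal.ofReal (kernelConst * M) := by
  -- The case `n = 1` has exponent `-2`, which is the size of the Coulomb kernel.
  have h := lintegral_rpow_mul_le hρ hM le_rfl x
  rw [mul_one] at h
  refine le_trans (lintegral_mono fun y => ?_) h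
  gcongr
  rw [← ofReal_norm, norm_coulombKernel]
  refine ENNReal.ofReal_le_ofReal (le_of_eq ?_)
  rw [show (1 : ℝ)⁻¹ - 3 = -(2 : ℕ) by norm_num, rpow_neg (norm_nonneg _), rpow_natCast]

/-- The log-Lipschitz estimate for the Coulomb kernel. -/
theorem lintegral_coulombKernel_sub_le {M : ℝ} {ρ : R3 → ℝ} (hρ : IsRegularSource M ρ)
    (hM : 0 ≤ M) {n : ℝ} (hn : 1 ≤ n) (x x' : R3) :
    ∫⁻ y, ‖coulombKernel (x - y) - coulombKernel (x' - y)‖ₑ * ‖ρ y‖ₑ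
      ≤ ENNReal.ofReal (8 * exp 1 * kernelConst * M * n * (‖x - x'‖ + exp (-n))) := by
  have hn0 : 0 < n := one_pos.trans_le hn
  set c := ENNReal.ofReal (4 * (exp 1 * (‖x - x'‖ + exp (-n)))) with hc
  have hne : ∀ z : R3, ∀ᵐ y : R3, z - y ≠ 0 := fun z => by
    filter_upwards [compl_mem_ae_iff.2 (measure_singleton z)] with y hy h
    exact hy (sub_eq_zero.1 h).symm
  have hm : ∀ z : R3, Measurable fun y : R3 => ENNReal.ofReal (‖z - y‖ ^ (n⁻¹ - 3)) := fun z =>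
    ((measurable_const.sub measurable_id).norm.pow_const _).ennreal_ofReal
  have hmul : ∀ z : R3, AEMeasurable fun y =>
      ENNReal.ofReal (‖z - y‖ ^ (n⁻¹ - 3)) * ‖ρ y‖ₑ :=
    fun z => (hm z).aemeasurable.mul hρ.aestronglyMeasurable.enorm
  calc ∫⁻ y, ‖coulombKernel (x - y) - coulombKernel (x' - y)‖ₑ * ‖ρ y‖ₑ
      ≤ ∫⁻ y, c * (ENNReal.ofReal (‖x - y‖ ^ (n⁻¹ - 3)) * ‖ρ y‖ₑ
          + ENNReal.ofReal (‖x' - y‖ ^ (n⁻¹ - 3)) * ‖ρ y‖ₑ) := by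
        refine lintegral_mono_ae ?_
        filter_upwards [hne x, hne x'] with y h1 h2
        rw [← add_mul, ← mul_assoc]
        gcongr
        rw [← ofReal_norm, hc, ← ENNReal.ofReal_add (by positivity) (by positivity),
          ← ENNReal.ofReal_mul (by positivity)]
        refine ENNReal.ofReal_le_ofReal ?_
        -- The interpolation exponent is `θ = 1/n`: the kernel integral then costs `1/θ = n`, and
        -- the power `r^{1-θ}` costs only the additive error `e^{-n}`.
        refine (norm_coulombKernel_sub_le_rpow h1 h2 (inv_pos.2 hn0).le
          (inv_le_one_of_one_le₀ hn)).trans ?_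
        rw [sub_sub_sub_cancel_right]
        gcongr
        exact rpow_one_sub_inv_le (norm_nonneg _) hn
    _ = c * ((∫⁻ y, ENNReal.ofReal (‖x - y‖ ^ (n⁻¹ - 3)) * ‖ρ y‖ₑ)
          + ∫⁻ y, ENNReal.ofReal (‖x' - y‖ ^ (n⁻¹ - 3)) * ‖ρ y‖ₑ) := by
        rw [lintegral_const_mul' _ _ ENNReal.ofReal_ne_top,
          lintegral_add_left' (hmul x)]
    _ ≤ c * (ENNReal.ofReal (kernelConst * n * M) + ENNReal.ofReal (kernelConst * n * M)) := by
        gcongr <;> exact lintegral_rpow_mul_le hρ hM hn _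
    _ = _ := by
        have := kernelConst_nonneg
        rw [hc, ← ENNReal.ofReal_add (by positivity) (by positivity),
          ← ENNReal.ofReal_mul (by positivity)]
        congr 1; ring

/-- The Coulomb field generated by a charge density. -/
noncomputable def coulombField (ρ : R3 → ℝ) (x : R3) : R3 :=
  (1 / (4 * π)) • ∫ y : R3, (ρ y / ‖x - y‖ ^ 3) • (x - y)

theorem electricField_eq (f : ℝ → R3 × R3 → ℝ) (t : ℝ) :
    electricField f t = coulombField (density f t) := rfl

theorem coulombField_congr {ρ ρ' : R3 → ℝ} (h : ρ =ᵐ[volume] ρ') :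
    coulombField ρ = coulombField ρ' := by
  funext x
  unfold coulombField
  congr 1
  refine integral_congr_ae ?_
  filter_upwards [h] with y hy
  rw [hy]

theorem coulombField_integrand (ρ : R3 → ℝ) (x y : R3) :
    (ρ y / ‖x - y‖ ^ 3) • (x - y) = ρ y • coulombKernel (x - y) := by
  rw [coulombKernel, smul_smul, div_eq_mul_inv]

theorem integrable_coulombField {M : ℝ} {ρ : R3 → ℝ} (hρ : IsRegularSource M ρ) (hM : 0 ≤ M)
    (x : R3) : Integrable fun y => ρ y • coulombKernel (x - y) := by
  refine ⟨hρ.aestronglyMeasurable.smul (measurable_coulombKernel.comp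
    (measurable_const.sub measurable_id)).aestronglyMeasurable, ?_⟩
  refine lt_of_le_of_lt ?_ (ENNReal.ofReal_lt_top (r := kernelConst * M))
  refine le_trans (lintegral_mono fun y => ?_) (lintegral_coulombKernel_le hρ hM x)
  rw [enorm_smul, mul_comm]

theorem one_div_four_pi_le_one : 1 / (4 * π) ≤ 1 := by
  rw [div_le_one (by positivity)]
  linarith [pi_gt_three]

theorem norm_coulombField_le {M : ℝ} {ρ : R3 → ℝ} (hρ : IsRegularSource M ρ) (hM : 0 ≤ M)
    (x : R3) : ‖coulombField ρ x‖ ≤ kernelConst * M := by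
  have hk := kernelConst_nonneg
  simp only [coulombField, coulombField_integrand]
  rw [norm_smul, Real.norm_of_nonneg (by positivity)]
  refine (mul_le_of_le_one_left (norm_nonneg _) one_div_four_pi_le_one).trans ?_
  rw [← ENNReal.ofReal_le_ofReal_iff (by positivity), ofReal_norm]
  refine (enorm_integral_le_lintegral_enorm _).trans (le_trans (lintegral_mono fun y => ?_)
    (lintegral_coulombKernel_le hρ hM x))
  rw [enorm_smul, mul_comm]

theorem norm_coulombField_sub_le {M : ℝ} {ρ : R3 → ℝ} (hρ : IsRegularSource M ρ) (hM : 0 ≤ M)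
    {n : ℝ} (hn : 1 ≤ n) (x x' : R3) : ‖coulombField ρ x - coulombField ρ x'‖
      ≤ 8 * exp 1 * kernelConst * M * n * (‖x - x'‖ + exp (-n)) := by
  have hk := kernelConst_nonneg
  have hn0 : 0 < n := one_pos.trans_le hn
  simp only [coulombField, coulombField_integrand]
  rw [← smul_sub, ← integral_sub (integrable_coulombField hρ hM x)
    (integrable_coulombField hρ hM x'), norm_smul, Real.norm_of_nonneg (by positivity)]
  refine (mul_le_of_le_one_left (norm_nonneg _) one_div_four_pi_le_one).trans ?_
  rw [← ENNReal.ofReal_le_ofReal_iff (by positivity), ofReal_norm]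
  refine (enorm_integral_le_lintegral_enorm _).trans (le_trans (lintegral_mono fun y => ?_)
    (lintegral_coulombKernel_sub_le hρ hM hn x x'))
  rw [← smul_sub, enorm_smul, mul_comm]

/-! ### The self-consistent field of a weak solution with bounded density -/

instance : (volume : Measure (R3 × R3)).IsAddHaarMeasure :=
  inferInstanceAs ((volume : Measure R3).prod (volume : Measure R3)).IsAddHaarMeasure

theorem IsRegularSource.mono {M M' : ℝ} {ρ : R3 → ℝ} (h : IsRegularSource M ρ) (hM : M ≤ M') :
    IsRegularSource M' ρ :=
  ⟨h.aestronglyMeasurable, h.bound.mono fun _ hy => hy.trans (ENNReal.ofReal_le_ofReal hM),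
    h.mass.trans (ENNReal.ofReal_le_ofReal hM)⟩

theorem volume_restrict_Icc_prod_univ_le (T : ℝ) :
    (volume : Measure (ℝ × R3 × R3)).restrict (Icc 0 T ×ˢ univ)
      ≤ volume.restrict (Ici 0 ×ˢ univ) :=
  Measure.restrict_mono (prod_mono Icc_subset_Ici_self subset_rfl) le_rfl

theorem IsWeakSolution.integrableOn {ω : ℝ} {fin : R3 × R3 → ℝ} {f : ℝ → R3 × R3 → ℝ}
    (h : IsWeakSolution ω fin f) {T : ℝ} (hT : 0 < T) :
    IntegrableOn (Function.uncurry f) (Icc 0 T ×ˢ univ) := by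
  have hm : AEStronglyMeasurable (Function.uncurry f)
      ((volume : Measure (ℝ × R3 × R3)).restrict (Icc 0 T ×ˢ univ)) :=
    h.measurable.mono_measure (volume_restrict_Icc_prod_univ_le T)
  refine ⟨hm, ?_⟩
  obtain ⟨C, hC⟩ := h.mass_bound T hT
  rw [volume_restrict_Icc_prod_univ] at hm ⊢
  unfold HasFiniteIntegral
  rw [lintegral_prod _ hm.enorm]
  calc _ ≤ ∫⁻ _t in Icc 0 T, ENNReal.ofReal C := by
        refine lintegral_mono_ae ?_
        filter_upwards [hC] with t ht
        rwa [eLpNorm_one_eq_lintegral_enorm] at ht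
    _ < ∞ := by
        rw [lintegral_const]
        exact ENNReal.mul_lt_top ENNReal.ofReal_lt_top (measure_lt_top _ _)

/-- The field `E_f` agrees at almost every time in `[0, T]` with a field which is jointly
measurable, bounded and log-Lipschitz at every time. -/
theorem IsWeakSolution.exists_regular_field {ω : ℝ} {fin : R3 × R3 → ℝ} {f : ℝ → R3 × R3 → ℝ}
    (h : IsWeakSolution ω fin f) (hρ : HasBoundedDensity f) {T : ℝ} (hT : 0 < T) :
    ∃ (M : ℝ) (E : ℝ → R3 → R3), 0 ≤ M ∧ Measurable (Function.uncurry E) ∧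
      (∀ t x, ‖E t x‖ ≤ kernelConst * M) ∧
      (∀ t x x' n, 1 ≤ n →
        ‖E t x - E t x'‖ ≤ 8 * exp 1 * kernelConst * M * n * (‖x - x'‖ + exp (-n))) ∧
      ∀ᵐ t ∂(volume.restrict (Icc 0 T)), E t = coulombField (density f t) ∧
        IsRegularSource M (density f t) := by
  have hm : AEStronglyMeasurable (Function.uncurry f)
      ((volume : Measure (ℝ × R3 × R3)).restrict (Icc 0 T ×ˢ univ)) :=
    (h.integrableOn hT).aestronglyMeasurable
  -- `f` is only almost everywhere equal to a measurable function. Joint measurability of the field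
  -- is obtained from the measurable version `f'`, which has the same density at almost every time.
  obtain ⟨f', hf'm, hff'⟩ := hm
  set ρ' : ℝ × R3 → ℝ := fun p => ∫ v, f' (p.1, p.2, v) with hρ'
  have hρ'm : StronglyMeasurable ρ' := by
    have : StronglyMeasurable fun q : (ℝ × R3) × R3 => f' (q.1.1, q.1.2, q.2) :=
      hf'm.comp_measurable (by fun_prop)
    exact this.integral_prod_right'
  -- slices of the two versions coincide
  have hslice : ∀ᵐ t ∂(volume.restrict (Icc (0 : ℝ) T)), ∀ᵐ z : R3 × R3, f t z = f' (t, z) := by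
    rw [volume_restrict_Icc_prod_univ] at hff'
    exact Measure.ae_ae_of_ae_prod hff'
  have hdens : ∀ᵐ t ∂(volume.restrict (Icc (0 : ℝ) T)),
      density f t =ᵐ[volume] fun x => ρ' (t, x) := by
    filter_upwards [hslice] with t ht
    filter_upwards [Measure.ae_ae_of_ae_prod (μ := (volume : Measure R3))
      (ν := (volume : Measure R3)) ht] with x hx
    exact integral_congr_ae hx
  obtain ⟨C, hC⟩ := h.mass_bound T hT
  set M := max (max C 0)
    (eLpNorm (fun p : ℝ × R3 => density f p.1 p.2) ⊤ (volume.restrict (Icc 0 T ×ˢ univ))).toReal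
  have hM : 0 ≤ M := (le_max_right _ _).trans (le_max_left _ _)
  have hCM : C ≤ M := (le_max_left _ _).trans (le_max_left _ _)
  have hbound : ∀ᵐ t ∂(volume.restrict (Icc (0 : ℝ) T)), ∀ᵐ x : R3,
      ‖density f t x‖ₑ ≤ ENNReal.ofReal M := by
    have h1 : ∀ᵐ p ∂((volume : Measure (ℝ × R3)).restrict (Icc 0 T ×ˢ univ)),
        ‖density f p.1 p.2‖ₑ ≤ ENNReal.ofReal M := by
      have h2 := (hρ T hT).eLpNorm_ne_top
      filter_upwards [ae_le_eLpNormEssSup (f := fun p : ℝ × R3 => density f p.1 p.2)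
        (μ := (volume : Measure (ℝ × R3)).restrict (Icc 0 T ×ˢ univ))] with p hp
      rw [← eLpNorm_exponent_top] at hp
      exact hp.trans ((ENNReal.ofReal_toReal h2).symm.trans_le
        (ENNReal.ofReal_le_ofReal (le_max_right _ _)))
    rw [volume_restrict_Icc_prod_univ] at h1
    exact Measure.ae_ae_of_ae_prod h1
  have hreg : ∀ᵐ t ∂(volume.restrict (Icc (0 : ℝ) T)), IsRegularSource M fun x => ρ' (t, x) := by
    filter_upwards [hslice, hdens, hbound, hC] with t h1 h2 h3 h4
    refine ⟨(hρ'm.comp_measurable measurable_prodMk_left).aestronglyMeasurable, ?_, ?_⟩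
    · filter_upwards [h2, h3] with x hx1 hx2
      rwa [← hx1]
    · have hfm : Measurable fun z : R3 × R3 => ‖f' (t, z)‖ₑ :=
        (hf'm.comp_measurable measurable_prodMk_left).measurable.enorm
      calc ∫⁻ x, ‖ρ' (t, x)‖ₑ ≤ ∫⁻ x : R3, ∫⁻ v : R3, ‖f' (t, x, v)‖ₑ :=
            lintegral_mono fun x => enorm_integral_le_lintegral_enorm _
        _ = ∫⁻ z : R3 × R3, ‖f' (t, z)‖ₑ := (lintegral_prod _ hfm.aemeasurable).symm
        _ = ∫⁻ z : R3 × R3, ‖f t z‖ₑ := by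
            refine lintegral_congr_ae ?_
            filter_upwards [h1] with z hz
            rw [hz]
        _ ≤ ENNReal.ofReal C := by rwa [eLpNorm_one_eq_lintegral_enorm] at h4
        _ ≤ _ := ENNReal.ofReal_le_ofReal hCM
  -- `G` is a measurable set of good times of full measure in `[0, T]`; setting the field to zero
  -- outside `G` makes the bounds hold at every time.
  obtain ⟨G, hG, hGm, hGreg⟩ := hreg.exists_measurable_mem
  set E : ℝ → R3 → R3 := fun t x =>
    G.indicator (fun t => coulombField (fun y => ρ' (t, y)) x) t with hE
  have hEin : ∀ t ∈ G, E t = coulombField fun y => ρ' (t, y) := fun t ht =>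
    funext fun x => indicator_of_mem ht _
  have hEout : ∀ t ∉ G, E t = 0 := fun t ht => funext fun x => indicator_of_notMem ht _
  have hk := kernelConst_nonneg
  refine ⟨M, E, hM, ?_, fun t x => ?_, fun t x x' n hn => ?_, ?_⟩
  · have hmeas : Measurable fun p : ℝ × R3 => coulombField (fun y => ρ' (p.1, y)) p.2 := by
      have h1 : StronglyMeasurable fun q : (ℝ × R3) × R3 =>
          (ρ' (q.1.1, q.2) / ‖q.1.2 - q.2‖ ^ 3) • (q.1.2 - q.2) := by
        refine Measurable.stronglyMeasurable ?_
        have h2 : Measurable fun q : (ℝ × R3) × R3 => ρ' (q.1.1, q.2) :=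
          hρ'm.measurable.comp (by fun_prop)
        fun_prop
      exact (h1.integral_prod_right'.const_smul (1 / (4 * π))).measurable
    have : Function.uncurry E = (G ×ˢ (univ : Set R3)).indicator
        fun p : ℝ × R3 => coulombField (fun y => ρ' (p.1, y)) p.2 := by
      funext p
      by_cases hp : p.1 ∈ G
      · rw [indicator_of_mem (by simpa using hp)]
        exact congrFun (hEin p.1 hp) p.2
      · rw [indicator_of_notMem (by simpa using hp)]
        exact congrFun (hEout p.1 hp) p.2
    rw [this]
    exact hmeas.indicator (hGm.prod MeasurableSet.univ)
  · by_cases ht : t ∈ G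
    · rw [hEin t ht]; exact norm_coulombField_le (hGreg t ht) hM x
    · rw [hEout t ht]; simp only [Pi.zero_apply, norm_zero]; positivity
  · by_cases ht : t ∈ G
    · rw [hEin t ht]; exact norm_coulombField_sub_le (hGreg t ht) hM hn x x'
    · have := exp_pos (-n)
      have := one_pos.trans_le hn
      rw [hEout t ht]; simp only [Pi.zero_apply, sub_self, norm_zero]; positivity
  · filter_upwards [hG, hdens] with t h1 h2
    have h3 := hGreg t h1
    refine ⟨by rw [hEin t h1, coulombField_congr h2], ⟨h3.aestronglyMeasurable.congr h2.symm,
      ?_, ?_⟩⟩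
    · filter_upwards [h2, h3.bound] with x hx1 hx2
      rwa [hx1]
    · refine (lintegral_congr_ae ?_).trans_le h3.mass
      filter_upwards [h2] with x hx
      rw [hx]

/-! ### The Lorentz force field in phase space -/

/-- The phase space vector field `(v, E + v ∧ B)`. -/
noncomputable def lorentzField (ω : ℝ) (E : ℝ → R3 → R3) (t : ℝ) (z : R3 × R3) : R3 × R3 :=
  (z.2, E t z.1 + wedge z.2 (magneticField ω))

/-- The linear map `v ↦ v ∧ w`. -/
noncomputable def wedgeRight (w : R3) : R3 →L[ℝ] R3 :=
  LinearMap.toContinuousLinearMap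
    ((WithLp.linearEquiv 2 ℝ (Fin 3 → ℝ)).symm.toLinearMap ∘ₗ
      ((crossProduct (R := ℝ)).flip w.ofLp) ∘ₗ (WithLp.linearEquiv 2 ℝ (Fin 3 → ℝ)).toLinearMap)

/-- The linear part `(v, v ∧ B)` is Lipschitz, and a Lipschitz bound is a special case of the
modulus because `r ≤ n (r + e^{-n})` for `n ≥ 1`. -/
theorem logLipschitzField_lorentzField (ω : ℝ) {E : ℝ → R3 → R3} {M' C : ℝ} (hM' : 0 ≤ M')
    (hC : 0 ≤ C) (hm : Measurable (Function.uncurry E)) (hbd : ∀ t x, ‖E t x‖ ≤ M')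
    (hmod : ∀ t x x' n, 1 ≤ n → ‖E t x - E t x'‖ ≤ C * n * (‖x - x'‖ + exp (-n))) :
    LogLipschitzField (1 + ‖wedgeRight (magneticField ω)‖ + C)
      (1 + ‖wedgeRight (magneticField ω)‖ + M') (lorentzField ω E) := by
  set W := wedgeRight (magneticField ω)
  have hW : 0 ≤ ‖W‖ := norm_nonneg _
  refine ⟨?_, by positivity, by positivity, fun t z => ?_, fun t z z' n hn => ?_⟩
  · have h1 : Measurable fun p : ℝ × R3 × R3 => E p.1 p.2.1 :=
      hm.comp (measurable_fst.prodMk (measurable_fst.comp measurable_snd))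
    exact (measurable_snd.comp measurable_snd).prodMk
      (h1.add (W.continuous.measurable.comp (measurable_snd.comp measurable_snd)))
  · have h1 := norm_snd_le z
    have h2 : ‖E t z.1 + W z.2‖ ≤ M' + ‖W‖ * ‖z‖ :=
      (norm_add_le _ _).trans (add_le_add (hbd t z.1)
        ((W.le_opNorm _).trans (mul_le_mul_of_nonneg_left h1 hW)))
    refine (Prod.norm_def _).trans_le (max_le ?_ ?_)
    · change ‖z.2‖ ≤ _
      nlinarith [norm_nonneg z]
    · change ‖E t z.1 + W z.2‖ ≤ _
      nlinarith [norm_nonneg z]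
  · have h0 := exp_pos (-n)
    have h1 : ‖z.1 - z'.1‖ ≤ ‖z - z'‖ := norm_fst_le (z - z')
    have h2 : ‖z.2 - z'.2‖ ≤ ‖z - z'‖ := norm_snd_le (z - z')
    have hn0 := one_pos.trans_le hn
    have h3 : ‖z - z'‖ ≤ n * (‖z - z'‖ + exp (-n)) := by
      nlinarith [norm_nonneg (z - z')]
    have h4 : ‖E t z.1 - E t z'.1‖ ≤ C * (n * (‖z - z'‖ + exp (-n))) := by
      refine (hmod t _ _ n hn).trans ?_
      rw [mul_assoc]
      gcongr
    have h5 : ‖W (z.2 - z'.2)‖ ≤ ‖W‖ * (n * (‖z - z'‖ + exp (-n))) :=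
      (W.le_opNorm _).trans (mul_le_mul_of_nonneg_left (h2.trans h3) hW)
    have h6 : 0 ≤ n * (‖z - z'‖ + exp (-n)) := by positivity
    have e : lorentzField ω E t z - lorentzField ω E t z'
        = (z.2 - z'.2, (E t z.1 - E t z'.1) + W (z.2 - z'.2)) := by
      rw [map_sub, ← add_sub_add_comm]; rfl
    rw [e, mul_assoc]
    refine (Prod.norm_def _).trans_le (max_le ?_ ?_)
    · refine (h2.trans h3).trans (le_mul_of_one_le_left h6 ?_)
      linarith
    · refine (norm_add_le _ _).trans ?_
      change ‖E t z.1 - E t z'.1‖ + ‖W (z.2 - z'.2)‖ ≤ _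
      nlinarith

/-- Test functions vanishing from time `T` on reduce the weak formulation to `[0, T]`, and there the
field may be replaced by any version equal to it at almost every time. -/
theorem IsWeakSolution.isLinearWeakSolution {ω : ℝ} {fin : R3 × R3 → ℝ} {f : ℝ → R3 × R3 → ℝ}
    (h : IsWeakSolution ω fin f) (hfin : Integrable fin) {T : ℝ} (hT : 0 < T)
    {E : ℝ → R3 → R3}
    (hE : ∀ᵐ t ∂(volume.restrict (Icc 0 T)), E t = coulombField (density f t)) :
    IsLinearWeakSolution (lorentzField ω E) T fin (Function.uncurry f) := by
  refine ⟨hfin, h.integrableOn hT, fun φ hφ hφc hφT => ?_⟩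
  refine Eq.trans ?_ (h.weak_eq φ hφ hφc)
  congr 1
  have hae : ∀ᵐ p ∂((volume : Measure (ℝ × R3 × R3)).restrict (Icc 0 T ×ˢ univ)),
      E p.1 = coulombField (density f p.1) := by
    rw [volume_restrict_Icc_prod_univ]
    exact Measure.quasiMeasurePreserving_fst.ae hE
  have h1 : ∫ p in Icc 0 T ×ˢ (univ : Set (R3 × R3)),
      Function.uncurry f p * fderiv ℝ φ p (1, lorentzField ω E p.1 p.2)
      = ∫ p in Icc 0 T ×ˢ (univ : Set (R3 × R3)), f p.1 p.2 * fderiv ℝ φ p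
          (1, p.2.2, electricField f p.1 p.2.1 + wedge p.2.2 (magneticField ω)) := by
    refine integral_congr_ae ?_
    filter_upwards [hae] with p hp
    rw [lorentzField, hp, electricField_eq]
    rfl
  rw [h1]
  refine (setIntegral_eq_of_subset_of_forall_sdiff_eq_zero
    (measurableSet_Ici.prod MeasurableSet.univ) (prod_mono Icc_subset_Ici_self subset_rfl)
    fun p hp => ?_).symm
  have hpT : T < p.1 := by
    by_contra hle
    exact hp.2 ⟨⟨hp.1.1, not_lt.1 hle⟩, mem_univ _⟩
  have : fderiv ℝ φ p = 0 := by
    have heq : φ =ᶠ[𝓝 p] fun _ => 0 := by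
      filter_upwards [(isOpen_lt continuous_const continuous_fst).mem_nhds hpT] with q hq
      exact hφT q.1 q.2 (le_of_lt hq)
    rw [heq.fderiv_eq]
    exact fderiv_const_apply 0
  rw [this]
  simp

/-! ### Comparison of two transported densities -/

/-- Nonnegativity is essential here: it is what makes the positive part commute with integration in
`v`. -/
theorem densityMeasure_marginal {g : R3 × R3 → ℝ} (hg : Integrable g) (hg0 : ∀ᵐ z, 0 ≤ g z) :
    densityMeasure (fun x => ∫ v, g (x, v)) = (densityMeasure g).map Prod.fst := by
  have hgi : Integrable g ((volume : Measure R3).prod (volume : Measure R3)) := hg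
  ext A hA
  have hm : AEMeasurable (fun z => ENNReal.ofReal (g z))
      ((volume : Measure R3).prod (volume : Measure R3)) :=
    hgi.aestronglyMeasurable.aemeasurable.ennreal_ofReal
  have hpre : (Prod.fst ⁻¹' A : Set (R3 × R3)) = A ×ˢ univ := by ext; simp
  rw [densityMeasure, withDensity_apply _ hA, Measure.map_apply measurable_fst hA, hpre,
    densityMeasure, withDensity_apply _ (hA.prod MeasurableSet.univ), Measure.volume_eq_prod,
    ← Measure.prod_restrict, Measure.restrict_univ,
    lintegral_prod _ (hm.mono_measure (Measure.prod_mono Measure.restrict_le_self le_rfl))]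
  refine lintegral_congr_ae (ae_restrict_of_ae ?_)
  filter_upwards [hgi.prod_right_ae, Measure.ae_ae_of_ae_prod (μ := (volume : Measure R3))
    (ν := (volume : Measure R3)) hg0] with x h1 h2
  exact ofReal_integral_eq_lintegral_ofReal h1 h2

theorem coulombKernel_neg (a : R3) : coulombKernel (-a) = -coulombKernel a := by
  simp [coulombKernel]

section Comparison

variable {Y : Type*} [MeasurableSpace Y] {m₀ : Measure Y} {M : ℝ} {ρ : R3 → ℝ}
  {X : Y → R3}

theorem lintegral_comp_eq_of_densityMeasure_eq_map (hρ : AEStronglyMeasurable ρ)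
    (hX : Measurable X) (h : densityMeasure ρ = m₀.map X) {g : R3 → ℝ≥0∞} (hg : Measurable g) :
    ∫⁻ y, g (X y) ∂m₀ = ∫⁻ x, ENNReal.ofReal (ρ x) * g x := by
  rw [← lintegral_map hg hX, ← h, densityMeasure,
    lintegral_withDensity_eq_lintegral_mul₀ hρ.aemeasurable.ennreal_ofReal hg.aemeasurable]
  rfl

theorem measurable_coulombKernel_sub (x : R3) : Measurable fun y => coulombKernel (x - y) :=
  measurable_coulombKernel.comp (measurable_const.sub measurable_id)

theorem integrable_coulombKernel_comp (hρ : IsRegularSource M ρ) (hM : 0 ≤ M)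
    (hX : Measurable X) (h : densityMeasure ρ = m₀.map X) (x : R3) :
    Integrable (fun y => coulombKernel (x - X y)) m₀ := by
  refine ⟨((measurable_coulombKernel_sub x).comp hX).aestronglyMeasurable, ?_⟩
  unfold HasFiniteIntegral
  rw [lintegral_comp_eq_of_densityMeasure_eq_map hρ.aestronglyMeasurable hX h
    (measurable_coulombKernel_sub x).enorm]
  refine lt_of_le_of_lt (lintegral_mono fun y => ?_)
    ((lintegral_coulombKernel_le hρ hM x).trans_lt ENNReal.ofReal_lt_top)
  rw [mul_comm]
  gcongr
  exact ofReal_le_enorm _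

theorem coulombField_eq_integral (hρ : IsRegularSource M ρ) (hρ0 : ∀ᵐ y, 0 ≤ ρ y)
    (hX : Measurable X) (h : densityMeasure ρ = m₀.map X) (x : R3) :
    coulombField ρ x = (1 / (4 * π)) • ∫ y, coulombKernel (x - X y) ∂m₀ := by
  simp only [coulombField, coulombField_integrand]
  rw [← integral_map (f := fun w => coulombKernel (x - w)) hX.aemeasurable
    (measurable_coulombKernel_sub x).aestronglyMeasurable, ← h, densityMeasure,
    integral_withDensity_eq_integral_toReal_smul₀
      hρ.aestronglyMeasurable.aemeasurable.ennreal_ofReal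
      (ae_of_all _ fun _ => ENNReal.ofReal_lt_top)]
  congr 1
  refine integral_congr_ae ?_
  filter_upwards [hρ0] with y hy
  rw [ENNReal.toReal_ofReal hy]

/-- The difference of the fields generated by two transported densities, averaged along one of
the two transport maps, is controlled by the distance of the transport maps. -/
theorem lintegral_coulombField_sub_comp_le [SFinite m₀] {ρ' : R3 → ℝ} {X' : Y → R3}
    {E E' : R3 → R3} (hρ : IsRegularSource M ρ) (hρ' : IsRegularSource M ρ') (hM : 0 ≤ M)
    (hρ0 : ∀ᵐ y, 0 ≤ ρ y) (hρ'0 : ∀ᵐ y, 0 ≤ ρ' y) (hX : Measurable X) (hX' : Measurable X')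
    (h : densityMeasure ρ = m₀.map X) (h' : densityMeasure ρ' = m₀.map X')
    (hE : E = coulombField ρ) (hE' : E' = coulombField ρ') (hEm : Measurable E)
    (hEm' : Measurable E') {n : ℝ} (hn : 1 ≤ n) :
    ∫⁻ y, ‖E (X' y) - E' (X' y)‖ₑ ∂m₀
      ≤ ∫⁻ y, ENNReal.ofReal (8 * exp 1 * kernelConst * M * n * (‖X y - X' y‖ + exp (-n))) ∂m₀ := by
  have hKm : Measurable fun p : R3 × Y =>
      ‖coulombKernel (p.1 - X p.2) - coulombKernel (p.1 - X' p.2)‖ₑ :=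
    ((measurable_coulombKernel.comp (measurable_fst.sub (hX.comp measurable_snd))).sub
      (measurable_coulombKernel.comp (measurable_fst.sub (hX'.comp measurable_snd)))).enorm
  -- Both fields are averages of the kernel over the same measure `m₀`, so their difference is the
  -- average of a kernel difference.
  have hpt : ∀ x, ‖E x - E' x‖ₑ
      ≤ ∫⁻ y, ‖coulombKernel (x - X y) - coulombKernel (x - X' y)‖ₑ ∂m₀ := fun x => by
    rw [hE, hE', coulombField_eq_integral hρ hρ0 hX h, coulombField_eq_integral hρ' hρ'0 hX' h',
      ← smul_sub, ← integral_sub (integrable_coulombKernel_comp hρ hM hX h x)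
        (integrable_coulombKernel_comp hρ' hM hX' h' x), enorm_smul]
    refine (mul_le_of_le_one_left' ?_).trans (enorm_integral_le_lintegral_enorm _)
    rw [← ofReal_norm, Real.norm_of_nonneg (by positivity)]
    exact ENNReal.ofReal_le_one.2 one_div_four_pi_le_one
  calc ∫⁻ y, ‖E (X' y) - E' (X' y)‖ₑ ∂m₀ = ∫⁻ x, ENNReal.ofReal (ρ' x) * ‖E x - E' x‖ₑ :=
        lintegral_comp_eq_of_densityMeasure_eq_map hρ'.aestronglyMeasurable hX' h'
          (hEm.sub hEm').enorm
    _ ≤ ∫⁻ x, ∫⁻ y, ‖ρ' x‖ₑ * ‖coulombKernel (x - X y) - coulombKernel (x - X' y)‖ₑ ∂m₀ := by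
        refine lintegral_mono fun x => ?_
        rw [lintegral_const_mul' _ _ enorm_ne_top]
        gcongr
        · exact ofReal_le_enorm _
        · exact hpt x
    -- After Tonelli the inner integral is, since the kernel is odd, the log-Lipschitz estimate for
    -- the source `ρ'` between the points `X y` and `X' y`.
    _ = ∫⁻ y, (∫⁻ x, ‖ρ' x‖ₑ * ‖coulombKernel (x - X y) - coulombKernel (x - X' y)‖ₑ) ∂m₀ := by
        refine lintegral_lintegral_swap ?_
        exact (hρ'.aestronglyMeasurable.enorm.comp_fst).mul hKm.aemeasurable
    _ ≤ _ := by
        refine lintegral_mono fun y => ?_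
        refine le_trans (lintegral_mono fun x => ?_)
          (lintegral_coulombKernel_sub_le hρ' hM hn (X y) (X' y))
        rw [mul_comm, ← neg_sub (X y) x, ← neg_sub (X' y) x, coulombKernel_neg, coulombKernel_neg,
          neg_sub_neg, enorm_sub_rev]

end Comparison

/-! ### Stability of the coupled characteristics -/

theorem norm_lorentzField_sub_le {ω : ℝ} {E E' : ℝ → R3 → R3} (t : ℝ) (z z' : R3 × R3) :
    ‖lorentzField ω E t z - lorentzField ω E' t z'‖
      ≤ ‖lorentzField ω E t z - lorentzField ω E t z'‖ + ‖E t z'.1 - E' t z'.1‖ := by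
  refine (norm_sub_le_norm_sub_add_norm_sub _ (lorentzField ω E t z') _).trans
    (add_le_add le_rfl (le_of_eq ?_))
  have : lorentzField ω E t z' - lorentzField ω E' t z' = (0, E t z'.1 - E' t z'.1) := by
    simp [lorentzField]
  rw [this, Prod.norm_def, norm_zero]
  exact max_eq_right (norm_nonneg _)

set_option maxHeartbeats 800000 in
/-- If the difference of two force fields is controlled, on average along the characteristics, by
the distance of the characteristics, then the characteristics coincide. -/
theorem ae_trajectory_eq {ω T C A C' A' B C₁ : ℝ} {E E' : ℝ → R3 → R3}
    {m₀ : Measure (R3 × R3)} [IsProbabilityMeasure m₀]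
    (hb : LogLipschitzField C A (lorentzField ω E))
    (hb' : LogLipschitzField C' A' (lorentzField ω E'))
    (hEm : Measurable (Function.uncurry E)) (hEm' : Measurable (Function.uncurry E'))
    (hB : ∀ t x, ‖E t x - E' t x‖ ≤ B) (hC₁ : 0 ≤ C₁)
    (hfield : ∀ᵐ t ∂(volume.restrict (Icc 0 T)), ∀ n : ℝ, 1 ≤ n →
      ∫⁻ z, ‖E t (trajectory (lorentzField ω E') t z).1
          - E' t (trajectory (lorentzField ω E') t z).1‖ₑ ∂m₀
        ≤ ∫⁻ z, ENNReal.ofReal (C₁ * n * (‖trajectory (lorentzField ω E) t z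
            - trajectory (lorentzField ω E') t z‖ + exp (-n))) ∂m₀) :
    ∀ t ∈ Icc 0 T, ∀ᵐ z ∂m₀,
      trajectory (lorentzField ω E) t z = trajectory (lorentzField ω E') t z := by
  set b := lorentzField ω E
  set b' := lorentzField ω E'
  have hC := hb.nonneg
  have hB0 : 0 ≤ B := (norm_nonneg _).trans (hB 0 0)
  have hZm := measurable_trajectory hb
  have hZm' := measurable_trajectory hb'
  set D : ℝ × (R3 × R3) → ℝ := fun p => ‖trajectory b p.1 p.2 - trajectory b' p.1 p.2‖ with hD
  have hDm : Measurable D := (hZm.sub hZm').norm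
  have hD0 : ∀ p, 0 ≤ D p := fun p => norm_nonneg _
  set e : ℝ × (R3 × R3) → ℝ := fun p =>
    ‖E p.1 (trajectory b' p.1 p.2).1 - E' p.1 (trajectory b' p.1 p.2).1‖ with he
  have hem : Measurable e := by
    have h1 : Measurable fun p : ℝ × (R3 × R3) => (p.1, (trajectory b' p.1 p.2).1) :=
      measurable_fst.prodMk (measurable_fst.comp hZm')
    exact ((hEm.comp h1).sub (hEm'.comp h1)).norm
  -- uniform bound on the distance of the characteristics
  have hDcont : ∀ z, Continuous fun t => D (t, z) := fun z =>
    ((continuous_trajectory hb z).sub (continuous_trajectory hb' z)).norm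
  -- The difference is split so that the two fields `E`, `E'` are compared along the second flow,
  -- which is where `hfield` controls them on average.
  have hstep : ∀ r z n, 1 ≤ n → 0 ≤ r → ‖b r (flow b 0 z r) - b' r (flow b' 0 z r)‖
      ≤ C * n * (D (r, z) + exp (-n)) + e (r, z) := fun r z n hn hr => by
    simp only [hD, he, trajectory_of_nonneg _ hr]
    refine (norm_lorentzField_sub_le _ _ _).trans (add_le_add (hb.modulus _ _ _ n hn) le_rfl)
  -- A crude bound from the modulus at `n = 1`. It only serves to make the averaged distance finite
  -- and integrable in time.
  have hDbound : ∃ R : ℝ, 0 ≤ R ∧ ∀ t ∈ Icc 0 T, ∀ z, D (t, z) ≤ R := by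
    refine ⟨exp (C * |T|) * ((C + B) * |T|), by positivity, fun t ht z => ?_⟩
    have h := gronwall_integral_const (u := fun t => D (t, z)) (a := 0) (t₀ := 0) (S := T)
      (σ := C + B) hC (by positivity) (hDcont z).continuousOn.integrableOn_Icc (fun s hs => ?_) t ht
    · refine h.trans ?_
      have h1 : t - 0 ≤ |T| := by rw [sub_zero]; exact ht.2.trans (le_abs_self T)
      have h2 : 0 ≤ t - 0 := by simpa using ht.1
      rw [zero_add]
      gcongr
    · have h1 := (isSolution_flow hb 0 z).norm_sub_le_of_le hb hb' (isSolution_flow hb' 0 z)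
        (s := s) (g := fun r => C * D (r, z) + (C + B)) hs.1
        ((continuous_const.mul (hDcont z)).add continuous_const) fun r hr => by
          refine (hstep r z 1 le_rfl hr.1).trans ?_
          have h2 : exp (-1) ≤ 1 := exp_le_one_iff.2 (by norm_num)
          have h3 : e (r, z) ≤ B := hB _ _
          nlinarith
      simpa [hD, trajectory_of_nonneg _ hs.1] using h1
  obtain ⟨R, hR0, hR⟩ := hDbound
  set q : ℝ → ℝ≥0∞ := fun t => ∫⁻ z, ENNReal.ofReal (D (t, z)) ∂m₀ with hq
  have hqm : Measurable q := hDm.ennreal_ofReal.lintegral_prod_right'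
  have hqR : ∀ t ∈ Icc 0 T, q t ≤ ENNReal.ofReal R := fun t ht => by
    calc q t ≤ ∫⁻ _z, ENNReal.ofReal R ∂m₀ :=
          lintegral_mono fun z => ENNReal.ofReal_le_ofReal (hR t ht z)
      _ = ENNReal.ofReal R := by simp
  have hqtop : ∀ t ∈ Icc 0 T, q t ≠ ∞ := fun t ht =>
    ((hqR t ht).trans_lt ENNReal.ofReal_lt_top).ne
  set u : ℝ → ℝ := fun t => (q t).toReal with hu
  have hum : Measurable u := hqm.ennreal_toReal
  have hu0 : ∀ t, 0 ≤ u t := fun t => ENNReal.toReal_nonneg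
  have hui : IntegrableOn u (Icc 0 T) := by
    refine (integrableOn_const (C := R) (measure_Icc_lt_top.ne)).mono' hum.aestronglyMeasurable ?_
    filter_upwards [ae_restrict_mem measurableSet_Icc] with t ht
    rw [Real.norm_of_nonneg (hu0 t)]
    exact ENNReal.toReal_le_of_le_ofReal hR0 (hqR t ht)
  -- Osgood's lemma is applied to the average `u(t)` of the distance over `m₀`. The rate `C + C₁`
  -- adds the modulus of the first phase space field and the averaged difference of the two force
  -- fields.
  have hu_le : ∀ t ∈ Icc 0 T, u t ≤ 0 := by
    refine osgood_integral_zero (C := C + C₁) (by positivity) hui fun N hN t ht => ?_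
    set n := scale (C + C₁) T N with hn
    have hN0 := one_pos.trans_le hN
    have hnc : Continuous n := continuous_scale _ _ _
    have hn0 : ∀ s, 0 < n s := fun s => scale_pos hN0 s
    have hn1 : ∀ s ≤ T, 1 ≤ n s := fun s hs => hN.trans (le_scale (by positivity) hN0.le hs)
    have hIoc : ∀ s ∈ Ioc 0 t, s ∈ Icc 0 T := fun s hs => ⟨hs.1.le, hs.2.trans ht.2⟩
    -- the integral inequality along each pair of characteristics
    have h1 : ∀ z, ENNReal.ofReal (D (t, z)) ≤ ∫⁻ s in Ioc 0 t,
        (ENNReal.ofReal (C * n s * (D (s, z) + exp (-n s))) + ENNReal.ofReal (e (s, z))) := by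
      intro z
      have h2 := (isSolution_flow hb 0 z).norm_sub_le_integral hb hb' (isSolution_flow hb' 0 z) ht.1
      rw [sub_self, norm_zero, zero_add, intervalIntegral.integral_of_le ht.1] at h2
      have h3 : D (t, z) = ‖flow b 0 z t - flow b' 0 z t‖ := by
        simp only [hD, trajectory_of_nonneg _ ht.1]
      have hii : IntegrableOn (fun r => ‖b r (flow b 0 z r) - b' r (flow b' 0 z r)‖) (Ioc 0 t) :=
        (((hb.intervalIntegrable (isSolution_flow hb 0 z).continuous 0 t).sub
          (hb'.intervalIntegrable (isSolution_flow hb' 0 z).continuous 0 t)).norm).1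
      rw [h3]
      refine (ENNReal.ofReal_le_ofReal h2).trans ?_
      rw [ofReal_integral_eq_lintegral_ofReal hii (ae_of_all _ fun _ => norm_nonneg _)]
      refine setLIntegral_mono' measurableSet_Ioc fun s hs => ?_
      have h4 : 0 ≤ C * n s * (D (s, z) + exp (-n s)) := by
        have := (hn0 s).le
        have := hD0 (s, z)
        positivity
      rw [← ENNReal.ofReal_add h4 (norm_nonneg _)]
      exact ENNReal.ofReal_le_ofReal (hstep s z _ (hn1 s (hIoc s hs).2) hs.1.le)
    have hm1 : Measurable fun p : (R3 × R3) × ℝ =>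
        ENNReal.ofReal (C * n p.2 * (D (p.2, p.1) + exp (-n p.2))) := by
      have h2 : Measurable fun p : (R3 × R3) × ℝ => D (p.2, p.1) := hDm.comp measurable_swap
      have h3 : Measurable fun p : (R3 × R3) × ℝ => n p.2 := hnc.measurable.comp measurable_snd
      exact ((h3.const_mul C).mul (h2.add h3.neg.exp)).ennreal_ofReal
    have hm2 : Measurable fun p : (R3 × R3) × ℝ => ENNReal.ofReal (e (p.2, p.1)) :=
      (hem.comp measurable_swap).ennreal_ofReal
    have hm12 : Measurable (Function.uncurry fun (z : R3 × R3) (s : ℝ) =>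
        ENNReal.ofReal (C * n s * (D (s, z) + exp (-n s))) + ENNReal.ofReal (e (s, z))) :=
      hm1.add hm2
    -- Since `m₀` has total mass 1, averaging leaves the additive error `e^{-n}` unchanged.
    have hlin : ∀ (c : ℝ) (s : ℝ), 0 ≤ c → s ∈ Icc 0 T →
        ∫⁻ z, ENNReal.ofReal (c * n s * (D (s, z) + exp (-n s))) ∂m₀
          = ENNReal.ofReal (c * n s * (u s + exp (-n s))) := by
      intro c s hc hs
      have hns := (hn0 s).le
      have hDs : Measurable fun z => ENNReal.ofReal (D (s, z)) :=
        (hDm.comp measurable_prodMk_left).ennreal_ofReal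
      calc _ = ∫⁻ z, ENNReal.ofReal (c * n s) * (ENNReal.ofReal (D (s, z))
            + ENNReal.ofReal (exp (-n s))) ∂m₀ := by
            refine lintegral_congr fun z => ?_
            rw [ENNReal.ofReal_mul (by positivity), ENNReal.ofReal_add (hD0 _) (exp_pos _).le]
        _ = ENNReal.ofReal (c * n s) * (q s + ENNReal.ofReal (exp (-n s))) := by
            rw [lintegral_const_mul' _ _ ENNReal.ofReal_ne_top, lintegral_add_left hDs]
            simp [hq]
        _ = _ := by
            rw [ENNReal.ofReal_mul (p := c * n s) (by positivity),
              ENNReal.ofReal_add (hu0 s) (exp_pos _).le, hu, ENNReal.ofReal_toReal (hqtop s hs)]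
    have hgi : IntegrableOn (fun s => (C + C₁) * n s * (u s + exp (-n s))) (Ioc 0 t) := by
      have h2 : IntervalIntegrable u volume 0 t :=
        (intervalIntegrable_iff_integrableOn_Ioc_of_le ht.1).2
          (hui.mono_set fun s hs => hIoc s hs)
      have h3 : IntervalIntegrable (fun s => (C + C₁) * n s * (u s + exp (-n s))) volume 0 t :=
        (h2.add ((by fun_prop : Continuous fun s => exp (-n s)).intervalIntegrable _ _)
          ).continuousOn_mul (by fun_prop)
      exact h3.1
    have hg0 : ∀ s, 0 ≤ (C + C₁) * n s * (u s + exp (-n s)) := fun s => by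
      have := (hn0 s).le
      have := hu0 s
      positivity
    have key : q t ≤ ENNReal.ofReal (∫ s in (0 : ℝ)..t, (C + C₁) * n s * (u s + exp (-n s))) := by
      rw [intervalIntegral.integral_of_le ht.1,
        ofReal_integral_eq_lintegral_ofReal hgi (ae_of_all _ hg0)]
      calc q t ≤ ∫⁻ z, (∫⁻ s in Ioc 0 t, (ENNReal.ofReal (C * n s * (D (s, z) + exp (-n s)))
            + ENNReal.ofReal (e (s, z)))) ∂m₀ := lintegral_mono h1
        _ = ∫⁻ s in Ioc 0 t, ∫⁻ z, (ENNReal.ofReal (C * n s * (D (s, z) + exp (-n s)))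
            + ENNReal.ofReal (e (s, z))) ∂m₀ := lintegral_lintegral_swap hm12.aemeasurable
        _ ≤ _ := by
            have hae : ∀ᵐ s ∂(volume.restrict (Ioc 0 t)), ∀ k : ℝ, 1 ≤ k →
                ∫⁻ z, ‖E s (trajectory b' s z).1 - E' s (trajectory b' s z).1‖ₑ ∂m₀
                  ≤ ∫⁻ z, ENNReal.ofReal (C₁ * k * (‖trajectory b s z - trajectory b' s z‖
                    + exp (-k))) ∂m₀ :=
              ae_mono (Measure.restrict_mono hIoc le_rfl) hfield
            refine lintegral_mono_ae ?_
            filter_upwards [hae, ae_restrict_mem measurableSet_Ioc] with s hs1 hs2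
            have hs := hIoc s hs2
            have hmz : Measurable fun z =>
                ENNReal.ofReal (C * n s * (D (s, z) + exp (-n s))) :=
              hm1.comp measurable_prodMk_right
            rw [lintegral_add_left hmz, hlin C s hC hs]
            have h5 : ∫⁻ z, ENNReal.ofReal (e (s, z)) ∂m₀
                ≤ ENNReal.ofReal (C₁ * n s * (u s + exp (-n s))) := by
              rw [← hlin C₁ s hC₁ hs]
              refine le_trans (le_of_eq (lintegral_congr fun z => ?_)) (hs1 (n s) (hn1 s hs.2))
              exact ofReal_norm _
            refine (add_le_add le_rfl h5).trans ?_
            have hns := (hn0 s).le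
            have hus := hu0 s
            rw [← ENNReal.ofReal_add (by positivity) (by positivity)]
            exact ENNReal.ofReal_le_ofReal (le_of_eq (by ring))
    exact ENNReal.toReal_le_of_le_ofReal
      (intervalIntegral.integral_nonneg ht.1 fun s _ => hg0 s) key
  intro t ht
  have hqt : q t = 0 := by
    have := le_antisymm (hu_le t ht) (hu0 t)
    exact ((ENNReal.toReal_eq_zero_iff _).1 this).resolve_right (hqtop t ht)
  have hDt : Measurable fun z => ENNReal.ofReal (D (t, z)) :=
    (hDm.comp measurable_prodMk_left).ennreal_ofReal
  filter_upwards [(lintegral_eq_zero_iff hDt).1 hqt] with z hz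
  have h1 : D (t, z) ≤ 0 := ENNReal.ofReal_eq_zero.1 hz
  exact sub_eq_zero.1 (norm_le_zero_iff.1 h1)

/-! ### Uniqueness -/

/-- At almost every time, the spatial density of a weak solution is nonnegative and is the image
of the initial datum under the characteristics. -/
theorem IsLinearWeakSolution.ae_density_eq_map {C A T : ℝ} {b : ℝ → R3 × R3 → R3 × R3}
    {fin : R3 × R3 → ℝ} {f : ℝ → R3 × R3 → ℝ}
    (hf : IsLinearWeakSolution b T fin (Function.uncurry f)) (hb : LogLipschitzField C A b)
    (hT : 0 < T) (hfin : ∀ᵐ z, 0 ≤ fin z) :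
    ∀ᵐ t ∂(volume.restrict (Icc 0 T)), (∀ᵐ x, 0 ≤ density f t x) ∧
      densityMeasure (density f t)
        = (densityMeasure fin).map fun z => (trajectory b t z).1 := by
  have h1 := hf.ae_nonneg hb hT hfin
  have h2 : Integrable (Function.uncurry f)
    ((volume : Measure (ℝ × R3 × R3)).restrict (Icc 0 T ×ˢ univ)) := hf.integrable
  rw [volume_restrict_Icc_prod_univ] at h1 h2
  filter_upwards [hf.ae_slice_eq_map hb hT hfin, Measure.ae_ae_of_ae_prod h1, h2.prod_right_ae]
    with t ht1 ht2 ht3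
  have ht2' : ∀ᵐ z, 0 ≤ f t z := ht2
  have ht3' : Integrable (f t) := ht3
  have hm : Measurable (trajectory b t) := (measurable_trajectory hb).comp measurable_prodMk_left
  refine ⟨?_, ?_⟩
  · filter_upwards [Measure.ae_ae_of_ae_prod (μ := (volume : Measure R3))
      (ν := (volume : Measure R3)) ht2'] with x hx
    exact integral_nonneg_of_ae hx
  · have h3 : densityMeasure (density f t) = (densityMeasure (f t)).map Prod.fst :=
      densityMeasure_marginal ht3' ht2'
    have h4 : densityMeasure (f t) = (densityMeasure fin).map (trajectory b t) := ht1
    rw [h3, h4, Measure.map_map measurable_fst hm]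
    rfl

theorem isProbabilityMeasure_densityMeasure {fin : R3 × R3 → ℝ} (h : IsProbabilityDensity fin) :
    IsProbabilityMeasure (densityMeasure fin) := by
  refine ⟨?_⟩
  rw [densityMeasure, withDensity_apply _ MeasurableSet.univ, Measure.restrict_univ,
    ← ofReal_integral_eq_lintegral_ofReal h.integrable h.nonneg, h.integral_eq_one,
    ENNReal.ofReal_one]

/-- Uniqueness on bounded time intervals. -/
theorem IsWeakSolution.ae_eq_Icc {ω : ℝ} {fin : R3 × R3 → ℝ} {f₁ f₂ : ℝ → R3 × R3 → ℝ}
    (hfin : IsProbabilityDensity fin) (h₁ : IsWeakSolution ω fin f₁)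
    (h₂ : IsWeakSolution ω fin f₂) (hρ₁ : HasBoundedDensity f₁) (hρ₂ : HasBoundedDensity f₂)
    {T : ℝ} (hT : 0 < T) :
    Function.uncurry f₁ =ᵐ[volume.restrict (Icc 0 T ×ˢ univ)] Function.uncurry f₂ := by
  have := isProbabilityMeasure_densityMeasure hfin
  have hk := kernelConst_nonneg
  obtain ⟨M₁, E₁, hM₁, hm₁, hbd₁, hmod₁, hE₁⟩ := h₁.exists_regular_field hρ₁ hT
  obtain ⟨M₂, E₂, hM₂, hm₂, hbd₂, hmod₂, hE₂⟩ := h₂.exists_regular_field hρ₂ hT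
  have hb₁ := logLipschitzField_lorentzField ω (mul_nonneg hk hM₁) (by positivity) hm₁ hbd₁ hmod₁
  have hb₂ := logLipschitzField_lorentzField ω (mul_nonneg hk hM₂) (by positivity) hm₂ hbd₂ hmod₂
  have hw₁ := h₁.isLinearWeakSolution hfin.integrable hT (hE₁.mono fun _ h => h.1)
  have hw₂ := h₂.isLinearWeakSolution hfin.integrable hT (hE₂.mono fun _ h => h.1)
  set b₁ := lorentzField ω E₁
  set b₂ := lorentzField ω E₂
  set m₀ := densityMeasure fin
  set M := max M₁ M₂
  have hM : 0 ≤ M := hM₁.trans (le_max_left _ _)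
  have hZ₁ := measurable_trajectory hb₁
  have hZ₂ := measurable_trajectory hb₂
  have hfield : ∀ᵐ t ∂(volume.restrict (Icc 0 T)), ∀ n : ℝ, 1 ≤ n →
      ∫⁻ z, ‖E₁ t (trajectory b₂ t z).1 - E₂ t (trajectory b₂ t z).1‖ₑ ∂m₀
        ≤ ∫⁻ z, ENNReal.ofReal (8 * exp 1 * kernelConst * M * n * (‖trajectory b₁ t z
            - trajectory b₂ t z‖ + exp (-n))) ∂m₀ := by
    filter_upwards [hE₁, hE₂, hw₁.ae_density_eq_map hb₁ hT hfin.nonneg,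
      hw₂.ae_density_eq_map hb₂ hT hfin.nonneg] with t e₁ e₂ d₁ d₂ n hn
    refine (lintegral_coulombField_sub_comp_le (e₁.2.mono (le_max_left _ _))
      (e₂.2.mono (le_max_right _ _)) hM d₁.1 d₂.1
      (measurable_fst.comp (hZ₁.comp measurable_prodMk_left))
      (measurable_fst.comp (hZ₂.comp measurable_prodMk_left)) d₁.2 d₂.2 e₁.1 e₂.1
      (hm₁.comp measurable_prodMk_left) (hm₂.comp measurable_prodMk_left) hn).trans
      (lintegral_mono fun z => ENNReal.ofReal_le_ofReal ?_)
    have hle : ‖(trajectory b₁ t z).1 - (trajectory b₂ t z).1‖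
        ≤ ‖trajectory b₁ t z - trajectory b₂ t z‖ :=
      norm_fst_le (trajectory b₁ t z - trajectory b₂ t z)
    have hn0 := one_pos.trans_le hn
    gcongr
    exact hle
  have htraj := ae_trajectory_eq (T := T) (m₀ := m₀) hb₁ hb₂ hm₁ hm₂
    (B := kernelConst * M₁ + kernelConst * M₂)
    (fun t x => (norm_sub_le _ _).trans (add_le_add (hbd₁ t x) (hbd₂ t x)))
    (by positivity) hfield
  -- The flows agree `m₀`-almost everywhere at each time; joint measurability upgrades this to
  -- almost everywhere for the product measure.
  have hae : ∀ᵐ p ∂((volume.restrict (Icc 0 T)).prod m₀),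
      (p.1, trajectory b₁ p.1 p.2) = (p.1, trajectory b₂ p.1 p.2) := by
    have hset : MeasurableSet {p : ℝ × R3 × R3 | trajectory b₁ p.1 p.2 = trajectory b₂ p.1 p.2} :=
      measurableSet_eq_fun hZ₁ hZ₂
    have := (Measure.ae_prod_iff_ae_ae (μ := volume.restrict (Icc 0 T)) (ν := m₀) hset).2 (by
      filter_upwards [ae_restrict_mem measurableSet_Icc] with t ht using htraj t ht)
    filter_upwards [this] with p hp
    rw [hp]
  -- Both solutions now have as density measure the image of the same measure under almost
  -- everywhere equal maps. Nonnegativity then recovers the functions from their positive parts.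
  have heq := (hw₁.withDensity_eq_map hb₁ hT hfin.nonneg).trans
    ((Measure.map_congr hae).trans (hw₂.withDensity_eq_map hb₂ hT hfin.nonneg).symm)
  have hi₁ := hw₁.integrable
  have hfin₁ : ∫⁻ p in Icc 0 T ×ˢ univ, ENNReal.ofReal (Function.uncurry f₁ p) ≠ ∞ :=
    ((lintegral_mono fun p => ofReal_le_enorm _).trans_lt hi₁.2).ne
  rw [withDensity_eq_iff hi₁.aestronglyMeasurable.aemeasurable.ennreal_ofReal
    hw₂.integrable.aestronglyMeasurable.aemeasurable.ennreal_ofReal hfin₁] at heq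
  filter_upwards [heq, hw₁.ae_nonneg hb₁ hT hfin.nonneg, hw₂.ae_nonneg hb₂ hT hfin.nonneg]
    with p hp h1 h2
  exact (ENNReal.ofReal_eq_ofReal_iff h1 h2).1 hp

end VlasovPoisson

theorem theorem2p3 (ω : ℝ) (hω : 0 < ω)
    (fin : VlasovPoisson.R3 × VlasovPoisson.R3 → ℝ)
    (hfin : VlasovPoisson.IsProbabilityDensity fin)
    (hfin_bdd : MemLp fin ⊤ volume)
    (f₁ f₂ : ℝ → VlasovPoisson.R3 × VlasovPoisson.R3 → ℝ)
    (h₁ : VlasovPoisson.IsWeakSolution ω fin f₁)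
    (h₂ : VlasovPoisson.IsWeakSolution ω fin f₂)
    (hρ₁ : VlasovPoisson.HasBoundedDensity f₁)
    (hρ₂ : VlasovPoisson.HasBoundedDensity f₂) :
    Function.uncurry f₁ =ᵐ[volume.restrict (Ici 0 ×ˢ univ)] Function.uncurry f₂ := by
  have hU : (Ici (0 : ℝ) ×ˢ (univ : Set (VlasovPoisson.R3 × VlasovPoisson.R3)))
      = ⋃ k : ℕ, Icc (0 : ℝ) (k + 1) ×ˢ univ := by
    ext p
    simp only [mem_prod, mem_Ici, mem_univ, and_true, mem_iUnion, mem_Icc, exists_and_left,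
      iff_self_and]
    intro _
    obtain ⟨k, hk⟩ := exists_nat_ge p.1
    exact ⟨k, hk.trans (by linarith)⟩
  rw [hU]
  refine (ae_restrict_iUnion_iff _ _).2 fun k => ?_
  exact VlasovPoisson.IsWeakSolution.ae_eq_Icc hfin h₁ h₂ hρ₁ hρ₂ (by positivity)
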